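/- Let $T>0$ and let $\mathcal R\subset SO(3)$ be the rotation group of the tetrahedron, of the octahedron (or cube), or of the icosahedron (or dodecahedron). For $R\in\mathcal R\setminus\{I\}$ let $r(R)=\{x\in\mathbb R^3: Rx=x\}$ be its rotation axis, and let $\Gamma=\bigcup_{R\in\mathcal R\setminus\{I\}} r(R)$ be the collision set. Fix a free-homotopy class of loops in $\mathbb R^3\setminus\Gamma$ which is non-trivial and is not represented by a loop winding around one rotation axis only; precisely, no loop of the class lies in a ball that meets at most one rotation axis. Fix $R_0\in\mathcal R$ and an integer $M\ge 1$, and let $\mathcal K$ be the cone of the $T$-periodic loops $v\in H^1_T(\mathbb R,\mathbb R^3\setminus\Gamma)$ which belong to this class and satisfy $v(t+T/M)=R_0v(t)$ for all $t\in\mathbb R$. Assume that $\mathcal K\neq\emptyset$. For $\alpha\ge1$ and $\varepsilon>0$ define, on the $L^2(0,T)$-closure $\overline{\mathcal K}^{L^2}$ with the topology of $L^2$, $$\mathcal A^\alpha_\varepsilon(v)=\int_0^T\Big(\frac{|\dot v|^2}{2}+\frac1{|v|^\alpha}+\frac\varepsilon2\sum_{R\in\mathcal R\setminus\{I\}}\frac1{|(R-I)v|^\alpha}\Big)dt\quad\text{if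 } v\in\overline{\mathcal K}^{H^1},\qquad \mathcal A^\alpha_\varepsilon(v)=+\infty\ \text{ otherwise,}$$ where $\overline{\mathcal K}^{H^1}$ is the $H^1$-closure of $\mathcal K$. Let $\widetilde{\mathcal A}^\alpha_0=\inf_{\varepsilon>0}\mathcal A^\alpha_\varepsilon$, and let $\overline{\widetilde{\mathcal A}^\alpha_0}$ be its lower semicontinuous envelope, i.e. the supremum of the lower semicontinuous functionals on $\overline{\mathcal K}^{L^2}$ which are $\le\widetilde{\mathcal A}^\alpha_0$; this is the $\Gamma$-limit of $\mathcal A^\alpha_\varepsilon$ as $\varepsilon\to0$. Assume that $\mathcal K$ is not central, i.e. that no loop of $\mathcal K$ lies in a plane through the origin, and let $\alpha=1$. Then there exists a minimizer of $\overline{\widetilde{\mathcal A}^1_0}$ on $\overline{\mathcal K}^{L^2}$, represented by a $T$-periodic $H^1$ loop $v^*$, such that either * $v^*$ has total collisions, i.e. $v^*(t)=0$ for some $t$; or * $v^*$ is composed of finitely many circular arcs centered at the origin, swept with uniform motion and passing through rotation axes: there are $\rho,\omega>0$, times $\tau_0<\tau_1<\dots<\tau_m=\tau_0+T$ and, for $0\le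 i<m$, orthonormal pairs $e_i,f_i\in\mathbb R^3$ with $e_i\in\Gamma$, such that $$v^*(t)=\rho\big(\cos(\omega(t-\tau_i))\,e_i+\sin(\omega(t-\tau_i))\,f_i\big)\qquad\text{for } t\in[\tau_i,\tau_{i+1}],\ 0\le i<m.$$ -/

import Mathlib

open MeasureTheory Set
open scoped ENNReal NNReal

noncomputable section

namespace PlatonicKepler

/-- Euclidean three-space. -/
abbrev E3 : Type := EuclideanSpace ℝ (Fin 3)

/-! ### Rotation groups of the Platonic polyhedra -/

/-- The rotations (linear isometries of determinant one) that map the set `V` onto itself. -/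
def rotationGroup (V : Set E3) : Subgroup (E3 ≃ₗᵢ[ℝ] E3) where
  carrier := {R | LinearMap.det (R.toLinearEquiv : E3 →ₗ[ℝ] E3) = 1 ∧ R '' V = V}
  one_mem' := ⟨LinearMap.det_id, by simp⟩
  mul_mem' := by
    rintro R S ⟨hR, hRV⟩ ⟨hS, hSV⟩
    refine ⟨?_, ?_⟩
    · have h : ((R * S).toLinearEquiv : E3 →ₗ[ℝ] E3) =
          (R.toLinearEquiv : E3 →ₗ[ℝ] E3) * (S.toLinearEquiv : E3 →ₗ[ℝ] E3) := rfl
      rw [h, map_mul, hR, hS, mul_one]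
    · rw [LinearIsometryEquiv.coe_mul, image_comp, hSV, hRV]
  inv_mem' := by
    rintro R ⟨hR, hRV⟩
    refine ⟨?_, ?_⟩
    · have h : ((R⁻¹).toLinearEquiv : E3 →ₗ[ℝ] E3) * (R.toLinearEquiv : E3 →ₗ[ℝ] E3) = 1 := by
        ext x : 1
        exact R.symm_apply_apply x
      have h2 := congrArg LinearMap.det h
      rw [map_mul, hR, mul_one, map_one] at h2
      exact h2
    · have h : (R⁻¹ : E3 ≃ₗᵢ[ℝ] E3) '' (R '' V) = V := by
        rw [← image_comp, ← LinearIsometryEquiv.coe_mul, inv_mul_cancel,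
          LinearIsometryEquiv.coe_one, image_id]
      rwa [hRV] at h

/-- The vertices of a regular tetrahedron centred at the origin. -/
def tetrahedronVertices : Set E3 :=
  {!₂[1, 1, 1], !₂[1, -1, -1], !₂[-1, 1, -1], !₂[-1, -1, 1]}

/-- The vertices of a regular octahedron centred at the origin. -/
def octahedronVertices : Set E3 :=
  {!₂[1, 0, 0], !₂[-1, 0, 0], !₂[0, 1, 0], !₂[0, -1, 0], !₂[0, 0, 1], !₂[0, 0, -1]}

/-- The vertices of a regular icosahedron centred at the origin: the cyclic permutations of
`(0, ±1, ±φ)`, with `φ` the golden ratio. -/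
def icosahedronVertices : Set E3 :=
  {x | ∃ a b : ℝ, (a = 1 ∨ a = -1) ∧ (b = Real.goldenRatio ∨ b = -Real.goldenRatio) ∧
    (x = !₂[0, a, b] ∨ x = !₂[a, b, 0] ∨ x = !₂[b, 0, a])}

/-- `ℛ` is the rotation group of the tetrahedron, of the octahedron (and the cube), or of the
icosahedron (and the dodecahedron). -/
def IsPlatonicRotationGroup (ℛ : Subgroup (E3 ≃ₗᵢ[ℝ] E3)) : Prop :=
  ℛ = rotationGroup tetrahedronVertices ∨ ℛ = rotationGroup octahedronVertices ∨
    ℛ = rotationGroup icosahedronVertices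

/-- The fixed space of `R`; it is the rotation axis of `R` if `R` is a rotation other than the
identity. -/
def axis (R : E3 ≃ₗᵢ[ℝ] E3) : Set E3 := {x | R x = x}

/-- The collision set `Γ`: the union of the rotation axes. -/
def collisionSet (ℛ : Subgroup (E3 ≃ₗᵢ[ℝ] E3)) : Set E3 :=
  {x | ∃ R ∈ ℛ, R ≠ 1 ∧ x ∈ axis R}

/-! ### Periodic loops of class `H¹` -/

/-- `v` is a `T`-periodic loop of class `H¹`: it is the primitive of its almost everywhere
derivative, which is square integrable over one period. -/
def IsH1Loop (T : ℝ) (v : ℝ → E3) : Prop :=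
  Function.Periodic v T ∧
  MemLp (deriv v) 2 (volume.restrict (Ioc 0 T)) ∧
  ∀ t ∈ Icc 0 T, v t = v 0 + ∫ s in (0 : ℝ)..t, deriv v s

/-- The square of the `H¹` distance of two loops over one period. -/
def h1DistSq (T : ℝ) (v w : ℝ → E3) : ℝ≥0∞ :=
  ∫⁻ t in Ioc 0 T, (‖v t - w t‖ₑ ^ 2 + ‖deriv v t - deriv w t‖ₑ ^ 2)

/-- The closure of a set of loops in the `H¹` norm. -/
def h1Closure (T : ℝ) (K : Set (ℝ → E3)) : Set (ℝ → E3) :=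
  {v | IsH1Loop T v ∧ ∀ δ : ℝ≥0∞, 0 < δ → ∃ w ∈ K, h1DistSq T v w < δ}

/-- `v` and `w` are `T`-periodic loops in `Ω` that are freely homotopic in `Ω`. -/
def FreelyHomotopic (T : ℝ) (Ω : Set E3) (v w : ℝ → E3) : Prop :=
  ∃ H : unitInterval × ℝ → E3, Continuous H ∧
    (∀ s t, H (s, t) ∈ Ω) ∧ (∀ s t, H (s, t + T) = H (s, t)) ∧
    (∀ t, H (0, t) = v t) ∧ (∀ t, H (1, t) = w t)

/-- The cone `𝒦`: the `T`-periodic `H¹` loops `v` without collisions, freely homotopic to `γ` in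
the complement of the collision set, with the symmetry `v (t + T / M) = R₀ (v t)`. -/
def cone (T : ℝ) (ℛ : Subgroup (E3 ≃ₗᵢ[ℝ] E3)) (γ : ℝ → E3) (R₀ : E3 ≃ₗᵢ[ℝ] E3) (M : ℕ) :
    Set (ℝ → E3) :=
  {v | IsH1Loop T v ∧ (∀ t, v t ∉ collisionSet ℛ) ∧
    FreelyHomotopic T (collisionSet ℛ)ᶜ γ v ∧ ∀ t, v (t + T / M) = R₀ (v t)}

/-- The free homotopy class of `γ` in the complement of the collision set is represented by a loop
that lies in a ball meeting at most one rotation axis. These are the trivial class and the classes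
of the loops that wind around one rotation axis only. -/
def WindsAroundAtMostOneAxis (T : ℝ) (ℛ : Subgroup (E3 ≃ₗᵢ[ℝ] E3)) (γ : ℝ → E3) : Prop :=
  ∃ w : ℝ → E3, FreelyHomotopic T (collisionSet ℛ)ᶜ γ w ∧
    ∃ (x : E3) (r : ℝ), (∀ t, w t ∈ Metric.ball x r) ∧
      ∃ R ∈ ℛ, R ≠ 1 ∧ Metric.ball x r ∩ collisionSet ℛ ⊆ axis R

/-- A cone is central if it contains a loop lying in a plane through the origin. -/
def IsCentral (K : Set (ℝ → E3)) : Prop :=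
  ∃ v ∈ K, ∃ n : E3, n ≠ 0 ∧ ∀ t, inner ℝ n (v t) = 0

/-! ### The action functionals and the `Γ`-limit -/

/-- The value in `[0, ∞]` of the integral
`∫₀ᵀ (|v'|² / 2 + 1 / |v|ᵅ + (ε / 2) ∑_{R ∈ ℛ, R ≠ I} 1 / |(R - I) v|ᵅ) dt`, with `1 / 0 = ∞`. -/
def actionIntegral (T : ℝ) (ℛ : Subgroup (E3 ≃ₗᵢ[ℝ] E3)) (α : ℝ) (ε : ℝ≥0) (v : ℝ → E3) : ℝ≥0∞ :=
  ∫⁻ t in Ioc 0 T, (‖deriv v t‖ₑ ^ 2 / 2 + (‖v t‖ₑ ^ α)⁻¹ +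
    (ε : ℝ≥0∞) / 2 * ∑' R : {R : E3 ≃ₗᵢ[ℝ] E3 // R ∈ ℛ ∧ R ≠ 1}, (‖R.1 (v t) - v t‖ₑ ^ α)⁻¹)

/-- The Hilbert space `L²((0, T), ℝ³)`. -/
abbrev L2 (T : ℝ) : Type := Lp E3 2 (volume.restrict (Ioc 0 T))

/-- The loop `v` represents the element `u` of `L²`. -/
def Represents (T : ℝ) (v : ℝ → E3) (u : L2 T) : Prop :=
  ∀ᵐ t ∂(volume.restrict (Ioc 0 T)), u t = v t

/-- The closure in `L²` of a set of loops. -/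
def l2Closure (T : ℝ) (K : Set (ℝ → E3)) : Set (L2 T) :=
  closure {u | ∃ v ∈ K, Represents T v u}

/-- The functional `𝒜_ε` on the `L²` closure of `K`: the action of `u` if `u` belongs to the `H¹`
closure of `K` (the `H¹` loop that represents `u` is then unique), and `∞` otherwise (infimum of
the empty set). -/
def action (T : ℝ) (ℛ : Subgroup (E3 ≃ₗᵢ[ℝ] E3)) (K : Set (ℝ → E3)) (α : ℝ) (ε : ℝ≥0)
    (u : l2Closure T K) : ℝ≥0∞ :=
  ⨅ (v : ℝ → E3) (_ : v ∈ h1Closure T K ∧ Represents T v u.1), actionIntegral T ℛ α ε v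

/-- The pointwise infimum of the functionals `𝒜_ε` over `ε > 0`. -/
def infAction (T : ℝ) (ℛ : Subgroup (E3 ≃ₗᵢ[ℝ] E3)) (K : Set (ℝ → E3)) (α : ℝ)
    (u : l2Closure T K) : ℝ≥0∞ :=
  ⨅ (ε : ℝ≥0) (_ : 0 < ε), action T ℛ K α ε u

/-- The lower semicontinuous envelope of a functional: the supremum of its lower semicontinuous
minorants. -/
def lscEnvelope {X : Type*} [TopologicalSpace X] (F : X → ℝ≥0∞) (u : X) : ℝ≥0∞ :=
  ⨆ (B : X → ℝ≥0∞) (_ : LowerSemicontinuous B ∧ ∀ w, B w ≤ F w), B u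

/-- The `Γ`-limit of `𝒜_ε` as `ε → 0` on the `L²` closure of `K` with the topology of `L²`. Since
`𝒜_ε` decreases as `ε` decreases to `0`, it is the lower semicontinuous envelope of the infimum of the `𝒜_ε`. -/
def gammaLimit (T : ℝ) (ℛ : Subgroup (E3 ≃ₗᵢ[ℝ] E3)) (K : Set (ℝ → E3)) (α : ℝ) :
    l2Closure T K → ℝ≥0∞ :=
  lscEnvelope (infAction T ℛ K α)

/-! ### Loops made of circular arcs -/

/-- The `T`-periodic loop `v` is composed of circular arcs centred at the origin, of radius `ρ`,
swept with constant angular velocity `ω`, and each connecting two points of rotation axes: the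
`i`-th arc is swept for `τ i ≤ t ≤ τ (i + 1)` in the plane with orthonormal basis `e i, f i`, and
starts from the semi-axis of direction `e i`. -/
def IsCircularArcLoop (T : ℝ) (ℛ : Subgroup (E3 ≃ₗᵢ[ℝ] E3)) (v : ℝ → E3) : Prop :=
  ∃ (ρ ω : ℝ) (m : ℕ) (τ : Fin (m + 1) → ℝ) (e f : Fin m → E3),
    0 < ρ ∧ 0 < ω ∧ StrictMono τ ∧ τ (Fin.last m) = τ 0 + T ∧
    (∀ i, ‖e i‖ = 1 ∧ ‖f i‖ = 1 ∧ inner ℝ (e i) (f i) = 0) ∧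
    (∀ i, e i ∈ collisionSet ℛ) ∧
    ∀ i, ∀ t ∈ Icc (τ i.castSucc) (τ i.succ),
      v t = ρ • (Real.cos (ω * (t - τ i.castSucc)) • e i + Real.sin (ω * (t - τ i.castSucc)) • f i)

end PlatonicKepler

end

/-!
Let `τ = T / M` and let `Λ = minSpeed` be the infimum of the speeds of the loops of the cone that
lie on the unit sphere; `Λ τ` is the infimum, over the cone, of the length of the radial projection
to the sphere during one symmetry period. The number `keplerBound τ θ` is the Kepler action of the
circular motion that sweeps the angle `θ` in the time `τ`, and `criticalAngle = min (Λ τ) (2π)`.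
The minimal value of the `Γ`-limit is `M * keplerBound τ criticalAngle`.

**Lower bound.** The speed of a loop depends on its radial part and on the speed of its radial
projection only, so the action over one symmetry period is that of an arc of the planar Kepler
problem which joins two points at the same distance from the centre. For an arc without zeros that
sweeps at least `2 β < 2π`, the coordinates of Levi-Civita turn the kinetic energy, in the
regularized time `∫ 1 / r`, into that of a harmonic oscillator, which is calibrated by a solution
of the Riccati equation (`sweep_bound`); an arc between two collisions is treated in the same way
(`collision_bound`) and satisfies the bound with angle `2π`. Hence the Kepler action is at least
the constant above on the whole `H¹` closure of the cone (`le_keplerAction_of_mem_h1Closure`). A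
constant is a lower semicontinuous minorant, and on a loop without collisions the perturbation
vanishes with `ε` (`infAction_le_keplerAction`), so that the limit of loops without collisions
whose Kepler actions tend to the bound is a minimizer of the `Γ`-limit
(`exists_minimizer_of_tendsto`).

**The limit `u` of spherical loops of nearly minimal speed.** Away from the axes it minimizes
length locally and is therefore composed of great-circle arcs (`exists_angle_eq`,
`exists_greatCircle`). It meets an axis, since otherwise it would be a planar loop of the cone
(`exists_collision`), and `Λ` is positive, since otherwise the class would be represented near a
single axis (`minSpeed_pos`). Its collisions are isolated: in a time interval between two passages
through the same point of an axis, the winding of the approximating loops around that axis can be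
pushed into an arbitrarily small circle, which would shorten them (`minSpeed_le_near_axis`,
`isolated_collision`). So `u` consists of finitely many circular arcs that start on axes
(`isCircularArcLoop`).

**Two cases.** If `Λ τ ≤ 2π`, then uniform motion along `u`, with the radius given by Kepler's
third law, attains the lower bound (`IsMinimizingLimit.exists_minimizer`). If `Λ τ ≥ 2π`, take
Kepler ellipses of period `τ`, with the angular motion slaved to a fixed spherical loop of the
cone: as the eccentricity tends to `1` the angular part of the action vanishes, the actions tend to
the bound, and the weak limit passes through the centre (`exists_kepler_loop`,
`exists_minimizer_collision`).
-/

namespace PlatonicKepler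

open Filter Topology intervalIntegral

/-! ### Absolutely continuous functions -/

/-- A function whose increments are dominated by those of an absolutely continuous function is
absolutely continuous. -/
lemma ac_of_dist_le {X Y : Type*} [PseudoMetricSpace X] [PseudoMetricSpace Y] {f : ℝ → X}
    {g : ℝ → Y} {a b : ℝ} (K : ℝ) (hg : AbsolutelyContinuousOnInterval g a b)
    (h : ∀ x ∈ uIcc a b, ∀ y ∈ uIcc a b, dist (f x) (f y) ≤ K * dist (g x) (g y)) :
    AbsolutelyContinuousOnInterval f a b := by
  unfold AbsolutelyContinuousOnInterval at hg ⊢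
  refine squeeze_zero' ?_ ?_ (by simpa using hg.const_mul K)
  · exact Eventually.of_forall fun _ => Finset.sum_nonneg fun _ _ => dist_nonneg
  · rw [eventually_inf_principal]
    refine Eventually.of_forall fun E hE => ?_
    simp only [Finset.mul_sum]
    exact Finset.sum_le_sum fun i hi => h _ (hE.1 i hi).1 _ (hE.1 i hi).2

lemma ac_integral {E : Type*} [NormedAddCommGroup E] [NormedSpace ℝ E] {g : ℝ → E} {a b : ℝ}
    (hg : IntervalIntegrable g volume a b) :
    AbsolutelyContinuousOnInterval (fun t => ∫ s in a..t, g s) a b := by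
  refine ac_of_dist_le 1
    (hg.norm.absolutelyContinuousOnInterval_intervalIntegral (c := a) left_mem_uIcc) ?_
  intro x hx y hy
  have h1 : IntervalIntegrable g volume a x := hg.mono_set (uIcc_subset_uIcc left_mem_uIcc hx)
  have h2 : IntervalIntegrable g volume a y := hg.mono_set (uIcc_subset_uIcc left_mem_uIcc hy)
  rw [one_mul, dist_comm, dist_comm (∫ s in a..x, ‖g s‖), dist_eq_norm, dist_eq_norm,
    integral_interval_sub_left h2 h1, integral_interval_sub_left h2.norm h1.norm, Real.norm_eq_abs]
  exact intervalIntegral.norm_integral_le_abs_integral_norm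

lemma ac_ae_differentiableAt {f : ℝ → E3} {a b : ℝ} (hf : AbsolutelyContinuousOnInterval f a b) :
    ∀ᵐ x, x ∈ uIcc a b → DifferentiableAt ℝ f x :=
  hf.boundedVariationOn.ae_differentiableAt_of_mem_uIcc

lemma ac_coord {f : ℝ → E3} {a b : ℝ} (hf : AbsolutelyContinuousOnInterval f a b) (i : Fin 3) :
    AbsolutelyContinuousOnInterval (fun t => f t i) a b := by
  refine ac_of_dist_le 1 hf fun x _ y _ => ?_
  rw [one_mul, dist_eq_norm, dist_eq_norm]
  simpa using PiLp.norm_apply_le (f x - f y) i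

lemma hasDerivAt_coord {f : ℝ → E3} {f' : E3} {x : ℝ} (hf : HasDerivAt f f' x) (i : Fin 3) :
    HasDerivAt (fun t => f t i) (f' i) x :=
  (EuclideanSpace.proj i : E3 →L[ℝ] ℝ).hasFDerivAt.comp_hasDerivAt x hf

lemma ac_intervalIntegrable_deriv {f : ℝ → E3} {a b : ℝ}
    (hf : AbsolutelyContinuousOnInterval f a b) : IntervalIntegrable (deriv f) volume a b := by
  have hsum : IntervalIntegrable (fun t => ∑ i, ‖deriv (fun t => f t i) t‖) volume a b := by
    simp only [Fin.sum_univ_three]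
    have h := fun i => ((ac_coord hf i).intervalIntegrable_deriv).norm
    exact ((h 0).add (h 1)).add (h 2)
  refine hsum.mono_fun (aestronglyMeasurable_deriv f _) ?_
  have := ac_ae_differentiableAt hf
  refine (ae_restrict_iff' measurableSet_uIoc).2 ?_
  filter_upwards [this] with x hx hxm
  have hd := (hx (uIoc_subset_uIcc hxm)).hasDerivAt
  have h1 : ∀ i, deriv (fun t => f t i) x = deriv f x i := fun i => (hasDerivAt_coord hd i).deriv
  simp only [h1]
  rw [Real.norm_of_nonneg (Finset.sum_nonneg fun _ _ => norm_nonneg _)]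
  rw [EuclideanSpace.norm_eq]
  refine Real.sqrt_le_iff.2 ⟨Finset.sum_nonneg fun _ _ => norm_nonneg _, ?_⟩
  exact Finset.sum_sq_le_sq_sum_of_nonneg fun _ _ => norm_nonneg _

lemma ac_integral_deriv {f : ℝ → E3} {a b : ℝ} (hf : AbsolutelyContinuousOnInterval f a b) :
    ∫ t in a..b, deriv f t = f b - f a := by
  ext i
  have h1 := (EuclideanSpace.proj i : E3 →L[ℝ] ℝ).intervalIntegral_comp_comm
    (ac_intervalIntegrable_deriv hf)
  have h2 := (ac_coord hf i).integral_deriv_eq_sub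
  refine h1.symm.trans (Eq.trans ?_ h2)
  refine intervalIntegral.integral_congr_ae ?_
  filter_upwards [ac_ae_differentiableAt hf] with x hx hxm
  exact ((hasDerivAt_coord (hx (uIoc_subset_uIcc hxm)).hasDerivAt i).deriv).symm

lemma ac_norm_sub_le {f : ℝ → E3} {a b : ℝ} (hab : a ≤ b)
    (hf : AbsolutelyContinuousOnInterval f a b) : ‖f b - f a‖ ≤ ∫ t in a..b, ‖deriv f t‖ := by
  rw [← ac_integral_deriv hf]
  exact intervalIntegral.norm_integral_le_integral_norm hab

/-- An absolutely continuous function grows at most by the integral of a bound of its derivative. -/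
lemma ac_sub_le_integral {f h : ℝ → ℝ} {a b : ℝ} (hab : a ≤ b)
    (hf : AbsolutelyContinuousOnInterval f a b) (hh : IntervalIntegrable h volume a b)
    (hle : ∀ᵐ t, t ∈ Ioc a b → deriv f t ≤ h t) : f b - f a ≤ ∫ t in a..b, h t := by
  rw [← hf.integral_deriv_eq_sub]
  refine intervalIntegral.integral_mono_ae_restrict hab hf.intervalIntegrable_deriv hh ?_
  have : (volume.restrict (Icc a b)) = volume.restrict (Ioc a b) :=
    Measure.restrict_congr_set Ioc_ae_eq_Icc.symm
  rw [this]
  exact (ae_restrict_iff' measurableSet_Ioc).2 hle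

lemma LipschitzWith.ac {X : Type*} [PseudoMetricSpace X] {f : ℝ → X} {c : ℝ≥0}
    (hf : LipschitzWith c f) (a b : ℝ) : AbsolutelyContinuousOnInterval f a b :=
  (hf.lipschitzOnWith (s := uIcc a b)).absolutelyContinuousOnInterval

/-! ### Periodic loops of class `H¹` -/

lemma periodic_deriv {E : Type*} [NormedAddCommGroup E] [NormedSpace ℝ E] {v : ℝ → E} {T : ℝ}
    (h : Function.Periodic v T) : Function.Periodic (deriv v) T := by
  intro t
  have : (fun x => v (x + T)) = v := funext h
  rw [← deriv_comp_add_const, this]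

lemma IsH1Loop.intervalIntegrable {T : ℝ} (hT : 0 < T) {v : ℝ → E3} (hv : IsH1Loop T v) (a b : ℝ) :
    IntervalIntegrable (deriv v) volume a b := by
  refine (periodic_deriv hv.1).intervalIntegrable₀ hT.ne' ?_ a b
  rw [intervalIntegrable_iff_integrableOn_Ioc_of_le hT.le]
  exact hv.2.1.integrable (by norm_num)

lemma IsH1Loop.intervalIntegrable_sq {T : ℝ} (hT : 0 < T) {v : ℝ → E3} (hv : IsH1Loop T v)
    (a b : ℝ) : IntervalIntegrable (fun t => ‖deriv v t‖ ^ 2) volume a b := by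
  have hp : Function.Periodic (fun t => ‖deriv v t‖ ^ 2) T := fun t => by
    simp only [periodic_deriv hv.1 t]
  refine hp.intervalIntegrable₀ hT.ne' ?_ a b
  rw [intervalIntegrable_iff_integrableOn_Ioc_of_le hT.le]
  exact hv.2.1.integrable_norm_pow (by norm_num)

/-- The fundamental theorem of calculus on an arbitrary interval. The definition grants it on
`[0, T]` only; the rest follows from the periodicity. -/
lemma IsH1Loop.sub_eq {T : ℝ} (hT : 0 < T) {v : ℝ → E3} (hv : IsH1Loop T v) (a b : ℝ) :
    v b - v a = ∫ t in a..b, deriv v t := by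
  have hi := hv.intervalIntegrable hT
  set f : ℝ → E3 := fun t => v t - ∫ s in (0 : ℝ)..t, deriv v s with hf
  have hper : Function.Periodic f T := by
    intro t
    have h1 : ∫ s in (0 : ℝ)..(t + T), deriv v s = (∫ s in (0 : ℝ)..t, deriv v s) +
        ∫ s in (0 : ℝ)..T, deriv v s := by
      simpa using (periodic_deriv hv.1).intervalIntegral_add_eq_add 0 t hi
    have h2 := hv.2.2 T (right_mem_Icc.2 hT.le)
    have h3 := hv.1 0
    rw [zero_add] at h3
    rw [h3] at h2
    have h4 : ∫ s in (0 : ℝ)..T, deriv v s = 0 := by simpa using h2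
    simp only [hf, h1, h4, add_zero, hv.1 t]
  have hconst : ∀ t, f t = v 0 := by
    intro t
    obtain ⟨y, hy, hty⟩ := hper.exists_mem_Ico₀ hT t
    rw [hty]
    simp only [hf]
    rw [hv.2.2 y ⟨hy.1, hy.2.le⟩, add_sub_cancel_right]
  have ha := hconst a
  have hb := hconst b
  simp only [hf, sub_eq_iff_eq_add] at ha hb
  rw [hb, ha, add_sub_add_left_eq_sub, integral_interval_sub_left (hi _ _) (hi _ _)]

lemma IsH1Loop.ac {T : ℝ} (hT : 0 < T) {v : ℝ → E3} (hv : IsH1Loop T v) (a b : ℝ) :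
    AbsolutelyContinuousOnInterval v a b := by
  refine ac_of_dist_le 1 (ac_integral (hv.intervalIntegrable hT a b)) fun x _ y _ => ?_
  have hi := hv.intervalIntegrable hT
  rw [one_mul, dist_eq_norm, dist_eq_norm, integral_interval_sub_left (hi _ _) (hi _ _),
    hv.sub_eq hT]

lemma IsH1Loop.continuous {T : ℝ} (hT : 0 < T) {v : ℝ → E3} (hv : IsH1Loop T v) :
    Continuous v := by
  have h : v = fun t => v 0 + ∫ s in (0 : ℝ)..t, deriv v s := by
    ext1 t
    rw [← hv.sub_eq hT 0 t]; abel
  rw [h]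
  exact continuous_const.add (continuous_primitive (hv.intervalIntegrable hT) 0)

lemma isH1Loop_of_ac {T : ℝ} (hT : 0 < T) {v : ℝ → E3} (hper : Function.Periodic v T)
    (hac : AbsolutelyContinuousOnInterval v 0 T)
    (hL : MemLp (deriv v) 2 (volume.restrict (Ioc 0 T))) : IsH1Loop T v := by
  refine ⟨hper, hL, fun t ht => ?_⟩
  rw [ac_integral_deriv (hac.mono (uIcc_subset_uIcc left_mem_uIcc (by rwa [uIcc_of_le hT.le])))]
  abel

/-- A periodic primitive of a square integrable function is a loop of class `H¹`. -/
lemma isH1Loop_of_integral {T : ℝ} (hT : 0 < T) {v g : ℝ → E3} (hper : Function.Periodic v T)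
    (hg : MemLp g 2 (volume.restrict (Ioc 0 T)))
    (h : ∀ t ∈ Icc 0 T, v t = v 0 + ∫ s in (0 : ℝ)..t, g s) : IsH1Loop T v := by
  have hgi : IntervalIntegrable g volume 0 T := by
    rw [intervalIntegrable_iff_integrableOn_Ioc_of_le hT.le]
    exact hg.integrable (by norm_num)
  have hac : AbsolutelyContinuousOnInterval v 0 T := by
    refine ac_of_dist_le 1 (ac_integral hgi) fun x hx y hy => ?_
    rw [uIcc_of_le hT.le] at hx hy
    rw [one_mul, h x hx, h y hy, dist_add_left]
  refine isH1Loop_of_ac hT hper hac (MemLp.ae_eq ?_ hg)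
  have h0 : ∀ᵐ t, t ≠ T := by simp [ae_iff, measure_singleton]
  refine (ae_restrict_iff' measurableSet_Ioc).2 ?_
  filter_upwards [hgi.ae_hasDerivAt_integral, h0] with t ht htT htm
  have hd := ht (by rw [uIcc_of_le hT.le]; exact ⟨htm.1.le, htm.2⟩) 0 left_mem_uIcc
  have hd' : HasDerivAt (fun x => v 0 + ∫ s in (0 : ℝ)..x, g s) (g t) t := hd.const_add _
  refine (HasDerivAt.deriv (hd'.congr_of_eventuallyEq ?_)).symm
  filter_upwards [Icc_mem_nhds htm.1 (lt_of_le_of_ne htm.2 htT)] with x hx using h x hx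

lemma norm_deriv_le_of_lipschitzWith {v : ℝ → E3} {c : ℝ≥0} (hv : LipschitzWith c v) (t : ℝ) :
    ‖deriv v t‖ ≤ c := norm_deriv_le_of_lipschitz hv

lemma isH1Loop_of_lipschitz {T : ℝ} (hT : 0 < T) {v : ℝ → E3} {c : ℝ≥0}
    (hper : Function.Periodic v T) (hv : LipschitzWith c v) : IsH1Loop T v :=
  isH1Loop_of_ac hT hper (LipschitzWith.ac hv 0 T)
    (MemLp.of_bound (aestronglyMeasurable_deriv v _) c
      (Eventually.of_forall (norm_deriv_le_of_lipschitzWith hv)))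

/-! ### The rotation group and its axes -/

/-- A linear isometry of `ℝ³` of determinant one that fixes two independent vectors is the
identity. -/
lemma eq_one_of_fixes_two {R : E3 ≃ₗᵢ[ℝ] E3}
    (hdet : LinearMap.det (R.toLinearEquiv : E3 →ₗ[ℝ] E3) = 1) {x y : E3} (hx : R x = x)
    (hy : R y = y) (hxy : LinearIndependent ℝ ![x, y]) : R = 1 := by
  classical
  set W : Submodule ℝ E3 := Submodule.span ℝ (Set.range ![x, y]) with hW
  have hxW : x ∈ W := Submodule.subset_span ⟨0, rfl⟩
  have hyW : y ∈ W := Submodule.subset_span ⟨1, rfl⟩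
  have hWf : Module.finrank ℝ W = 2 := by
    simpa using finrank_span_eq_card hxy
  have hE : Module.finrank ℝ E3 = 3 := by simp
  have hperp : Module.finrank ℝ Wᗮ = 1 := by
    have := W.finrank_add_finrank_orthogonal
    omega
  obtain ⟨z, hz0, hz⟩ := finrank_eq_one_iff'.1 hperp
  have hzW := z.2
  rw [Submodule.mem_orthogonal] at hzW
  have hRz : R (z : E3) ∈ Wᗮ := by
    rw [Submodule.mem_orthogonal]
    intro u hu
    have hRu : R u = u := by
      have hle : W ≤ LinearMap.eqLocus (R.toLinearEquiv : E3 →ₗ[ℝ] E3) LinearMap.id := by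
        rw [hW, Submodule.span_le]
        rintro _ ⟨i, rfl⟩
        fin_cases i
        · exact hx
        · exact hy
      exact hle hu
    rw [← hRu, R.inner_map_map]
    exact hzW u hu
  obtain ⟨l, hl⟩ := hz ⟨_, hRz⟩
  have hl' : R (z : E3) = l • (z : E3) := (congrArg Subtype.val hl).symm
  have hz0' : (z : E3) ≠ 0 := fun h => hz0 (Subtype.ext h)
  have hli : LinearIndependent ℝ ![x, y, (z : E3)] := by
    rw [Fintype.linearIndependent_iff]
    intro g hg
    simp only [Fin.sum_univ_three, Matrix.cons_val] at hg
    have h2 : g 2 = 0 := by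
      have := congrArg (fun w => inner ℝ w (z : E3)) hg
      simp only [inner_add_left, inner_smul_left, hzW x hxW, hzW y hyW, inner_zero_left] at this
      simpa [hz0'] using this
    rw [h2, zero_smul, add_zero] at hg
    have := LinearIndependent.pair_iff.1 hxy _ _ hg
    intro i
    fin_cases i
    exacts [this.1, this.2, h2]
  let b := basisOfLinearIndependentOfCardEqFinrank hli (by simp)
  have hb : ∀ i, b i = ![x, y, (z : E3)] i := fun i => by simp [b]
  have hRb : ∀ i, (R.toLinearEquiv : E3 →ₗ[ℝ] E3) (b i) = (![1, 1, l] i) • b i := by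
    intro i
    rw [hb]
    fin_cases i
    · simpa using hx
    · simpa using hy
    · simpa using hl'
  have hm : LinearMap.toMatrix b b (R.toLinearEquiv : E3 →ₗ[ℝ] E3) =
      Matrix.diagonal ![1, 1, l] := by
    ext i j
    rw [LinearMap.toMatrix_apply, hRb, map_smul, Finsupp.smul_apply, Module.Basis.repr_self,
      Matrix.diagonal_apply, Finsupp.single_apply]
    by_cases h : i = j
    · subst h; simp
    · simp [h, Ne.symm h]
  have hl1 : l = 1 := by
    rw [← LinearMap.det_toMatrix b, hm, Matrix.det_diagonal] at hdet
    simpa [Fin.prod_univ_three] using hdet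
  have : (R.toLinearEquiv : E3 →ₗ[ℝ] E3) = LinearMap.id := by
    refine b.ext fun i => ?_
    rw [hRb, hl1]
    fin_cases i <;> simp
  ext1 u
  exact LinearMap.congr_fun this u

/-- The properties of the rotation groups of the Platonic polyhedra on which the argument relies:
they are finite, non-trivial and consist of rotations. -/
structure IsFiniteRotationGroup (ℛ : Subgroup (E3 ≃ₗᵢ[ℝ] E3)) : Prop where
  finite : (ℛ : Set (E3 ≃ₗᵢ[ℝ] E3)).Finite
  nontrivial : ∃ R ∈ ℛ, R ≠ 1
  det : ∀ R ∈ ℛ, LinearMap.det (R.toLinearEquiv : E3 →ₗ[ℝ] E3) = 1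

/-- The half-turn about the first coordinate axis. -/
noncomputable def halfTurn : E3 ≃ₗᵢ[ℝ] E3 :=
  LinearIsometryEquiv.piLpCongrRight 2
    ![LinearIsometryEquiv.refl ℝ ℝ, LinearIsometryEquiv.neg ℝ, LinearIsometryEquiv.neg ℝ]

lemma halfTurn_apply (a b c : ℝ) : halfTurn !₂[a, b, c] = !₂[a, -b, -c] := by
  ext i
  fin_cases i <;> simp [halfTurn]

lemma det_halfTurn : LinearMap.det (halfTurn.toLinearEquiv : E3 →ₗ[ℝ] E3) = 1 := by
  have hm : LinearMap.toMatrix (EuclideanSpace.basisFun (Fin 3) ℝ).toBasis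
      (EuclideanSpace.basisFun (Fin 3) ℝ).toBasis (halfTurn.toLinearEquiv : E3 →ₗ[ℝ] E3) =
      Matrix.diagonal ![1, -1, -1] := by
    ext i j
    rw [LinearMap.toMatrix_apply]
    fin_cases i <;> fin_cases j <;> simp [halfTurn]
  rw [← LinearMap.det_toMatrix (EuclideanSpace.basisFun (Fin 3) ℝ).toBasis, hm,
    Matrix.det_diagonal]
  simp [Fin.prod_univ_three]

lemma halfTurn_ne_one : halfTurn ≠ 1 := by
  intro h
  have h1 := halfTurn_apply 0 1 0
  rw [h] at h1
  have h2 : (!₂[0, 1, 0] : E3) 1 = (!₂[0, -1, -0] : E3) 1 := congrArg (fun x : E3 => x 1) h1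
  norm_num at h2

lemma halfTurn_mem_rotationGroup {V : Set E3} (hV : ∀ x ∈ V, halfTurn x ∈ V) :
    halfTurn ∈ rotationGroup V := by
  refine ⟨det_halfTurn, ?_⟩
  refine Subset.antisymm (image_subset_iff.2 hV) fun x hx => ⟨halfTurn x, hV x hx, ?_⟩
  have hx' : x = !₂[x 0, x 1, x 2] := by ext i; fin_cases i <;> simp
  rw [hx', halfTurn_apply, halfTurn_apply, neg_neg, neg_neg]

/-- A rotation is determined by the permutation of the vertices if these span `ℝ³`, which gives
finiteness; the half-turn is a non-trivial element. -/
lemma rotationGroup_isFiniteRotationGroup {V : Set E3} (hV : V.Finite)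
    (hR : ∀ x ∈ V, halfTurn x ∈ V)
    (h0 : !₂[1, 0, 0] ∈ Submodule.span ℝ V) (h1 : !₂[0, 1, 0] ∈ Submodule.span ℝ V)
    (h2 : !₂[0, 0, 1] ∈ Submodule.span ℝ V) : IsFiniteRotationGroup (rotationGroup V) := by
  refine ⟨?_, ⟨halfTurn, halfTurn_mem_rotationGroup hR, halfTurn_ne_one⟩, fun R hR => hR.1⟩
  have htop : Submodule.span ℝ V = ⊤ := by
    rw [eq_top_iff]
    intro x _
    have hx : x = x 0 • !₂[1, 0, 0] + x 1 • !₂[0, 1, 0] + x 2 • !₂[0, 0, 1] := by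
      ext i; fin_cases i <;> simp
    rw [hx]
    exact Submodule.add_mem _ (Submodule.add_mem _ (Submodule.smul_mem _ _ h0)
      (Submodule.smul_mem _ _ h1)) (Submodule.smul_mem _ _ h2)
  have : Finite V := hV
  have hmaps : ∀ R ∈ rotationGroup V, ∀ x ∈ V, R x ∈ V := fun R hR x hx =>
    hR.2 ▸ mem_image_of_mem R hx
  have hinj : Function.Injective
      (fun (R : rotationGroup V) (x : V) => (⟨R.1 x.1, hmaps R.1 R.2 x.1 x.2⟩ : V)) := by
    intro R S hRS
    have h : (R.1.toLinearEquiv : E3 →ₗ[ℝ] E3) = (S.1.toLinearEquiv : E3 →ₗ[ℝ] E3) := by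
      refine LinearMap.ext_on htop fun x hx => ?_
      exact congrArg Subtype.val (congrFun hRS ⟨x, hx⟩)
    refine Subtype.ext (LinearIsometryEquiv.ext fun x => LinearMap.congr_fun h x)
  exact Finite.of_injective _ hinj

lemma IsPlatonicRotationGroup.isFiniteRotationGroup {ℛ : Subgroup (E3 ≃ₗᵢ[ℝ] E3)}
    (h : IsPlatonicRotationGroup ℛ) : IsFiniteRotationGroup ℛ := by
  have half : ∀ {V : Set E3} {x y z : E3}, x ∈ V → y ∈ V → z = (1 / 2 : ℝ) • (x + y) →
      z ∈ Submodule.span ℝ V := fun {V x y z} hx hy hz => by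
    rw [hz]
    exact Submodule.smul_mem _ _ (Submodule.add_mem _ (Submodule.subset_span hx)
      (Submodule.subset_span hy))
  rcases h with rfl | rfl | rfl
  · refine rotationGroup_isFiniteRotationGroup (by unfold tetrahedronVertices; exact toFinite _)
      (by rintro x (rfl | rfl | rfl | rfl) <;> simp [halfTurn_apply, tetrahedronVertices])
      (half (x := !₂[1, 1, 1]) (y := !₂[1, -1, -1]) ?_ ?_ ?_)
      (half (x := !₂[1, 1, 1]) (y := !₂[-1, 1, -1]) ?_ ?_ ?_)
      (half (x := !₂[1, 1, 1]) (y := !₂[-1, -1, 1]) ?_ ?_ ?_)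
    all_goals first
      | (simp [tetrahedronVertices]; done)
      | (ext i; fin_cases i <;> norm_num)
  · refine rotationGroup_isFiniteRotationGroup (by unfold octahedronVertices; exact toFinite _)
      (by rintro x (rfl | rfl | rfl | rfl | rfl | rfl) <;>
        simp [halfTurn_apply, octahedronVertices])
      (Submodule.subset_span ?_) (Submodule.subset_span ?_) (Submodule.subset_span ?_)
    all_goals simp [octahedronVertices]
  · refine rotationGroup_isFiniteRotationGroup ?_ ?_
      (half (x := !₂[1, Real.goldenRatio, 0]) (y := !₂[1, -Real.goldenRatio, 0]) ?_ ?_ ?_)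
      (half (x := !₂[0, 1, Real.goldenRatio]) (y := !₂[0, 1, -Real.goldenRatio]) ?_ ?_ ?_)
      (half (x := !₂[Real.goldenRatio, 0, 1]) (y := !₂[-Real.goldenRatio, 0, 1]) ?_ ?_ ?_)
    · let A : Set (ℝ × ℝ) := ({1, -1} : Set ℝ) ×ˢ ({Real.goldenRatio, -Real.goldenRatio} : Set ℝ)
      have hA : A.Finite := toFinite _
      refine (((hA.image fun p => (!₂[0, p.1, p.2] : E3)).union
        (hA.image fun p => (!₂[p.1, p.2, 0] : E3))).union
        (hA.image fun p => (!₂[p.2, 0, p.1] : E3))).subset ?_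
      rintro x ⟨a, b, ha, hb, hx⟩
      have hab : (a, b) ∈ A := ⟨ha, hb⟩
      rcases hx with rfl | rfl | rfl
      · exact Or.inl (Or.inl ⟨_, hab, rfl⟩)
      · exact Or.inl (Or.inr ⟨_, hab, rfl⟩)
      · exact Or.inr ⟨_, hab, rfl⟩
    · have hneg : ∀ {a b : ℝ}, a = b ∨ a = -b → -a = b ∨ -a = -b := fun h =>
        h.elim (fun h => Or.inr (by rw [h])) fun h => Or.inl (by rw [h, neg_neg])
      rintro x ⟨a, b, ha, hb, rfl | rfl | rfl⟩
      · exact ⟨-a, -b, hneg ha, hneg hb, by simp [halfTurn_apply]⟩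
      · exact ⟨a, -b, ha, hneg hb, by simp [halfTurn_apply]⟩
      · exact ⟨-a, b, hneg ha, hb, by simp [halfTurn_apply]⟩
    · exact ⟨1, Real.goldenRatio, by simp, by simp, by simp⟩
    · exact ⟨1, -Real.goldenRatio, by simp, by simp, by simp⟩
    · ext i; fin_cases i <;> norm_num
    · exact ⟨1, Real.goldenRatio, by simp, by simp, by simp⟩
    · exact ⟨1, -Real.goldenRatio, by simp, by simp, by simp⟩
    · ext i; fin_cases i <;> norm_num
    · exact ⟨1, Real.goldenRatio, by simp, by simp, by simp⟩
    · exact ⟨1, -Real.goldenRatio, by simp, by simp, by simp⟩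
    · ext i; fin_cases i <;> norm_num

section CollisionSet

variable {ℛ : Subgroup (E3 ≃ₗᵢ[ℝ] E3)}

lemma smul_mem_collisionSet {c : ℝ} (hc : c ≠ 0) {x : E3} :
    c • x ∈ collisionSet ℛ ↔ x ∈ collisionSet ℛ := by
  have key : ∀ (c : ℝ) (x : E3), x ∈ collisionSet ℛ → c • x ∈ collisionSet ℛ := by
    rintro c x ⟨R, hR, hR1, hx⟩
    refine ⟨R, hR, hR1, ?_⟩
    have hx' : R x = x := hx
    change R (c • x) = c • x
    rw [map_smul, hx']
  refine ⟨fun h => ?_, key c x⟩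
  have := key c⁻¹ _ h
  rwa [smul_smul, inv_mul_cancel₀ hc, one_smul] at this

lemma map_mem_collisionSet {Q : E3 ≃ₗᵢ[ℝ] E3} (hQ : Q ∈ ℛ) {x : E3} :
    Q x ∈ collisionSet ℛ ↔ x ∈ collisionSet ℛ := by
  have key : ∀ Q ∈ ℛ, ∀ x ∈ collisionSet ℛ, Q x ∈ collisionSet ℛ := by
    rintro Q hQ x ⟨R, hR, hR1, hx⟩
    refine ⟨Q * R * Q⁻¹, ℛ.mul_mem (ℛ.mul_mem hQ hR) (ℛ.inv_mem hQ), ?_, ?_⟩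
    · intro h
      exact hR1 (conj_eq_one_iff.1 h)
    · have hx' : R x = x := hx
      change Q (R (Q.symm (Q x))) = Q x
      rw [Q.symm_apply_apply, hx']
  refine ⟨fun h => ?_, key Q hQ x⟩
  have := key Q⁻¹ (ℛ.inv_mem hQ) _ h
  have h2 : Q⁻¹ (Q x) = x := Q.symm_apply_apply x
  rwa [h2] at this

lemma zero_mem_collisionSet (hℛ : IsFiniteRotationGroup ℛ) : (0 : E3) ∈ collisionSet ℛ := by
  obtain ⟨R, hR, hR1⟩ := hℛ.nontrivial
  exact ⟨R, hR, hR1, map_zero R⟩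

lemma isClosed_axis (R : E3 ≃ₗᵢ[ℝ] E3) : IsClosed (axis R) :=
  isClosed_eq R.continuous continuous_id

lemma isClosed_collisionSet (hℛ : IsFiniteRotationGroup ℛ) : IsClosed (collisionSet ℛ) := by
  have : collisionSet ℛ = ⋃ R ∈ {R : E3 ≃ₗᵢ[ℝ] E3 | R ∈ ℛ ∧ R ≠ 1}, axis R := by
    ext x
    simp [collisionSet, and_assoc]
  rw [this]
  exact (hℛ.finite.subset fun R hR => hR.1).isClosed_biUnion fun R _ => isClosed_axis R

/-- A rotation axis is a line. -/
lemma exists_smul_of_mem_axis (hℛ : IsFiniteRotationGroup ℛ) {R : E3 ≃ₗᵢ[ℝ] E3} (hR : R ∈ ℛ)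
    (hR1 : R ≠ 1) {p x : E3} (hp : p ∈ axis R) (hp0 : p ≠ 0) (hx : x ∈ axis R) :
    ∃ c : ℝ, x = c • p := by
  by_contra! h
  refine hR1 (eq_one_of_fixes_two (hℛ.det R hR) (x := p) (y := x) hp hx ?_)
  rw [LinearIndependent.pair_iff' hp0]
  exact fun a ha => h a ha.symm

/-- Near a point `p ≠ 0` of the collision set the only collisions are those on the axis of `p`. -/
lemma exists_ball_inter_subset_axis (hℛ : IsFiniteRotationGroup ℛ) {p : E3}
    (hp : p ∈ collisionSet ℛ) (hp0 : p ≠ 0) :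
    ∃ δ > 0, ∃ R ∈ ℛ, R ≠ 1 ∧ Metric.ball p δ ∩ collisionSet ℛ ⊆ axis R ∧
      ∀ x ∈ axis R, ∃ c : ℝ, x = c • p := by
  obtain ⟨R, hR, hR1, hpR⟩ := hp
  have hcl : IsClosed (⋃ S ∈ {S : E3 ≃ₗᵢ[ℝ] E3 | S ∈ ℛ ∧ p ∉ axis S}, axis S) :=
    (hℛ.finite.subset fun R hR => hR.1).isClosed_biUnion fun R _ => isClosed_axis R
  have hmem : p ∈ (⋃ S ∈ {S : E3 ≃ₗᵢ[ℝ] E3 | S ∈ ℛ ∧ p ∉ axis S}, axis S)ᶜ := by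
    simp
  obtain ⟨δ, hδ, hball⟩ := Metric.isOpen_iff.1 hcl.isOpen_compl p hmem
  refine ⟨δ, hδ, R, hR, hR1, ?_, fun x hx => exists_smul_of_mem_axis hℛ hR hR1 hpR hp0 hx⟩
  rintro x ⟨hx, S, hS, hS1, hxS⟩
  have hpS : p ∈ axis S := by
    by_contra hpS
    exact hball hx (mem_biUnion (x := S) ⟨hS, hpS⟩ hxS)
  obtain ⟨c, rfl⟩ := exists_smul_of_mem_axis hℛ hS hS1 hpS hp0 hxS
  have hp' : R p = p := hpR
  change R (c • p) = c • p
  rw [map_smul, hp']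

end CollisionSet

/-! ### Homotopies and reparametrizations of loops in the cone -/

lemma FreelyHomotopic.continuous_right {T : ℝ} {Ω : Set E3} {v w : ℝ → E3}
    (h : FreelyHomotopic T Ω v w) : Continuous w := by
  obtain ⟨H, hH, -, -, -, h1⟩ := h
  have : w = fun t => H (1, t) := funext fun t => (h1 t).symm
  rw [this]
  exact hH.comp (by fun_prop)

lemma FreelyHomotopic.trans {T : ℝ} {Ω : Set E3} {u v w : ℝ → E3}
    (h₁ : FreelyHomotopic T Ω u v) (h₂ : FreelyHomotopic T Ω v w) : FreelyHomotopic T Ω u w := by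
  have hv := h₁.continuous_right
  have hw := h₂.continuous_right
  obtain ⟨F, hF, hFΩ, hFT, hF0, hF1⟩ := h₁
  obtain ⟨G, hG, hGΩ, hGT, hG0, hG1⟩ := h₂
  have hu : Continuous u := by
    have : u = fun t => F (0, t) := funext fun t => (hF0 t).symm
    rw [this]
    exact hF.comp (by fun_prop)
  let F' : ContinuousMap.Homotopy (⟨u, hu⟩ : C(ℝ, E3)) ⟨v, hv⟩ := ⟨⟨F, hF⟩, hF0, hF1⟩
  let G' : ContinuousMap.Homotopy (⟨v, hv⟩ : C(ℝ, E3)) ⟨w, hw⟩ := ⟨⟨G, hG⟩, hG0, hG1⟩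
  have hval : ∀ s, ∃ s', (∀ t, (F'.trans G') (s, t) = F (s', t)) ∨
      ∀ t, (F'.trans G') (s, t) = G (s', t) := by
    intro s
    by_cases hs : (s : ℝ) ≤ 1 / 2
    · refine ⟨⟨2 * s, (unitInterval.mul_pos_mem_iff zero_lt_two).2 ⟨s.2.1, hs⟩⟩,
        Or.inl fun t => ?_⟩
      rw [ContinuousMap.Homotopy.trans_apply, dif_pos hs]; rfl
    · refine ⟨⟨2 * s - 1, unitInterval.two_mul_sub_one_mem_iff.2 ⟨(not_le.1 hs).le, s.2.2⟩⟩,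
        Or.inr fun t => ?_⟩
      rw [ContinuousMap.Homotopy.trans_apply, dif_neg hs]; rfl
  refine ⟨F'.trans G', (F'.trans G').continuous, fun s t => ?_, fun s t => ?_,
    fun t => (F'.trans G').apply_zero t, fun t => (F'.trans G').apply_one t⟩
  · obtain ⟨s', h | h⟩ := hval s
    · rw [h]; exact hFΩ _ _
    · rw [h]; exact hGΩ _ _
  · obtain ⟨s', h | h⟩ := hval s
    · rw [h, h]; exact hFT _ _
    · rw [h, h]; exact hGT _ _

/-- The straight-line homotopy. -/
lemma freelyHomotopic_of_segment {T : ℝ} {Ω : Set E3} {v w : ℝ → E3} (hv : Continuous v)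
    (hw : Continuous w) (hvT : Function.Periodic v T) (hwT : Function.Periodic w T)
    (h : ∀ t, ∀ σ ∈ Icc (0 : ℝ) 1, (1 - σ) • v t + σ • w t ∈ Ω) : FreelyHomotopic T Ω v w := by
  refine ⟨fun p => (1 - (p.1 : ℝ)) • v p.2 + (p.1 : ℝ) • w p.2, by fun_prop, fun s t => h t s s.2,
    fun s t => ?_, fun t => by simp, fun t => by simp⟩
  simp only [hvT t, hwT t]

/-- A loop is homotopic to its reparametrization by `φ`, through the reparametrizations by
`t ↦ (1 - σ) t + σ φ t`. -/
lemma freelyHomotopic_comp {T : ℝ} {Ω : Set E3} {v : ℝ → E3} {φ : ℝ → ℝ} (hv : Continuous v)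
    (hφ : Continuous φ) (hvT : Function.Periodic v T) (hφT : ∀ t, φ (t + T) = φ t + T)
    (h : ∀ t, v t ∈ Ω) : FreelyHomotopic T Ω v (v ∘ φ) := by
  refine ⟨fun p => v ((1 - (p.1 : ℝ)) * p.2 + (p.1 : ℝ) * φ p.2), by fun_prop, fun s t => h _,
    fun s t => ?_, fun t => by simp, fun t => by simp⟩
  simp only [hφT]
  exact Eq.trans (congrArg v (by ring)) (hvT _)

/-- A continuous loop with the topological and symmetry properties of the loops in the cone. -/
structure IsConeLoop (T : ℝ) (ℛ : Subgroup (E3 ≃ₗᵢ[ℝ] E3)) (γ : ℝ → E3) (R₀ : E3 ≃ₗᵢ[ℝ] E3) (M : ℕ)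
    (v : ℝ → E3) : Prop where
  cont : Continuous v
  per : Function.Periodic v T
  avoid : ∀ t, v t ∉ collisionSet ℛ
  hom : FreelyHomotopic T (collisionSet ℛ)ᶜ γ v
  equiv : ∀ t, v (t + T / M) = R₀ (v t)

variable {T : ℝ} {ℛ : Subgroup (E3 ≃ₗᵢ[ℝ] E3)} {γ : ℝ → E3} {R₀ : E3 ≃ₗᵢ[ℝ] E3} {M : ℕ}

lemma isConeLoop_of_mem_cone (hT : 0 < T) {v : ℝ → E3} (hv : v ∈ cone T ℛ γ R₀ M) :
    IsConeLoop T ℛ γ R₀ M v :=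
  ⟨hv.1.continuous hT, hv.1.1, hv.2.1, hv.2.2.1, hv.2.2.2⟩

lemma IsConeLoop.mem_cone {v : ℝ → E3} (hv : IsConeLoop T ℛ γ R₀ M v) (h : IsH1Loop T v) :
    v ∈ cone T ℛ γ R₀ M := ⟨h, hv.avoid, hv.hom, hv.equiv⟩

lemma IsConeLoop.ne_zero (hℛ : IsFiniteRotationGroup ℛ) {v : ℝ → E3}
    (hv : IsConeLoop T ℛ γ R₀ M v) (t : ℝ) : v t ≠ 0 := fun h =>
  hv.avoid t (h ▸ zero_mem_collisionSet hℛ)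

lemma equivariant_zpow {τ : ℝ} {v : ℝ → E3} (hv : ∀ t, v (t + τ) = R₀ (v t)) (k : ℤ) (t : ℝ) :
    v (t + k * τ) = (R₀ ^ k) (v t) := by
  induction k with
  | zero => simp
  | succ n ih =>
    have : t + ((n : ℤ) + 1 : ℤ) * τ = t + (n : ℤ) * τ + τ := by push_cast; ring
    rw [this, hv, ih, add_comm (n : ℤ), zpow_one_add]; rfl
  | pred n ih =>
    have h1 : t + (-(n : ℤ) - 1 : ℤ) * τ + τ = t + (-(n : ℤ) : ℤ) * τ := by push_cast; ring
    have h2 := hv (t + (-(n : ℤ) - 1 : ℤ) * τ)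
    rw [h1, ih] at h2
    have h3 : R₀ ^ (-(n : ℤ)) = R₀ * R₀ ^ (-(n : ℤ) - 1) := by
      rw [← zpow_one_add]; congr 1; ring
    rw [h3] at h2
    exact (R₀.injective h2).symm

lemma translation_int_mul {τ : ℝ} {φ : ℝ → ℝ} {c : ℝ} (h : ∀ t, φ (t + τ) = φ t + c) (k : ℤ)
    (t : ℝ) : φ (t + k * τ) = φ t + k * c := by
  induction k with
  | zero => simp
  | succ n ih =>
    have : t + ((n : ℤ) + 1 : ℤ) * τ = t + (n : ℤ) * τ + τ := by push_cast; ring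
    rw [this, h, ih]; push_cast; ring
  | pred n ih =>
    have h1 : t + (-(n : ℤ) - 1 : ℤ) * τ + τ = t + (-(n : ℤ) : ℤ) * τ := by push_cast; ring
    have h2 := h (t + (-(n : ℤ) - 1 : ℤ) * τ)
    rw [h1, ih] at h2
    push_cast at h2 ⊢
    linarith

lemma exists_int_mem_Ico {τ : ℝ} (hτ : 0 < τ) (a t : ℝ) :
    ∃ (k : ℤ) (x : ℝ), x ∈ Ico a (a + τ) ∧ t = x + k * τ := by
  refine ⟨toIcoDiv hτ a t, toIcoMod hτ a t, toIcoMod_mem_Ico hτ a t, ?_⟩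
  have := toIcoMod_add_toIcoDiv_zsmul hτ a t
  rw [zsmul_eq_mul] at this
  exact this.symm

/-- The symmetry forces `R₀ ^ M = 1`, because the loops in the cone avoid the rotation axes. -/
lemma IsConeLoop.pow_eq_one (hM : 0 < M) (hR₀ : R₀ ∈ ℛ) {v : ℝ → E3}
    (hv : IsConeLoop T ℛ γ R₀ M v) : R₀ ^ M = 1 := by
  by_contra h
  refine hv.avoid 0 ⟨R₀ ^ M, ℛ.pow_mem hR₀ M, h, ?_⟩
  have h1 := equivariant_zpow hv.equiv M 0
  have h2 : (0 : ℝ) + ((M : ℤ) : ℝ) * (T / M) = 0 + T := by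
    have : (M : ℝ) ≠ 0 := by positivity
    push_cast; field_simp
  rw [h2, hv.per 0, zpow_natCast] at h1
  exact h1.symm

lemma periodic_of_equivariant (hM : 0 < M) (h : R₀ ^ M = 1) {v : ℝ → E3}
    (hv : ∀ t, v (t + T / M) = R₀ (v t)) : Function.Periodic v T := by
  intro t
  have h1 := equivariant_zpow hv M t
  have h2 : t + ((M : ℤ) : ℝ) * (T / M) = t + T := by
    have : (M : ℝ) ≠ 0 := by positivity
    push_cast; field_simp
  rw [h2, zpow_natCast, h] at h1
  exact h1

lemma translation_period (hM : 0 < M) {φ : ℝ → ℝ} {c : ℝ} (hφ : ∀ t, φ (t + T / M) = φ t + c)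
    (t : ℝ) : φ (t + T) = φ t + M * c := by
  have h1 := translation_int_mul hφ M t
  have h2 : t + ((M : ℤ) : ℝ) * (T / M) = t + T := by
    have : (M : ℝ) ≠ 0 := by positivity
    push_cast; field_simp
  rw [h2] at h1
  exact_mod_cast h1

lemma norm_deriv_periodic_of_equivariant {τ : ℝ} {v : ℝ → E3} (hv : ∀ t, v (t + τ) = R₀ (v t)) :
    Function.Periodic (fun t => ‖deriv v t‖) τ := by
  intro t
  have h1 : (fun x => v (x + τ)) = R₀.toContinuousLinearEquiv ∘ v := funext hv
  have h2 : deriv v (t + τ) = R₀ (deriv v t) := by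
    rw [← deriv_comp_add_const, h1, ← fderiv_apply_one_eq_deriv, ← fderiv_apply_one_eq_deriv,
      R₀.toContinuousLinearEquiv.comp_fderiv]
    rfl
  simp only [h2, R₀.norm_map]

lemma norm_periodic_of_equivariant {τ : ℝ} {v : ℝ → E3} (hv : ∀ t, v (t + τ) = R₀ (v t)) :
    Function.Periodic (fun t => ‖v t‖) τ := by
  intro t
  simp only [hv, R₀.norm_map]

/-- A loop with the same symmetry is in the cone if, over one symmetry period, the segments joining
it to a loop in the cone avoid the collisions. -/
lemma IsConeLoop.of_segment (hT : 0 < T) (hM : 0 < M) (hR₀ : R₀ ∈ ℛ) {v w : ℝ → E3}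
    (hv : IsConeLoop T ℛ γ R₀ M v) (hw : Continuous w) (hwe : ∀ t, w (t + T / M) = R₀ (w t)) (a : ℝ)
    (h : ∀ t ∈ Ico a (a + T / M), ∀ σ ∈ Icc (0 : ℝ) 1,
      (1 - σ) • v t + σ • w t ∉ collisionSet ℛ) : IsConeLoop T ℛ γ R₀ M w := by
  have hτ : 0 < T / M := div_pos hT (by exact_mod_cast hM)
  have hwT := periodic_of_equivariant hM (hv.pow_eq_one hM hR₀) hwe
  have hseg : ∀ t, ∀ σ ∈ Icc (0 : ℝ) 1, (1 - σ) • v t + σ • w t ∉ collisionSet ℛ := by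
    intro t σ hσ
    obtain ⟨k, x, hx, rfl⟩ := exists_int_mem_Ico hτ a t
    rw [equivariant_zpow hv.equiv, equivariant_zpow hwe, ← map_smul, ← map_smul, ← map_add,
      map_mem_collisionSet (ℛ.zpow_mem hR₀ k)]
    exact h x hx σ hσ
  refine ⟨hw, hwT, fun t => ?_, ?_, hwe⟩
  · simpa using hseg t 1 (by simp)
  · exact hv.hom.trans (freelyHomotopic_of_segment hv.cont hw hv.per hwT hseg)

/-- The loops of the cone can be rescaled by positive functions with the period `T / M`, since the
collision set is a union of lines through the origin. -/
lemma IsConeLoop.smul (hT : 0 < T) (hM : 0 < M) (hR₀ : R₀ ∈ ℛ) {v : ℝ → E3}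
    (hv : IsConeLoop T ℛ γ R₀ M v) {l : ℝ → ℝ} (hl : Continuous l)
    (hlp : Function.Periodic l (T / M)) (hl0 : ∀ t, 0 < l t) :
    IsConeLoop T ℛ γ R₀ M (fun t => l t • v t) := by
  refine hv.of_segment hT hM hR₀ (hl.smul hv.cont) (fun t => ?_) 0 fun t _ σ hσ => ?_
  · rw [hv.equiv, hlp t, map_smul]
  · have hpos : 0 < 1 - σ + σ * l t := by
      rcases hσ.1.eq_or_lt with h | h
      · rw [← h]; simp
      · have := mul_pos h (hl0 t)
        linarith [hσ.2]
    rw [smul_smul, ← add_smul, smul_mem_collisionSet hpos.ne']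
    exact hv.avoid t

lemma IsConeLoop.comp (hM : 0 < M) {v : ℝ → E3}
    (hv : IsConeLoop T ℛ γ R₀ M v) {φ : ℝ → ℝ} (hφ : Continuous φ)
    (hφτ : ∀ t, φ (t + T / M) = φ t + T / M) : IsConeLoop T ℛ γ R₀ M (v ∘ φ) := by
  have hφT : ∀ t, φ (t + T) = φ t + T := fun t => by
    rw [translation_period hM hφτ]
    have : (M : ℝ) ≠ 0 := by positivity
    field_simp
  refine ⟨hv.cont.comp hφ, fun t => ?_, fun t => hv.avoid _, hv.hom.trans
    (freelyHomotopic_comp hv.cont hφ hv.per hφT hv.avoid), fun t => ?_⟩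
  · simp only [Function.comp, hφT, hv.per (φ t)]
  · simp only [Function.comp, hφτ, hv.equiv]

/-- Reparametrization: a spherical loop whose increments are bounded by those of `F` can be swept
with speed at most `c'`, for every `c'` greater than the mean growth `c` of `F`. -/
lemma IsConeLoop.exists_lipschitz_reparam (hT : 0 < T) (hM : 0 < M) {v : ℝ → E3}
    (hv : IsConeLoop T ℛ γ R₀ M v) {F : ℝ → ℝ} (hF : Continuous F)
    (hFv : ∀ x y, x ≤ y → ‖v y - v x‖ ≤ F y - F x) {c c' : ℝ}
    (hFτ : ∀ t, F (t + T / M) = F t + T / M * c) (hc : c < c') :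
    ∃ φ : ℝ → ℝ, LipschitzWith c'.toNNReal (v ∘ φ) ∧ v ∘ φ ∈ cone T ℛ γ R₀ M := by
  have hτ : 0 < T / M := div_pos hT (by exact_mod_cast hM)
  have hFm : Monotone F := fun x y h => by
    have := (norm_nonneg _).trans (hFv x y h)
    linarith
  have hc0 : 0 ≤ c := by
    have h1 := hFm (show (0 : ℝ) ≤ 0 + T / M by linarith)
    rw [hFτ] at h1
    have : 0 ≤ T / M * c := by linarith
    exact nonneg_of_mul_nonneg_right this hτ
  set G : ℝ → ℝ := fun t => F t + (c' - c) * t with hG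
  have hd : 0 < c' - c := sub_pos.2 hc
  have hGm : StrictMono G := fun x y h => by
    have := hFm h.le
    have := mul_lt_mul_of_pos_left h hd
    simp only [hG]; linarith
  have hGc : Continuous G := by fun_prop
  have hGτ : ∀ t, G (t + T / M) = G t + T / M * c' := fun t => by
    simp only [hG, hFτ]; ring
  have htop : Tendsto G atTop atTop := by
    refine tendsto_atTop_mono' atTop ?_ (tendsto_atTop_add_const_left atTop (F 0)
      (tendsto_id.const_mul_atTop hd))
    filter_upwards [eventually_ge_atTop 0] with t ht
    have := hFm ht
    simp only [hG, id]; linarith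
  have hbot : Tendsto G atBot atBot := by
    refine tendsto_atBot_mono' atBot ?_ (tendsto_atBot_add_const_left atBot (F 0)
      (tendsto_id.const_mul_atBot hd))
    filter_upwards [eventually_le_atBot 0] with t ht
    have := hFm ht
    simp only [hG, id]; linarith
  have hsurj := hGc.surjective htop hbot
  let e := hGm.orderIsoOfSurjective G hsurj
  have he : ∀ t, G (e.symm t) = t := fun t => e.apply_symm_apply t
  set φ : ℝ → ℝ := fun t => e.symm (c' * t) with hφ
  have hφc : Continuous φ := e.symm.continuous.comp (by fun_prop)
  have hφτ : ∀ t, φ (t + T / M) = φ t + T / M := by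
    intro t
    apply hGm.injective
    rw [hGτ]
    simp only [hφ, he]; ring
  have hLip : LipschitzWith c'.toNNReal (v ∘ φ) := by
    refine LipschitzWith.of_dist_le_mul fun x y => ?_
    wlog hxy : y ≤ x generalizing x y
    · rw [dist_comm, dist_comm x]
      exact this y x (not_le.1 hxy).le
    have hφm : φ y ≤ φ x := e.symm.monotone (mul_le_mul_of_nonneg_left hxy (hc0.trans hc.le))
    have h1 := hFv _ _ hφm
    have h2 := mul_le_mul_of_nonneg_left hφm hd.le
    have h3 : G (φ x) = c' * x := he _
    have h4 : G (φ y) = c' * y := he _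
    simp only [hG] at h3 h4
    rw [dist_eq_norm, Real.dist_eq, abs_of_nonneg (sub_nonneg.2 hxy),
      Real.coe_toNNReal _ (hc0.trans hc.le)]
    simp only [Function.comp]
    linarith
  have hcl := hv.comp hM hφc hφτ
  exact ⟨φ, hLip, hcl.mem_cone (isH1Loop_of_lipschitz hT hcl.per hLip)⟩

/-- The infimum of the speeds at which a spherical loop in the cone can be swept. Multiplied by the
symmetry period `T / M` it is the infimum of the lengths of the radial projections to the sphere,
over one symmetry period, of the loops in the cone. -/
noncomputable def minSpeed (T : ℝ) (ℛ : Subgroup (E3 ≃ₗᵢ[ℝ] E3)) (γ : ℝ → E3)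
    (R₀ : E3 ≃ₗᵢ[ℝ] E3) (M : ℕ) : ℝ≥0 :=
  sInf {c : ℝ≥0 | ∃ w ∈ cone T ℛ γ R₀ M, (∀ t, ‖w t‖ = 1) ∧ LipschitzWith c w}

lemma minSpeed_le {c : ℝ≥0} {w : ℝ → E3} (hw : w ∈ cone T ℛ γ R₀ M) (h1 : ∀ t, ‖w t‖ = 1)
    (hc : LipschitzWith c w) : minSpeed T ℛ γ R₀ M ≤ c :=
  csInf_le (OrderBot.bddBelow _) ⟨w, hw, h1, hc⟩

/-- The length of a spherical loop over one symmetry period is bounded below. -/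
lemma IsConeLoop.minSpeed_mul_le (hT : 0 < T) (hM : 0 < M) {s : ℝ → E3}
    (hs : IsConeLoop T ℛ γ R₀ M s) (hs1 : ∀ t, ‖s t‖ = 1)
    (hac : ∀ a b, AbsolutelyContinuousOnInterval s a b) (a : ℝ) :
    minSpeed T ℛ γ R₀ M * (T / M) ≤ ∫ t in a..(a + T / M), ‖deriv s t‖ := by
  have hτ : 0 < T / M := div_pos hT (by exact_mod_cast hM)
  have hi : ∀ x y, IntervalIntegrable (fun t => ‖deriv s t‖) volume x y := fun x y =>
    (ac_intervalIntegrable_deriv (hac x y)).norm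
  have hper : Function.Periodic (fun t => ‖deriv s t‖) (T / M) := by
    exact norm_deriv_periodic_of_equivariant hs.equiv
  rw [hper.intervalIntegral_add_eq a 0, zero_add]
  set I := ∫ t in (0 : ℝ)..T / M, ‖deriv s t‖ with hI
  have key : ∀ c' : ℝ, I / (T / M) < c' → (minSpeed T ℛ γ R₀ M : ℝ) ≤ c' := by
    intro c' hc'
    have hI0 : 0 ≤ I := intervalIntegral.integral_nonneg hτ.le fun _ _ => norm_nonneg _
    have hc0 : 0 ≤ c' := (div_nonneg hI0 hτ.le).trans hc'.le
    obtain ⟨φ, hL, hm⟩ := hs.exists_lipschitz_reparam hT hM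
      (F := fun t => ∫ x in (0 : ℝ)..t, ‖deriv s x‖) (continuous_primitive hi 0)
      (fun x y hxy => by
        rw [integral_interval_sub_left (hi _ _) (hi _ _)]
        exact ac_norm_sub_le hxy (hac x y))
      (c := I / (T / M)) (fun t => by
        rw [mul_div_cancel₀ _ hτ.ne', hper.intervalIntegral_add_eq_add 0 t hi, zero_add]) hc'
    have := minSpeed_le hm (fun t => hs1 _) hL
    rw [← NNReal.coe_le_coe, Real.coe_toNNReal _ hc0] at this
    exact this
  rw [← le_div_iff₀ hτ]
  exact le_of_forall_gt_imp_ge_of_dense fun c' h => key c' h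

/-! ### Replacing an arc of a spherical loop -/

section Equivariant

variable {τ : ℝ}

/-- The extension of a function on `[a, a + τ)` to `ℝ` by the rule `v (t + τ) = R₀ (v t)`. -/
noncomputable def equivariantExtension (R₀ : E3 ≃ₗᵢ[ℝ] E3) (hτ : 0 < τ) (a : ℝ) (p : ℝ → E3)
    (t : ℝ) : E3 :=
  (R₀ ^ toIcoDiv hτ a t) (p (toIcoMod hτ a t))

lemma equivariantExtension_add (hτ : 0 < τ) (a : ℝ) (p : ℝ → E3) (t : ℝ) :
    equivariantExtension R₀ hτ a p (t + τ) = R₀ (equivariantExtension R₀ hτ a p t) := by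
  unfold equivariantExtension
  rw [toIcoDiv_add_right, toIcoMod_add_right, add_comm, zpow_one_add]
  rfl

lemma equivariantExtension_of_mem (hτ : 0 < τ) {a t : ℝ} (p : ℝ → E3) (ht : t ∈ Ico a (a + τ)) :
    equivariantExtension R₀ hτ a p t = p t := by
  unfold equivariantExtension
  have h1 : toIcoDiv hτ a t = 0 := toIcoDiv_eq_of_sub_zsmul_mem_Ico hτ (by simpa using ht)
  have h2 : toIcoMod hτ a t = t := (toIcoMod_eq_self hτ).2 ht
  rw [h1, h2, zpow_zero]; rfl

lemma equivariantExtension_of_mem_Icc (hτ : 0 < τ) {a t : ℝ} {p : ℝ → E3}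
    (hp : p (a + τ) = R₀ (p a)) (ht : t ∈ Icc a (a + τ)) :
    equivariantExtension R₀ hτ a p t = p t := by
  rcases ht.2.eq_or_lt with rfl | h
  · rw [equivariantExtension_add, hp, equivariantExtension_of_mem hτ p ⟨le_rfl, by linarith⟩]
  · exact equivariantExtension_of_mem hτ p ⟨ht.1, h⟩

/-- An equivariant function that is Lipschitz on one period is Lipschitz. -/
lemma lipschitzWith_of_equivariant (hτ : 0 < τ) {v : ℝ → E3} (hv : ∀ t, v (t + τ) = R₀ (v t))
    (a : ℝ) {C : ℝ≥0} (h : LipschitzOnWith C v (Icc a (a + τ))) : LipschitzWith C v := by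
  have hshift : ∀ x y, dist (v (x + τ)) (v (y + τ)) = dist (v x) (v y) := fun x y => by
    rw [hv, hv, R₀.dist_map]
  have key : ∀ n : ℕ, ∀ x ∈ Icc a (a + τ), ∀ y, x ≤ y → y ≤ a + (n + 1) * τ →
      dist (v y) (v x) ≤ C * (y - x) := by
    intro n
    induction n with
    | zero =>
      intro x hx y hxy hy
      have := h.dist_le_mul y ⟨hx.1.trans hxy, by simpa using hy⟩ x hx
      rwa [Real.dist_eq, abs_of_nonneg (sub_nonneg.2 hxy)] at this
    | succ n ih =>
      intro x hx y hxy hy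
      by_cases hya : y ≤ a + τ
      · have := h.dist_le_mul y ⟨hx.1.trans hxy, hya⟩ x hx
        rwa [Real.dist_eq, abs_of_nonneg (sub_nonneg.2 hxy)] at this
      · have h1 := h.dist_le_mul (a + τ) ⟨by linarith, le_rfl⟩ x hx
        rw [Real.dist_eq, abs_of_nonneg (sub_nonneg.2 hx.2)] at h1
        have h2 := ih a ⟨le_rfl, by linarith⟩ (y - τ) (by linarith) (by
          push_cast at hy; linarith)
        rw [← hshift, sub_add_cancel] at h2
        have := dist_triangle (v y) (v (a + τ)) (v x)
        linarith
  refine LipschitzWith.of_dist_le_mul fun y x => ?_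
  wlog hxy : x ≤ y generalizing x y
  · rw [dist_comm, dist_comm y]
    exact this x y (not_le.1 hxy).le
  obtain ⟨k, x', hx', rfl⟩ := exists_int_mem_Ico hτ a x
  obtain ⟨n, hn⟩ := exists_nat_ge ((y - k * τ - a) / τ)
  rw [div_le_iff₀ hτ] at hn
  have h1 := key n x' ⟨hx'.1, hx'.2.le⟩ (y - k * τ) (by linarith) (by linarith)
  have h2 : dist (v y) (v (x' + k * τ)) = dist (v (y - k * τ)) (v x') := by
    have h3 := equivariant_zpow hv k (y - k * τ)
    rw [sub_add_cancel] at h3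
    rw [h3, equivariant_zpow hv k, LinearIsometryEquiv.dist_map]
  rw [h2, Real.dist_eq, abs_of_nonneg (sub_nonneg.2 hxy)]
  linarith

end Equivariant

/-- If the arc `s '' [a, b]` of a spherical loop is replaced by an arc `g` without crossing the
collisions, then the new loop is not shorter than the infimum of the lengths. -/
lemma IsConeLoop.minSpeed_le_of_replace (hT : 0 < T) (hM : 0 < M) (hR₀ : R₀ ∈ ℛ) {s : ℝ → E3}
    (hs : IsConeLoop T ℛ γ R₀ M s) (hs1 : ∀ t, ‖s t‖ = 1) {c : ℝ≥0} (hsL : LipschitzWith c s)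
    {a b : ℝ} (hab : a < b) (hb : b ≤ a + T / M) {g : ℝ → E3} {C : ℝ≥0}
    (hg : LipschitzOnWith C g (Icc a b)) (hg1 : ∀ t ∈ Icc a b, ‖g t‖ = 1) (hga : g a = s a)
    (hgb : g b = s b) (hseg : ∀ t ∈ Icc a b, ∀ σ ∈ Icc (0 : ℝ) 1,
      (1 - σ) • s t + σ • g t ∉ collisionSet ℛ) :
    minSpeed T ℛ γ R₀ M * (T / M) ≤ (∫ t in a..b, ‖deriv g t‖) + c * (T / M - (b - a)) := by
  have hτ : 0 < T / M := div_pos hT (by exact_mod_cast hM)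
  set τ := T / M with hτdef
  set p : ℝ → E3 := fun t => if t ≤ b then g t else s t with hp
  have hpg : ∀ t ≤ b, p t = g t := fun t ht => if_pos ht
  have hps : ∀ t, b ≤ t → p t = s t := fun t ht => by
    rcases ht.eq_or_lt with rfl | h
    · rw [hpg _ le_rfl, hgb]
    · exact if_neg (not_le.2 h)
  have hpτ : p (a + τ) = R₀ (p a) := by
    rw [hps _ hb, hpg a hab.le, hga, hs.equiv]
  set w := equivariantExtension R₀ hτ a p with hw
  have hwp : ∀ t ∈ Icc a (a + τ), w t = p t := fun t ht =>
    equivariantExtension_of_mem_Icc hτ hpτ ht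
  have hwe : ∀ t, w (t + τ) = R₀ (w t) := equivariantExtension_add hτ a p
  have hwL0 : LipschitzOnWith (max C c) w (Icc a (a + τ)) := by
    refine LipschitzOnWith.of_dist_le_mul fun y hy x hx => ?_
    wlog hxy : x ≤ y generalizing x y
    · rw [dist_comm, dist_comm y]
      exact this x hx y hy (not_le.1 hxy).le
    rw [hwp y hy, hwp x hx, Real.dist_eq, abs_of_nonneg (sub_nonneg.2 hxy)]
    have hC1 : (C : ℝ) ≤ (max C c : ℝ≥0) := by exact_mod_cast le_max_left _ _
    have hC2 : (c : ℝ) ≤ (max C c : ℝ≥0) := by exact_mod_cast le_max_right _ _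
    have H1 : ∀ x y, a ≤ x → x ≤ y → y ≤ b → dist (g y) (g x) ≤ (max C c : ℝ≥0) * (y - x) := by
      intro x y hax hxy hyb
      have := hg.dist_le_mul y ⟨hax.trans hxy, hyb⟩ x ⟨hax, hxy.trans hyb⟩
      rw [Real.dist_eq, abs_of_nonneg (sub_nonneg.2 hxy)] at this
      exact this.trans (mul_le_mul_of_nonneg_right hC1 (sub_nonneg.2 hxy))
    have H2 : ∀ x y, x ≤ y → dist (s y) (s x) ≤ (max C c : ℝ≥0) * (y - x) := by
      intro x y hxy
      have := hsL.dist_le_mul y x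
      rw [Real.dist_eq, abs_of_nonneg (sub_nonneg.2 hxy)] at this
      exact this.trans (mul_le_mul_of_nonneg_right hC2 (sub_nonneg.2 hxy))
    rcases le_total y b with hyb | hby
    · rw [hpg y hyb, hpg x (hxy.trans hyb)]
      exact H1 x y hx.1 hxy hyb
    · rw [hps y hby]
      rcases le_total x b with hxb | hbx
      · rw [hpg x hxb]
        have h1 := H1 x b hx.1 hxb le_rfl
        have h2 := H2 b y hby
        rw [hgb] at h1
        have := dist_triangle (s y) (s b) (g x)
        linarith
      · rw [hps x hbx]
        exact H2 x y hxy
  have hwL : LipschitzWith (max C c) w := lipschitzWith_of_equivariant hτ hwe a hwL0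
  have hwnorm : ∀ t, ‖w t‖ = 1 := by
    intro t
    obtain ⟨k, x, hx, rfl⟩ := exists_int_mem_Ico hτ a t
    rw [equivariant_zpow hwe, LinearIsometryEquiv.norm_map, hwp x ⟨hx.1, hx.2.le⟩]
    rcases le_total x b with h | h
    · rw [hpg x h]; exact hg1 x ⟨hx.1, h⟩
    · rw [hps x h]; exact hs1 x
  have hwcone : IsConeLoop T ℛ γ R₀ M w := by
    refine hs.of_segment hT hM hR₀ hwL.continuous hwe a fun t ht σ hσ => ?_
    rw [hwp t ⟨ht.1, ht.2.le⟩]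
    rcases le_total t b with h | h
    · rw [hpg t h]; exact hseg t ⟨ht.1, h⟩ σ hσ
    · rw [hps t h, ← add_smul, sub_add_cancel, one_smul]; exact hs.avoid t
  have hmain := hwcone.minSpeed_mul_le hT hM hwnorm (LipschitzWith.ac hwL) a
  have hi : ∀ x y, IntervalIntegrable (fun t => ‖deriv w t‖) volume x y := fun x y =>
    (ac_intervalIntegrable_deriv (LipschitzWith.ac hwL x y)).norm
  have hne : ∀ x : ℝ, ∀ᵐ t, t ≠ x := fun x => by simp [ae_iff, measure_singleton]
  rw [← integral_add_adjacent_intervals (hi a b) (hi b _)] at hmain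
  have e1 : ∫ t in a..b, ‖deriv w t‖ = ∫ t in a..b, ‖deriv g t‖ := by
    refine intervalIntegral.integral_congr_ae ?_
    filter_upwards [hne b] with t htb ht
    rw [uIoc_of_le hab.le] at ht
    have : w =ᶠ[𝓝 t] g := by
      filter_upwards [Ioo_mem_nhds ht.1 (lt_of_le_of_ne ht.2 htb)] with x hx
      rw [hwp x ⟨hx.1.le, hx.2.le.trans hb⟩, hpg x hx.2.le]
    rw [this.deriv_eq]
  have e2 : ∫ t in b..(a + τ), ‖deriv w t‖ ≤ c * (τ - (b - a)) := by
    have h1 : ∫ t in b..(a + τ), ‖deriv w t‖ ≤ ∫ t in b..(a + τ), (c : ℝ) := by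
      refine intervalIntegral.integral_mono_ae_restrict hb (hi _ _) (by simp) ?_
      refine (ae_restrict_iff' measurableSet_Icc).2 ?_
      filter_upwards [hne b, hne (a + τ)] with t htb hta ht
      have : w =ᶠ[𝓝 t] s := by
        filter_upwards [Ioo_mem_nhds (lt_of_le_of_ne ht.1 htb.symm) (lt_of_le_of_ne ht.2 hta)]
          with x hx
        rw [hwp x ⟨hab.le.trans hx.1.le, hx.2.le⟩, hps x hx.1.le]
      rw [this.deriv_eq]
      exact norm_deriv_le_of_lipschitzWith hsL t
    rw [intervalIntegral.integral_const, smul_eq_mul] at h1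
    linarith
  linarith

/-- The length of a Lipschitz arc. -/
lemma integral_norm_deriv_le {g : ℝ → E3} {a b K : ℝ} (hab : a ≤ b) (hK : 0 ≤ K)
    (h : ∀ x ∈ Icc a b, ∀ y ∈ Icc a b, ‖g y - g x‖ ≤ K * |y - x|) :
    IntervalIntegrable (fun t => ‖deriv g t‖) volume a b ∧
      ∫ t in a..b, ‖deriv g t‖ ≤ K * (b - a) := by
  have hL : LipschitzOnWith K.toNNReal g (Icc a b) :=
    LipschitzOnWith.of_dist_le_mul fun y hy x hx => by
      rw [dist_eq_norm, Real.coe_toNNReal _ hK, Real.dist_eq]; exact h x hx y hy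
  have hac : AbsolutelyContinuousOnInterval g a b := by
    apply LipschitzOnWith.absolutelyContinuousOnInterval (K := K.toNNReal)
    rwa [uIcc_of_le hab]
  have hi := (ac_intervalIntegrable_deriv hac).norm
  refine ⟨hi, ?_⟩
  have h1 : ∫ t in a..b, ‖deriv g t‖ ≤ ∫ t in a..b, K := by
    refine intervalIntegral.integral_mono_ae_restrict hab hi (by simp) ?_
    refine (ae_restrict_iff' measurableSet_Icc).2 ?_
    have hne : ∀ x : ℝ, ∀ᵐ t, t ≠ x := fun x => by simp [ae_iff, measure_singleton]
    filter_upwards [hne a, hne b] with t hta htb ht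
    have := norm_deriv_le_of_lipschitzOn
      (Icc_mem_nhds (lt_of_le_of_ne ht.1 hta.symm) (lt_of_le_of_ne ht.2 htb)) hL
    rwa [Real.coe_toNNReal _ hK] at this
  rw [intervalIntegral.integral_const, smul_eq_mul] at h1
  linarith

/-! ### Length comparisons near and away from the rotation axes -/

open InnerProductGeometry in
lemma two_mul_angle_le_pi_mul_dist {x y : E3} (hx : ‖x‖ = 1) (hy : ‖y‖ = 1) :
    2 * angle x y ≤ Real.pi * ‖y - x‖ := by
  have h1 : ‖y - x‖ ^ 2 = 2 - 2 * Real.cos (angle x y) := by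
    rw [norm_sub_sq_real, hx, hy, cos_angle, hx, hy, real_inner_comm]; ring
  have h2 := Real.cos_le_one_sub_mul_cos_sq (x := angle x y)
    (by rw [abs_of_nonneg (angle_nonneg x y)]; exact angle_le_pi x y)
  have hpi := Real.pi_pos
  have h3 : 4 * angle x y ^ 2 ≤ Real.pi ^ 2 * ‖y - x‖ ^ 2 := by
    have h4 : 2 / Real.pi ^ 2 * angle x y ^ 2 * Real.pi ^ 2 = 2 * angle x y ^ 2 := by field_simp
    have h5 := mul_le_mul_of_nonneg_right h2 (sq_nonneg Real.pi)
    rw [h1]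
    linarith
  refine (abs_le_of_sq_le_sq' ?_ (by positivity)).2
  rw [mul_pow, mul_pow]
  linarith

open InnerProductGeometry in
/-- Two points of the unit sphere that are not antipodal are joined by a great-circle arc swept
with constant speed. -/
lemma exists_geodesic_arc {x y : E3} (hx : ‖x‖ = 1) (hy : ‖y‖ = 1) (hne : angle x y ≠ Real.pi)
    {a b : ℝ} (hab : a < b) : ∃ g : ℝ → E3, g a = x ∧ g b = y ∧ (∀ t, ‖g t‖ = 1) ∧
      ∀ u v, ‖g v - g u‖ ≤ angle x y / (b - a) * |v - u| := by
  have hin : inner ℝ x y = Real.cos (angle x y) := by rw [cos_angle, hx, hy]; simp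
  rcases eq_or_ne (angle x y) 0 with h0 | h0
  · have hxy : x = y := by
      rw [h0, Real.cos_zero] at hin
      exact (inner_eq_one_iff_of_norm_eq_one hx hy).1 hin
    exact ⟨fun _ => x, rfl, hxy, fun _ => hx, fun u v => by simp [h0]⟩
  · set θ := angle x y with hθ
    have hsin : 0 < Real.sin θ := Real.sin_pos_of_pos_of_lt_pi
      (lt_of_le_of_ne (angle_nonneg x y) h0.symm) (lt_of_le_of_ne (angle_le_pi x y) hne)
    set z : E3 := (Real.sin θ)⁻¹ • (y - Real.cos θ • x) with hz
    have hxx : inner ℝ x x = (1 : ℝ) := by rw [real_inner_self_eq_norm_sq, hx]; norm_num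
    have hyy : inner ℝ y y = (1 : ℝ) := by rw [real_inner_self_eq_norm_sq, hy]; norm_num
    have hyx : inner ℝ y x = Real.cos θ := by rw [real_inner_comm]; exact hin
    have hxz : inner ℝ x z = (0 : ℝ) := by
      rw [hz, inner_smul_right, inner_sub_right, inner_smul_right, hxx, hin]; ring
    have hzz : inner ℝ z z = (1 : ℝ) := by
      simp only [hz, inner_smul_right, inner_smul_left, inner_sub_right, inner_sub_left, hxx, hin,
        hyy, hyx]
      simp only [RCLike.conj_to_real]
      have := Real.sin_sq_add_cos_sq θ
      field_simp
      linear_combination -this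
    have hzx : inner ℝ z x = (0 : ℝ) := by rw [real_inner_comm]; exact hxz
    set k := θ / (b - a) with hk
    have hba : 0 < b - a := sub_pos.2 hab
    set g : ℝ → E3 := fun t => Real.cos (k * (t - a)) • x + Real.sin (k * (t - a)) • z with hg
    have hgin : ∀ u v, inner ℝ (g u) (g v) = Real.cos (k * (v - u)) := by
      intro u v
      simp only [hg, inner_add_left, inner_add_right, inner_smul_left, inner_smul_right, hxx, hzz,
        hxz, hzx, RCLike.conj_to_real]
      have : k * (v - u) = k * (v - a) - k * (u - a) := by ring
      rw [this, Real.cos_sub]; ring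
    have hg1 : ∀ t, ‖g t‖ = 1 := fun t => by
      have h1 := hgin t t
      rw [real_inner_self_eq_norm_sq, sub_self, mul_zero, Real.cos_zero] at h1
      exact (pow_eq_one_iff_of_nonneg (norm_nonneg _) two_ne_zero).1 h1
    refine ⟨g, by simp [hg], ?_, hg1, fun u v => ?_⟩
    · have : k * (b - a) = θ := by rw [hk]; field_simp
      simp only [hg, this, hz]
      rw [smul_smul, mul_inv_cancel₀ hsin.ne', one_smul]; abel
    · have hk0 : 0 ≤ k := div_nonneg (angle_nonneg x y) hba.le
      have h1 : ‖g v - g u‖ ^ 2 = 2 - 2 * Real.cos (k * (v - u)) := by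
        rw [norm_sub_sq_real, hg1, hg1, real_inner_comm, hgin]; ring
      have h2 := Real.one_sub_sq_div_two_le_cos (x := k * (v - u))
      refine (abs_le_of_sq_le_sq' ?_ (by positivity)).2
      rw [h1, mul_pow, sq_abs]; nlinarith

open InnerProductGeometry in
/-- Comparison of an arc that stays away from the collisions with the great-circle arc between its
endpoints. -/
lemma IsConeLoop.minSpeed_le_angle (hT : 0 < T) (hM : 0 < M) (hR₀ : R₀ ∈ ℛ) {s : ℝ → E3}
    (hs : IsConeLoop T ℛ γ R₀ M s) (hs1 : ∀ t, ‖s t‖ = 1) {c : ℝ≥0} (hsL : LipschitzWith c s)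
    {a b : ℝ} (hab : a < b) (hb : b ≤ a + T / M) {x₀ : E3} {δ : ℝ} (hδ1 : δ ≤ 1)
    (hδ : ∀ x ∈ Metric.ball x₀ δ, x ∉ collisionSet ℛ)
    (hball : ∀ t ∈ Icc a b, s t ∈ Metric.ball x₀ (δ / 8)) :
    minSpeed T ℛ γ R₀ M * (T / M) ≤ angle (s a) (s b) + c * (T / M - (b - a)) := by
  have hpi := Real.pi_lt_four
  have hang := two_mul_angle_le_pi_mul_dist (hs1 a) (hs1 b)
  have hda := hball a (left_mem_Icc.2 hab.le)
  have hdb := hball b (right_mem_Icc.2 hab.le)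
  have hdist : ‖s b - s a‖ < δ / 4 := by
    rw [Metric.mem_ball] at hda hdb
    rw [← dist_eq_norm]
    have := dist_triangle_right (s b) (s a) x₀
    linarith
  have hang' : angle (s a) (s b) < δ / 2 := by
    have : Real.pi * ‖s b - s a‖ ≤ 4 * ‖s b - s a‖ :=
      mul_le_mul_of_nonneg_right hpi.le (norm_nonneg _)
    linarith
  have hne : angle (s a) (s b) ≠ Real.pi := by
    have := Real.pi_gt_three
    intro h; linarith
  obtain ⟨g, hga, hgb, hg1, hgL⟩ := exists_geodesic_arc (hs1 a) (hs1 b) hne hab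
  have hba : 0 < b - a := sub_pos.2 hab
  set k := angle (s a) (s b) / (b - a) with hk
  have hk0 : 0 ≤ k := div_nonneg (angle_nonneg _ _) hba.le
  have hkb : k * (b - a) = angle (s a) (s b) := by rw [hk]; field_simp
  have hgball : ∀ t ∈ Icc a b, g t ∈ Metric.ball x₀ δ := by
    intro t ht
    have h1 := hgL a t
    rw [hga, abs_of_nonneg (sub_nonneg.2 ht.1)] at h1
    have h2 : k * (t - a) ≤ k * (b - a) :=
      mul_le_mul_of_nonneg_left (by linarith [ht.2]) hk0
    rw [Metric.mem_ball] at hda ⊢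
    have := dist_triangle (g t) (s a) x₀
    rw [dist_eq_norm (g t) (s a)] at this
    have hδ0 : 0 < δ := by linarith [norm_nonneg (s b - s a)]
    linarith
  have hL : LipschitzOnWith k.toNNReal g (Icc a b) :=
    LipschitzOnWith.of_dist_le_mul fun v _ u _ => by
      rw [dist_eq_norm, Real.coe_toNNReal _ hk0, Real.dist_eq]; exact hgL u v
  have h := hs.minSpeed_le_of_replace hT hM hR₀ hs1 hsL hab hb hL (fun t _ => hg1 t) hga hgb ?_
  · have h2 := (integral_norm_deriv_le hab.le hk0 fun u _ v _ => hgL u v).2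
    linarith
  · intro t ht σ hσ
    refine hδ _ ((convex_ball x₀ δ) ?_ (hgball t ht) (by linarith [hσ.2]) hσ.1 (by ring))
    exact Metric.ball_subset_ball (by
      have : 0 < δ := by linarith [norm_nonneg (s b - s a)]
      linarith) (hball t ht)

/-- Radial projection to the sphere is Lipschitz away from the origin. -/
lemma norm_normalize_sub_le {x y : E3} {m : ℝ} (hm : 0 < m) (hx : m ≤ ‖x‖) (hy : m ≤ ‖y‖) :
    ‖‖y‖⁻¹ • y - ‖x‖⁻¹ • x‖ ≤ 2 / m * ‖y - x‖ := by
  have hx0 : 0 < ‖x‖ := by linarith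
  have hy0 : 0 < ‖y‖ := by linarith
  have h1 : ‖y‖⁻¹ • y - ‖x‖⁻¹ • x = ‖x‖⁻¹ • ((y - x) + ((‖x‖ - ‖y‖) * ‖y‖⁻¹) • y) := by
    rw [smul_add, smul_sub, smul_smul, ← sub_eq_zero]
    have : ‖x‖⁻¹ * ((‖x‖ - ‖y‖) * ‖y‖⁻¹) = ‖y‖⁻¹ - ‖x‖⁻¹ := by field_simp
    rw [this, sub_smul]; abel
  have h2 : ‖((‖x‖ - ‖y‖) * ‖y‖⁻¹) • y‖ ≤ ‖y - x‖ := by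
    rw [norm_smul, norm_mul, norm_inv, norm_norm, mul_assoc, inv_mul_cancel₀ hy0.ne', mul_one,
      norm_sub_rev y]
    exact abs_norm_sub_norm_le x y
  have h3 : ‖x‖⁻¹ ≤ m⁻¹ := inv_anti₀ hm hx
  rw [h1, norm_smul, norm_inv, norm_norm]
  have h4 := norm_add_le (y - x) (((‖x‖ - ‖y‖) * ‖y‖⁻¹) • y)
  calc ‖x‖⁻¹ * ‖(y - x) + ((‖x‖ - ‖y‖) * ‖y‖⁻¹) • y‖ ≤ m⁻¹ * (‖y - x‖ + ‖y - x‖) := by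
        gcongr; exact h4.trans (by linarith)
    _ = _ := by ring

lemma ac_normalize {v : ℝ → E3} {a b : ℝ} (hv : AbsolutelyContinuousOnInterval v a b)
    (h0 : ∀ t ∈ uIcc a b, v t ≠ 0) :
    AbsolutelyContinuousOnInterval (fun t => ‖v t‖⁻¹ • v t) a b := by
  obtain ⟨t₀, ht₀, hmin⟩ := isCompact_uIcc.exists_isMinOn nonempty_uIcc hv.continuousOn.norm
  have hm : 0 < ‖v t₀‖ := norm_pos_iff.2 (h0 t₀ ht₀)
  refine ac_of_dist_le (2 / ‖v t₀‖) hv fun x hx y hy => ?_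
  rw [dist_eq_norm, dist_eq_norm]
  exact norm_normalize_sub_le hm (hmin hy) (hmin hx)

/-- Comparison of an arc that stays near a point `p` of a rotation axis with the arc that is pushed
towards `p`: the winding around the axis takes place on a small circle and costs arbitrarily little,
so that, up to a factor, only the distances of the endpoints from `p` matter. -/
lemma IsConeLoop.minSpeed_le_near_axis (hT : 0 < T) (hM : 0 < M) (hR₀ : R₀ ∈ ℛ) {s : ℝ → E3}
    (hs : IsConeLoop T ℛ γ R₀ M s) (hs1 : ∀ t, ‖s t‖ = 1) {c : ℝ≥0} (hsL : LipschitzWith c s)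
    {a b : ℝ} (hab : a < b) (hb : b ≤ a + T / M) {p : E3} (hp1 : ‖p‖ = 1) {δ : ℝ}
    (hδ1 : δ ≤ 1 / 2) {R : E3 ≃ₗᵢ[ℝ] E3} (hR : R ∈ ℛ) (hR1 : R ≠ 1) (hpR : p ∈ axis R)
    (hδ : Metric.ball p δ ∩ collisionSet ℛ ⊆ axis R)
    (hball : ∀ t ∈ Icc a b, s t ∈ Metric.ball p δ) :
    minSpeed T ℛ γ R₀ M * (T / M) ≤
      4 * (‖s a - p‖ + ‖s b - p‖) + c * (T / M - (b - a)) := by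
  have hba : 0 < b - a := sub_pos.2 hab
  have hsL' : ∀ x y, x ≤ y → ‖s y - s x‖ ≤ c * (y - x) := fun x y h => by
    have := hsL.dist_le_mul y x
    rwa [dist_eq_norm, Real.dist_eq, abs_of_nonneg (sub_nonneg.2 h)] at this
  have hpR' : R p = p := hpR
  -- `h` is the duration of the radial motion and the factor of the contraction towards `p`.
  have key : ∀ h : ℝ, 0 < h → h ≤ 1 → 2 * h ≤ b - a → minSpeed T ℛ γ R₀ M * (T / M) ≤
      4 * (‖s a - p‖ + ‖s b - p‖) + c * (T / M - (b - a)) + h * (4 * c * (b - a + 4)) := by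
    intro h hh hh1 hh2
    set χ : ℝ → ℝ := fun t => max h (max (1 - (t - a) / h) (1 - (b - t) / h)) with hχ
    have hχ0 : ∀ t, 0 < χ t := fun t => lt_max_of_lt_left hh
    have hχ1 : ∀ t ∈ Icc a b, χ t ≤ 1 := fun t ht => by
      have h1 : 0 ≤ (t - a) / h := div_nonneg (by linarith [ht.1]) hh.le
      have h2 : 0 ≤ (b - t) / h := div_nonneg (by linarith [ht.2]) hh.le
      exact max_le hh1 (max_le (by linarith) (by linarith))
    have hχL : ∀ x y, |χ y - χ x| ≤ 1 / h * |y - x| := by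
      intro x y
      have e1 : |(1 - (y - a) / h) - (1 - (x - a) / h)| = 1 / h * |y - x| := by
        rw [← abs_of_pos (one_div_pos.2 hh), ← abs_mul, ← abs_neg]
        congr 1; ring
      have e2 : |(1 - (b - y) / h) - (1 - (b - x) / h)| = 1 / h * |y - x| := by
        rw [← abs_of_pos (one_div_pos.2 hh), ← abs_mul]
        congr 1; ring
      refine (abs_max_sub_max_le_max _ _ _ _).trans (max_le ?_ ?_)
      · rw [sub_self, abs_zero]; positivity
      · exact (abs_max_sub_max_le_max _ _ _ _).trans (max_le e1.le e2.le)
    have hχa : χ a = 1 := by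
      have h1 : 1 ≤ (b - a) / h := by rw [le_div_iff₀ hh]; linarith
      simp only [hχ, sub_self, zero_div, sub_zero]
      rw [max_eq_left (by linarith : 1 - (b - a) / h ≤ 1), max_eq_right hh1]
    have hχb : χ b = 1 := by
      have h1 : 1 ≤ (b - a) / h := by rw [le_div_iff₀ hh]; linarith
      simp only [hχ, sub_self, zero_div, sub_zero]
      rw [max_eq_right (by linarith : 1 - (b - a) / h ≤ 1), max_eq_right hh1]
    have hχm : ∀ t ∈ Icc (a + h) (b - h), χ t = h := fun t ht => by
      have h1 : 1 ≤ (t - a) / h := by rw [le_div_iff₀ hh]; linarith [ht.1]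
      have h2 : 1 ≤ (b - t) / h := by rw [le_div_iff₀ hh]; linarith [ht.2]
      exact max_eq_left (max_le (by linarith) (by linarith))
    set g₀ : ℝ → E3 := fun t => p + χ t • (s t - p) with hg₀
    have hg₀ball : ∀ t ∈ Icc a b, ‖g₀ t - p‖ < δ := fun t ht => by
      have h1 := hball t ht
      rw [Metric.mem_ball, dist_eq_norm] at h1
      simp only [hg₀, add_sub_cancel_left]
      rw [norm_smul, Real.norm_of_nonneg (hχ0 t).le]
      calc χ t * ‖s t - p‖ ≤ 1 * ‖s t - p‖ :=
            mul_le_mul_of_nonneg_right (hχ1 t ht) (norm_nonneg _)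
        _ < δ := by rwa [one_mul]
    have hg₀half : ∀ t ∈ Icc a b, 1 / 2 ≤ ‖g₀ t‖ := fun t ht => by
      have h1 := hg₀ball t ht
      have h2 := norm_sub_norm_le p (g₀ t)
      rw [norm_sub_rev, hp1] at h2
      linarith
    have hg₀L : ∀ x ∈ Icc a b, ∀ y ∈ Icc a b,
        ‖g₀ y - g₀ x‖ ≤ |χ y - χ x| * ‖s y - p‖ + χ x * ‖s y - s x‖ := by
      intro x hx y hy
      have : g₀ y - g₀ x = (χ y - χ x) • (s y - p) + χ x • (s y - s x) := by
        simp only [hg₀]; module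
      rw [this]
      refine (norm_add_le _ _).trans ?_
      rw [norm_smul, norm_smul, Real.norm_eq_abs, Real.norm_of_nonneg (hχ0 x).le]
    set g : ℝ → E3 := fun t => ‖g₀ t‖⁻¹ • g₀ t with hg
    have hgL : ∀ x ∈ Icc a b, ∀ y ∈ Icc a b, ‖g y - g x‖ ≤ 4 * ‖g₀ y - g₀ x‖ :=
      fun x hx y hy => (norm_normalize_sub_le one_half_pos (hg₀half x hx) (hg₀half y hy)).trans_eq
        (by norm_num)
    have hpiece : ∀ x₁ x₂, a ≤ x₁ → x₁ ≤ x₂ → x₂ ≤ b → ∀ A B D : ℝ, 0 ≤ A → 0 ≤ B → 0 ≤ D →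
        (∀ x ∈ Icc x₁ x₂, ∀ y ∈ Icc x₁ x₂, |χ y - χ x| ≤ A * |y - x|) →
        (∀ x ∈ Icc x₁ x₂, χ x ≤ B) → (∀ x ∈ Icc x₁ x₂, ‖s x - p‖ ≤ D) →
        IntervalIntegrable (fun t => ‖deriv g t‖) volume x₁ x₂ ∧
        ∫ t in x₁..x₂, ‖deriv g t‖ ≤ 4 * (A * D + B * c) * (x₂ - x₁) := by
      intro x₁ x₂ h1 h12 h2 A B D hA hB hD H1 H2 H3
      refine integral_norm_deriv_le h12 (by positivity) fun x hx y hy => ?_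
      have hx' : x ∈ Icc a b := ⟨h1.trans hx.1, hx.2.trans h2⟩
      have hy' : y ∈ Icc a b := ⟨h1.trans hy.1, hy.2.trans h2⟩
      have hsd : ‖s y - s x‖ ≤ c * |y - x| := by
        have := hsL.dist_le_mul y x
        rwa [dist_eq_norm, Real.dist_eq] at this
      have e1 : |χ y - χ x| * ‖s y - p‖ ≤ A * |y - x| * D :=
        mul_le_mul (H1 x hx y hy) (H3 y hy) (norm_nonneg _) (by positivity)
      have e2 : χ x * ‖s y - s x‖ ≤ B * (c * |y - x|) :=
        mul_le_mul (H2 x hx) hsd (norm_nonneg _) hB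
      have := hgL x hx' y hy'
      have := hg₀L x hx' y hy'
      linarith
    have hdista : ∀ x ∈ Icc a (a + h), ‖s x - p‖ ≤ ‖s a - p‖ + c * h := fun x hx => by
      have h1 := hsL' a x hx.1
      have h2 : (c : ℝ) * (x - a) ≤ c * h := mul_le_mul_of_nonneg_left (by linarith [hx.2]) c.2
      have h3 := norm_add_le (s x - s a) (s a - p)
      rw [sub_add_sub_cancel] at h3
      linarith
    have hdistb : ∀ x ∈ Icc (b - h) b, ‖s x - p‖ ≤ ‖s b - p‖ + c * h := fun x hx => by
      have h1 := hsL' x b hx.2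
      have h2 : (c : ℝ) * (b - x) ≤ c * h := mul_le_mul_of_nonneg_left (by linarith [hx.1]) c.2
      have h3 := norm_add_le (s x - s b) (s b - p)
      rw [sub_add_sub_cancel, norm_sub_rev (s x) (s b)] at h3
      linarith
    have hdist1 : ∀ x ∈ Icc a b, ‖s x - p‖ ≤ 1 := fun x hx => by
      have := hball x hx
      rw [Metric.mem_ball, dist_eq_norm] at this
      linarith
    have P1 := hpiece a (a + h) le_rfl (by linarith) (by linarith) (1 / h) 1 (‖s a - p‖ + c * h)
      (by positivity) zero_le_one (by positivity) (fun x _ y _ => hχL x y)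
      (fun x hx => hχ1 x ⟨hx.1, by linarith [hx.2]⟩) hdista
    have P2 := hpiece (a + h) (b - h) (by linarith) (by linarith) (by linarith) 0 h 1 le_rfl hh.le
      zero_le_one (fun x hx y hy => by rw [hχm x hx, hχm y hy]; simp) (fun x hx => (hχm x hx).le)
      (fun x hx => hdist1 x ⟨by linarith [hx.1], by linarith [hx.2]⟩)
    have P3 := hpiece (b - h) b (by linarith) (by linarith) le_rfl (1 / h) 1 (‖s b - p‖ + c * h)
      (by positivity) zero_le_one (by positivity) (fun x _ y _ => hχL x y)
      (fun x hx => hχ1 x ⟨by linarith [hx.1], hx.2⟩) hdistb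
    have hint : ∫ t in a..b, ‖deriv g t‖ ≤
        4 * (‖s a - p‖ + ‖s b - p‖) + h * (4 * c * (b - a + 4)) := by
      rw [← integral_add_adjacent_intervals P1.1 (P2.1.trans P3.1),
        ← integral_add_adjacent_intervals P2.1 P3.1]
      have q1 := P1.2
      have q2 := P2.2
      have q3 := P3.2
      have r1 : 4 * (1 / h * (‖s a - p‖ + c * h) + 1 * c) * (a + h - a) =
          4 * ‖s a - p‖ + 8 * c * h := by field_simp; ring
      have r3 : 4 * (1 / h * (‖s b - p‖ + c * h) + 1 * c) * (b - (b - h)) =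
          4 * ‖s b - p‖ + 8 * c * h := by field_simp; ring
      have r2 : 4 * (0 * 1 + h * c) * (b - h - (a + h)) ≤ 4 * (h * c) * (b - a) := by
        have : 0 ≤ h * c := by positivity
        nlinarith
      rw [r1] at q1
      rw [r3] at q3
      linarith
    have hLip : LipschitzOnWith (4 * (1 / h * 1 + 1 * c)).toNNReal g (Icc a b) := by
      refine LipschitzOnWith.of_dist_le_mul fun y hy x hx => ?_
      rw [dist_eq_norm, Real.coe_toNNReal _ (by positivity), Real.dist_eq]
      have hsd : ‖s y - s x‖ ≤ c * |y - x| := by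
        have := hsL.dist_le_mul y x
        rwa [dist_eq_norm, Real.dist_eq] at this
      have e1 : |χ y - χ x| * ‖s y - p‖ ≤ 1 / h * |y - x| * 1 :=
        mul_le_mul (hχL x y) (hdist1 y hy) (norm_nonneg _) (by positivity)
      have e2 : χ x * ‖s y - s x‖ ≤ 1 * (c * |y - x|) :=
        mul_le_mul (hχ1 x hx) hsd (norm_nonneg _) zero_le_one
      have := hgL x hx y hy
      have := hg₀L x hx y hy
      linarith
    have hend : ∀ x, χ x = 1 → g x = s x := fun x hx => by
      simp only [hg, hg₀, hx, one_smul, add_sub_cancel, hs1, inv_one]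
    have h := hs.minSpeed_le_of_replace hT hM hR₀ hs1 hsL hab hb hLip (fun t ht => ?_)
      (hend a hχa) (hend b hχb) ?_
    · linarith
    · have : ‖g₀ t‖ ≠ 0 := by linarith [hg₀half t ht]
      simp only [hg, norm_smul, norm_inv, norm_norm]
      exact inv_mul_cancel₀ this
    · intro t ht σ hσ hmem
      have hn0 : 0 < ‖g₀ t‖⁻¹ := inv_pos.2 (by linarith [hg₀half t ht])
      -- A positive multiple of this point lies on the segment from `s t` to `g₀ t`.
      set m := 1 - σ + σ * ‖g₀ t‖⁻¹ with hm
      have hm0 : 0 < m := by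
        rcases hσ.1.eq_or_lt with h | h
        · rw [hm, ← h]; simp
        · have := mul_pos h hn0
          linarith [hσ.2]
      have hmem' := (smul_mem_collisionSet (inv_pos.2 hm0).ne').2 hmem
      set l := m⁻¹ * (σ * ‖g₀ t‖⁻¹) with hl
      have hl0 : 0 ≤ l := mul_nonneg (inv_pos.2 hm0).le (mul_nonneg hσ.1 hn0.le)
      have hl1 : m⁻¹ * (1 - σ) = 1 - l := by
        rw [hl, eq_sub_iff_add_eq, ← mul_add, ← hm, inv_mul_cancel₀ hm0.ne']
      have hl1' : 0 ≤ 1 - l := hl1 ▸ mul_nonneg (inv_pos.2 hm0).le (by linarith [hσ.2])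
      have he : m⁻¹ • ((1 - σ) • s t + σ • g t) = (1 - l) • s t + l • g₀ t := by
        simp only [hg]
        rw [smul_add, smul_smul, hl1, smul_smul, smul_smul, mul_assoc]
      rw [he] at hmem'
      have hin : (1 - l) • s t + l • g₀ t ∈ Metric.ball p δ :=
        convex_ball p δ (hball t ht) (by rw [Metric.mem_ball, dist_eq_norm]; exact hg₀ball t ht)
          hl1' hl0 (by ring)
      have hax : R ((1 - l) • s t + l • g₀ t) = (1 - l) • s t + l • g₀ t := hδ ⟨hin, hmem'⟩
      set q := (1 - l) + l * χ t with hq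
      have hq0 : 0 < q := by
        rcases hl0.eq_or_lt with h | h
        · rw [hq, ← h]; simp
        · have := mul_pos h (hχ0 t)
          linarith
      have he2 : (1 - l) • s t + l • g₀ t = q • s t + (l * (1 - χ t)) • p := by
        simp only [hg₀, hq]; module
      rw [he2, map_add, map_smul, map_smul, hpR', add_left_inj] at hax
      have : R (s t) = s t := smul_right_injective E3 hq0.ne' hax
      exact hs.avoid t ⟨R, hR, hR1, this⟩
  have hlim : Tendsto (fun h : ℝ => 4 * (‖s a - p‖ + ‖s b - p‖) + c * (T / M - (b - a)) +
      h * (4 * c * (b - a + 4))) (𝓝[>] 0)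
      (𝓝 (4 * (‖s a - p‖ + ‖s b - p‖) + c * (T / M - (b - a)))) := by
    have : Continuous (fun h : ℝ => 4 * (‖s a - p‖ + ‖s b - p‖) + c * (T / M - (b - a)) +
      h * (4 * c * (b - a + 4))) := by fun_prop
    have h0 := (this.tendsto 0).mono_left (nhdsWithin_le_nhds (s := Ioi 0))
    simpa using h0
  refine ge_of_tendsto hlim ?_
  have : Ioo (0 : ℝ) (min 1 ((b - a) / 2)) ∈ 𝓝[>] (0 : ℝ) :=
    Ioo_mem_nhdsGT (lt_min one_pos (by linarith))
  filter_upwards [this] with h hh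
  have h1 := hh.2.trans_le (min_le_left _ _)
  have h2 := hh.2.trans_le (min_le_right _ _)
  exact key h hh.1 h1.le (by linarith)

/-! ### Limits of spherical loops of nearly minimal speed -/

/-- A bounded equicontinuous sequence has a pointwise convergent subsequence. -/
lemma exists_subseq_tendsto {f : ℕ → ℝ → E3} {B : ℝ} (hB : ∀ n t, ‖f n t‖ ≤ B) {ω : ℝ → ℝ}
    (hω : Tendsto ω (𝓝 0) (𝓝 0)) (h : ∀ n x y, ‖f n x - f n y‖ ≤ ω (x - y)) :
    ∃ (φ : ℕ → ℕ) (g : ℝ → E3), StrictMono φ ∧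
      ∀ t, Tendsto (fun n => f (φ n) t) atTop (𝓝 (g t)) := by
  have hK : IsCompact (Set.pi univ fun _ : ℚ => Metric.closedBall (0 : E3) B) :=
    isCompact_univ_pi fun _ => isCompact_closedBall _ _
  obtain ⟨g₀, -, φ, hφ, hg₀⟩ := hK.tendsto_subseq (x := fun n (q : ℚ) => f n q)
    (fun n q _ => by simpa using hB n q)
  rw [tendsto_pi_nhds] at hg₀
  have hc : ∀ t, CauchySeq fun n => f (φ n) t := by
    intro t
    rw [Metric.cauchySeq_iff']
    intro ε hε
    obtain ⟨δ, hδ, hωδ⟩ := Metric.tendsto_nhds_nhds.1 hω (ε / 4) (by linarith)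
    obtain ⟨q, hq1, hq2⟩ := exists_rat_btwn (show t < t + δ by linarith)
    have hsmall : ∀ n, dist (f n t) (f n q) < ε / 4 := fun n => by
      have h1 := hωδ (x := t - q) (by
        rw [Real.dist_eq, sub_zero, abs_lt]; constructor <;> linarith)
      rw [Real.dist_eq, sub_zero] at h1
      rw [dist_eq_norm]
      exact (h n t q).trans_lt ((le_abs_self _).trans_lt h1)
    obtain ⟨N, hN⟩ := Metric.cauchySeq_iff'.1 (hg₀ q).cauchySeq (ε / 4) (by linarith)
    refine ⟨N, fun n hn => ?_⟩
    have h1 := hN n hn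
    simp only [Function.comp] at h1
    have h2 := dist_triangle4 (f (φ n) t) (f (φ n) q) (f (φ N) q) (f (φ N) t)
    have h3 := hsmall (φ n)
    have h4 := hsmall (φ N)
    rw [dist_comm] at h4
    linarith
  choose g hg using fun t => cauchySeq_tendsto_of_complete (hc t)
  exact ⟨φ, g, hφ, hg⟩

open InnerProductGeometry in
/-- A spherical curve of speed at most `L` moves by an angle at most `L * |b - a|`. -/
lemma angle_le_of_lipschitz {f : ℝ → E3} (hf : ∀ t, ‖f t‖ = 1) {L : ℝ≥0} (hL : LipschitzWith L f)
    (a b : ℝ) (hab : a ≤ b) : angle (f a) (f b) ≤ L * (b - a) := by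
  -- A chord of length at most `u` subtends an angle at most `u + O(u³)`; the cubic errors of a
  -- subdivision into `n` arcs add up to `O(1 / n²)`.
  have hstep : ∀ x y : ℝ, x ≤ y →
      angle (f x) (f y) ≤ L * (y - x) + (L * (y - x)) ^ 3 / 3 * (Real.pi / 2) ^ 3 := by
    intro x y hxy
    set θ := angle (f x) (f y) with hθ
    have hθ0 : 0 ≤ θ := angle_nonneg _ _
    have hθπ : θ ≤ Real.pi := angle_le_pi _ _
    have hd := hL.dist_le_mul y x
    rw [dist_eq_norm, Real.dist_eq, abs_of_nonneg (sub_nonneg.2 hxy)] at hd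
    set u := (L : ℝ) * (y - x) with hu
    have hu0 : 0 ≤ u := mul_nonneg L.2 (sub_nonneg.2 hxy)
    have h1 : ‖f y - f x‖ ^ 2 = 2 - 2 * Real.cos θ := by
      rw [norm_sub_sq_real, hf, hf, hθ, cos_angle, hf, hf, real_inner_comm]; ring
    have h2 : ‖f y - f x‖ = 2 * Real.sin (θ / 2) := by
      have hs : 0 ≤ Real.sin (θ / 2) := Real.sin_nonneg_of_nonneg_of_le_pi (by linarith)
        (by linarith)
      have hc : Real.cos θ = 1 - 2 * Real.sin (θ / 2) ^ 2 := by
        have := Real.cos_two_mul (θ / 2)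
        rw [mul_div_cancel₀ _ (two_ne_zero)] at this
        rw [this]
        linarith [Real.sin_sq_add_cos_sq (θ / 2)]
      refine (pow_left_inj₀ (norm_nonneg _) (by positivity) two_ne_zero).1 ?_
      rw [h1, hc]; ring
    have h3 : θ ≤ Real.pi / 2 * u := by
      have := two_mul_angle_le_pi_mul_dist (hf x) (hf y)
      have h4 : Real.pi * ‖f y - f x‖ ≤ Real.pi * u := mul_le_mul_of_nonneg_left hd Real.pi_pos.le
      linarith
    have h5 : θ / 2 - (θ / 2) ^ 3 / 6 ≤ Real.sin (θ / 2) := by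
      rcases hθ0.eq_or_lt with h | h
      · rw [← h]; simp
      · exact (Real.sin_gt_sub_cube (by linarith)).le
    have h6 : θ ^ 3 ≤ (Real.pi / 2 * u) ^ 3 := pow_le_pow_left₀ hθ0 h3 3
    have h7 : (Real.pi / 2 * u) ^ 3 = u ^ 3 * (Real.pi / 2) ^ 3 := by ring
    have h8 : 0 ≤ u ^ 3 * (Real.pi / 2) ^ 3 := by have := Real.pi_pos; positivity
    have h9 : (θ / 2) ^ 3 = θ ^ 3 / 8 := by ring
    rw [h9] at h5
    have h10 : u ^ 3 / 3 * (Real.pi / 2) ^ 3 = (u ^ 3 * (Real.pi / 2) ^ 3) / 3 := by ring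
    rw [h10]
    linarith
  have hsum : ∀ (h : ℝ), 0 ≤ h → ∀ n : ℕ, angle (f a) (f (a + n * h)) ≤
      n * (L * h + (L * h) ^ 3 / 3 * (Real.pi / 2) ^ 3) := by
    intro h hh n
    induction n with
    | zero =>
      have : f a ≠ 0 := norm_ne_zero_iff.1 (by rw [hf]; exact one_ne_zero)
      simp [angle_self this]
    | succ n ih =>
      have h1 := hstep (a + n * h) (a + (n + 1 : ℕ) * h) (by push_cast; linarith)
      have h2 : a + (n + 1 : ℕ) * h - (a + n * h) = h := by push_cast; ring
      rw [h2] at h1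
      have h3 := angle_le_angle_add_angle (f a) (f (a + n * h)) (f (a + (n + 1 : ℕ) * h))
      push_cast at *
      linarith
  have hn : ∀ n : ℕ, angle (f a) (f b) ≤ L * (b - a) +
      ((L * (b - a)) ^ 3 / 3 * (Real.pi / 2) ^ 3) * (1 / ((n : ℝ) + 1)) ^ 2 := by
    intro n
    have hn0 : (0 : ℝ) < n + 1 := by positivity
    have h1 := hsum ((b - a) / (n + 1)) (div_nonneg (sub_nonneg.2 hab) hn0.le) (n + 1)
    have h2 : a + ((n + 1 : ℕ) : ℝ) * ((b - a) / (n + 1)) = b := by push_cast; field_simp; ring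
    rw [h2] at h1
    refine h1.trans (le_of_eq ?_)
    push_cast
    field_simp
  have hlim : Tendsto (fun n : ℕ => L * (b - a) +
      ((L * (b - a)) ^ 3 / 3 * (Real.pi / 2) ^ 3) * (1 / ((n : ℝ) + 1)) ^ 2) atTop
      (𝓝 (L * (b - a) + ((L * (b - a)) ^ 3 / 3 * (Real.pi / 2) ^ 3) * 0 ^ 2)) :=
    ((tendsto_one_div_add_atTop_nhds_zero_nat.pow 2).const_mul _).const_add _
  simpa using ge_of_tendsto' hlim hn

/-- `u` is a limit of spherical loops in the cone whose speeds tend to the minimal speed. -/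
structure IsMinimizingLimit (T : ℝ) (ℛ : Subgroup (E3 ≃ₗᵢ[ℝ] E3)) (γ : ℝ → E3)
    (R₀ : E3 ≃ₗᵢ[ℝ] E3) (M : ℕ) (s : ℕ → ℝ → E3) (c : ℕ → ℝ≥0) (u : ℝ → E3) : Prop where
  mem : ∀ n, s n ∈ cone T ℛ γ R₀ M
  norm : ∀ n t, ‖s n t‖ = 1
  lip : ∀ n, LipschitzWith (c n) (s n)
  tendsto_speed : Tendsto c atTop (𝓝 (minSpeed T ℛ γ R₀ M))
  tendsto : ∀ t, Tendsto (fun n => s n t) atTop (𝓝 (u t))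

/-- The radial projection to the sphere of a loop in the cone. -/
lemma IsConeLoop.normalize (hT : 0 < T) (hM : 0 < M) (hR₀ : R₀ ∈ ℛ)
    (hℛ : IsFiniteRotationGroup ℛ) {v : ℝ → E3} (hv : IsConeLoop T ℛ γ R₀ M v) :
    IsConeLoop T ℛ γ R₀ M (fun t => ‖v t‖⁻¹ • v t) :=
  hv.smul hT hM hR₀ (hv.cont.norm.inv₀ fun t => norm_ne_zero_iff.2 (hv.ne_zero hℛ t))
    (fun t => by simp only [norm_periodic_of_equivariant hv.equiv t])
    fun t => inv_pos.2 (norm_pos_iff.2 (hv.ne_zero hℛ t))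

lemma norm_normalize_eq_one {x : E3} (hx : x ≠ 0) : ‖‖x‖⁻¹ • x‖ = 1 := by
  rw [norm_smul, norm_inv, norm_norm, inv_mul_cancel₀ (norm_ne_zero_iff.2 hx)]

/-- The radial projection to the sphere of a loop in the cone can be swept with bounded speed. -/
lemma exists_lipschitz_mem_cone (hT : 0 < T) (hM : 0 < M) (hR₀ : R₀ ∈ ℛ)
    (hℛ : IsFiniteRotationGroup ℛ) (hne : (cone T ℛ γ R₀ M).Nonempty) :
    ∃ c : ℝ≥0, ∃ w ∈ cone T ℛ γ R₀ M, (∀ t, ‖w t‖ = 1) ∧ LipschitzWith c w := by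
  obtain ⟨v, hv⟩ := hne
  have hτ : 0 < T / M := div_pos hT (by exact_mod_cast hM)
  have hvc := isConeLoop_of_mem_cone hT hv
  have hs := hvc.normalize hT hM hR₀ hℛ
  set s : ℝ → E3 := fun t => ‖v t‖⁻¹ • v t with hsdef
  have hac : ∀ a b, AbsolutelyContinuousOnInterval s a b := fun a b =>
    ac_normalize (hv.1.ac hT a b) fun t _ => hvc.ne_zero hℛ t
  have hi : ∀ x y, IntervalIntegrable (fun t => ‖deriv s t‖) volume x y := fun x y =>
    (ac_intervalIntegrable_deriv (hac x y)).norm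
  obtain ⟨φ, hL, hm⟩ := hs.exists_lipschitz_reparam hT hM
    (F := fun t => ∫ x in (0 : ℝ)..t, ‖deriv s x‖) (continuous_primitive hi 0)
    (fun x y hxy => by
      rw [integral_interval_sub_left (hi _ _) (hi _ _)]
      exact ac_norm_sub_le hxy (hac x y))
    (c := (∫ x in (0 : ℝ)..T / M, ‖deriv s x‖) / (T / M)) (fun t => by
      rw [mul_div_cancel₀ _ hτ.ne',
        (norm_deriv_periodic_of_equivariant hs.equiv).intervalIntegral_add_eq_add 0 t hi,
        zero_add]) (lt_add_one _)
  exact ⟨_, _, hm, fun t => norm_normalize_eq_one (hvc.ne_zero hℛ _), hL⟩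

/-- There are spherical loops whose speeds tend to the minimal speed, and a subsequence of them
converges because they are equi-Lipschitz. -/
lemma exists_isMinimizingLimit (hT : 0 < T) (hM : 0 < M) (hR₀ : R₀ ∈ ℛ)
    (hℛ : IsFiniteRotationGroup ℛ) (hne : (cone T ℛ γ R₀ M).Nonempty) :
    ∃ s c u, IsMinimizingLimit T ℛ γ R₀ M s c u := by
  obtain ⟨c₀, w₀, hw₀⟩ := exists_lipschitz_mem_cone hT hM hR₀ hℛ hne
  set S : Set ℝ≥0 := {c : ℝ≥0 | ∃ w ∈ cone T ℛ γ R₀ M, (∀ t, ‖w t‖ = 1) ∧ LipschitzWith c w}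
    with hS
  have hSne : S.Nonempty := ⟨c₀, w₀, hw₀⟩
  obtain ⟨c, -, hc, hcS⟩ := exists_seq_tendsto_sInf hSne (OrderBot.bddBelow S)
  choose s hs using hcS
  obtain ⟨B, hB⟩ := hc.bddAbove_range
  obtain ⟨φ, u, hφ, hu⟩ := exists_subseq_tendsto (f := s) (B := 1) (fun n t => ((hs n).2.1 t).le)
    (ω := fun x => B * |x|) (by
      have : Continuous fun x : ℝ => (B : ℝ) * |x| := by fun_prop
      simpa using this.tendsto 0) fun n x y => by
      have h1 := (hs n).2.2.dist_le_mul x y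
      rw [dist_eq_norm, Real.dist_eq] at h1
      have h2 : (c n : ℝ) ≤ B := by exact_mod_cast hB ⟨n, rfl⟩
      exact h1.trans (mul_le_mul_of_nonneg_right h2 (abs_nonneg _))
  exact ⟨s ∘ φ, c ∘ φ, u, fun n => (hs _).1, fun n => (hs _).2.1, fun n => (hs _).2.2,
    hc.comp hφ.tendsto_atTop, hu⟩

namespace IsMinimizingLimit

variable {s : ℕ → ℝ → E3} {c : ℕ → ℝ≥0} {u : ℝ → E3}

lemma norm_limit (h : IsMinimizingLimit T ℛ γ R₀ M s c u) (t : ℝ) : ‖u t‖ = 1 :=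
  tendsto_nhds_unique (h.tendsto t).norm (by simp [h.norm])

lemma lip_limit (h : IsMinimizingLimit T ℛ γ R₀ M s c u) :
    LipschitzWith (minSpeed T ℛ γ R₀ M) u := by
  refine LipschitzWith.of_dist_le_mul fun x y => ?_
  refine le_of_tendsto_of_tendsto' ((h.tendsto x).dist (h.tendsto y))
    ((NNReal.tendsto_coe.2 h.tendsto_speed).mul_const (dist x y)) fun n => ?_
  exact (h.lip n).dist_le_mul x y

lemma equiv_limit (h : IsMinimizingLimit T ℛ γ R₀ M s c u) (t : ℝ) : u (t + T / M) = R₀ (u t) := by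
  refine tendsto_nhds_unique (h.tendsto (t + T / M)) ?_
  have h1 := (R₀.continuous.tendsto (u t)).comp (h.tendsto t)
  refine h1.congr fun n => ((h.mem n).2.2.2 t).symm

lemma tendstoUniformlyOn_Icc (h : IsMinimizingLimit T ℛ γ R₀ M s c u) (a b : ℝ) {ε : ℝ}
    (hε : 0 < ε) : ∀ᶠ n in atTop, ∀ t ∈ Icc a b, ‖s n t - u t‖ < ε := by
  set L := minSpeed T ℛ γ R₀ M with hL
  have hc : ∀ᶠ n in atTop, c n ≤ L + 1 :=
      h.tendsto_speed.eventually_le_const (lt_add_of_pos_right _ one_pos)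
  refine isCompact_Icc.induction_on (p := fun S => ∀ᶠ n in atTop, ∀ t ∈ S, ‖s n t - u t‖ < ε)
    (by simp) (fun S S' hSS h => h.mono fun n hn t ht => hn t (hSS ht))
    (fun S S' h h' => (h.and h').mono fun n hn t ht => ht.elim (hn.1 t) (hn.2 t)) fun x _ => ?_
  have hd : 0 < ε / (4 * ((L : ℝ) + 1)) := by positivity
  refine ⟨Metric.ball x (ε / (4 * ((L : ℝ) + 1))), mem_nhdsWithin_of_mem_nhds
    (Metric.ball_mem_nhds _ hd), ?_⟩
  have hx := Metric.tendsto_nhds.1 (h.tendsto x) (ε / 4) (by linarith)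
  filter_upwards [hc, hx] with n hn hnx t ht
  rw [Metric.mem_ball] at ht
  rw [lt_div_iff₀ (by positivity)] at ht
  have h1 := (h.lip n).dist_le_mul t x
  have h2 := h.lip_limit.dist_le_mul t x
  have h3 : (c n : ℝ) ≤ L + 1 := by exact_mod_cast hn
  have h4 : (c n : ℝ) * dist t x ≤ (L + 1) * dist t x :=
    mul_le_mul_of_nonneg_right h3 dist_nonneg
  have h5 : (L : ℝ) * dist t x ≤ (L + 1) * dist t x :=
    mul_le_mul_of_nonneg_right (by linarith) dist_nonneg
  have h6 := dist_triangle4 (s n t) (s n x) (u x) (u t)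
  rw [dist_comm (u x)] at h6
  rw [← dist_eq_norm]
  linarith

open InnerProductGeometry in
/-- Away from the collisions the limit is locally a length-minimizing arc of the sphere. -/
lemma exists_angle_eq (h : IsMinimizingLimit T ℛ γ R₀ M s c u) (hT : 0 < T) (hM : 0 < M)
    (hR₀ : R₀ ∈ ℛ) (hℛ : IsFiniteRotationGroup ℛ) {t₀ : ℝ} (ht₀ : u t₀ ∉ collisionSet ℛ) :
    ∃ δ > 0, ∀ a b, t₀ - δ < a → a ≤ b → b < t₀ + δ →
      angle (u a) (u b) = minSpeed T ℛ γ R₀ M * (b - a) := by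
  have hτ : 0 < T / M := div_pos hT (by exact_mod_cast hM)
  set L := minSpeed T ℛ γ R₀ M with hL
  obtain ⟨d₀, hd₀, hball₀⟩ := Metric.isOpen_iff.1 (isClosed_collisionSet hℛ).isOpen_compl _ ht₀
  set d := min d₀ 1 with hd
  have hdpos : 0 < d := lt_min hd₀ one_pos
  have hball : ∀ x ∈ Metric.ball (u t₀) d, x ∉ collisionSet ℛ := fun x hx =>
    hball₀ (Metric.ball_subset_ball (min_le_left _ _) hx)
  set δ := min (T / M / 2) (d / (16 * ((L : ℝ) + 1))) with hδ
  have hδpos : 0 < δ := lt_min (by linarith) (by positivity)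
  refine ⟨δ, hδpos, fun a b ha hab hb => ?_⟩
  refine le_antisymm (angle_le_of_lipschitz h.norm_limit h.lip_limit a b hab) ?_
  have hu0 : ∀ t, u t ≠ 0 := fun t => norm_ne_zero_iff.1 (by rw [h.norm_limit]; exact one_ne_zero)
  rcases hab.eq_or_lt with rfl | hab'
  · simp [angle_self (hu0 a)]
  have hδ1 : δ ≤ T / M / 2 := min_le_left _ _
  have hδ2 : δ * (16 * ((L : ℝ) + 1)) ≤ d := by
    rw [← le_div_iff₀ (by positivity)]; exact min_le_right _ _
  have hnear : ∀ᶠ n in atTop, ∀ t ∈ Icc a b, s n t ∈ Metric.ball (u t₀) (d / 8) := by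
    filter_upwards [h.tendstoUniformlyOn_Icc a b (ε := d / 16) (by positivity)] with n hn t ht
    have h1 := hn t ht
    have h2 := h.lip_limit.dist_le_mul t t₀
    have h3 : dist t t₀ ≤ δ := by
      rw [Real.dist_eq, abs_le]; constructor <;> linarith [ht.1, ht.2]
    have h4 : (L : ℝ) * dist t t₀ ≤ L * δ := mul_le_mul_of_nonneg_left h3 L.2
    rw [← dist_eq_norm] at h1
    have := dist_triangle (s n t) (u t) (u t₀)
    rw [Metric.mem_ball]
    linarith
  have hlim : Tendsto (fun n => angle (s n a) (s n b) + c n * (T / M - (b - a))) atTop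
      (𝓝 (angle (u a) (u b) + L * (T / M - (b - a)))) := by
    have hA : Tendsto (fun n => (c n : ℝ) * (T / M - (b - a))) atTop
        (𝓝 (L * (T / M - (b - a)))) := (NNReal.tendsto_coe.2 h.tendsto_speed).mul_const _
    have hB : Tendsto (fun n => angle (s n a) (s n b)) atTop (𝓝 (angle (u a) (u b))) := by
      simp only [angle, h.norm, h.norm_limit, mul_one, div_one]
      exact (Real.continuous_arccos.tendsto _).comp ((h.tendsto a).inner (h.tendsto b))
    exact hB.add hA
  have hd1 : d ≤ 1 := min_le_right _ _
  have hba : b ≤ a + T / M := by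
    clear hlim hnear hball hball₀
    linarith only [hδ1, ha, hb, hτ]
  have hev : ∀ᶠ n in atTop, (L : ℝ) * (T / M) ≤
      angle (s n a) (s n b) + c n * (T / M - (b - a)) := by
    filter_upwards [hnear] with n hn
    exact (isConeLoop_of_mem_cone hT (h.mem n)).minSpeed_le_angle hT hM hR₀ (h.norm n) (h.lip n)
      hab' hba hd1 hball hn
  have h6 := ge_of_tendsto hlim hev
  linarith

/-- The collision times of the limit are isolated: between two nearby passages through the same
point `p` the approximating loops would be a definite length too long, since they can be
replaced by loops that stay close to `p`. -/
lemma isolated_collision (h : IsMinimizingLimit T ℛ γ R₀ M s c u) (hT : 0 < T) (hM : 0 < M)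
    (hR₀ : R₀ ∈ ℛ) (hℛ : IsFiniteRotationGroup ℛ) (hpos : 0 < minSpeed T ℛ γ R₀ M) {t₀ : ℝ}
    (ht₀ : u t₀ ∈ collisionSet ℛ) :
    ∃ δ > 0, ∀ t, |t - t₀| < δ → t ≠ t₀ → u t ∉ collisionSet ℛ := by
  have hτ : 0 < T / M := div_pos hT (by exact_mod_cast hM)
  set L := minSpeed T ℛ γ R₀ M with hL
  set p := u t₀ with hp
  have hp1 : ‖p‖ = 1 := h.norm_limit t₀
  have hp0 : p ≠ 0 := norm_ne_zero_iff.1 (by rw [hp1]; exact one_ne_zero)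
  obtain ⟨d₀, hd₀, R, hR, hR1, hball₀, hline⟩ := exists_ball_inter_subset_axis hℛ ht₀ hp0
  have hpR : p ∈ axis R := hball₀ ⟨Metric.mem_ball_self hd₀, ht₀⟩
  set d := min d₀ (1 / 2) with hd
  have hdpos : 0 < d := lt_min hd₀ one_half_pos
  have hball : Metric.ball p d ∩ collisionSet ℛ ⊆ axis R := fun x hx =>
    hball₀ ⟨Metric.ball_subset_ball (min_le_left _ _) hx.1, hx.2⟩
  set δ := min (T / M) (d / (2 * ((L : ℝ) + 1))) with hδ
  have hδpos : 0 < δ := lt_min hτ (by positivity)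
  have hδ1 : δ ≤ T / M := min_le_left _ _
  have hδ2 : δ * (2 * ((L : ℝ) + 1)) ≤ d := by
    rw [← le_div_iff₀ (by positivity)]; exact min_le_right _ _
  refine ⟨δ, hδpos, fun t ht hne hmem => ?_⟩
  have hutball : u t ∈ Metric.ball p d := by
    have h2 := h.lip_limit.dist_le_mul t t₀
    rw [Real.dist_eq] at h2
    have h4 : (L : ℝ) * |t - t₀| ≤ L * δ := mul_le_mul_of_nonneg_left ht.le L.2
    rw [Metric.mem_ball]
    have : 0 ≤ (L : ℝ) := L.2
    nlinarith
  have hut : u t = p := by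
    obtain ⟨k, hk⟩ := hline _ (hball ⟨hutball, hmem⟩)
    have h1 := h.norm_limit t
    rw [hk, norm_smul, hp1, mul_one, Real.norm_eq_abs] at h1
    rcases (abs_eq zero_le_one).1 h1 with rfl | rfl
    · rw [hk, one_smul]
    · exfalso
      rw [hk, Metric.mem_ball, dist_eq_norm] at hutball
      have : (-1 : ℝ) • p - p = (-2 : ℝ) • p := by module
      rw [this, norm_smul, hp1] at hutball
      have := min_le_right d₀ (1 / 2)
      norm_num at hutball
      linarith
  -- The limit cannot be at `p` at two times `a < b` less than `δ` apart: replacing the arcs of the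
  -- approximating loops over `[a, b]` by short ones would gain almost `L * (b - a)`.
  have key : ∀ a b, a < b → b - a < δ → u a = p → u b = p → False := by
    intro a b hab hbδ hua hub
    have hc : ∀ᶠ n in atTop, c n ≤ L + 1 :=
      h.tendsto_speed.eventually_le_const (lt_add_of_pos_right _ one_pos)
    have hta := Metric.tendsto_nhds.1 (h.tendsto a) (d / 2) (by linarith)
    have hlim : Tendsto (fun n => 4 * (‖s n a - p‖ + ‖s n b - p‖) + c n * (T / M - (b - a))) atTop
        (𝓝 (4 * (‖u a - p‖ + ‖u b - p‖) + L * (T / M - (b - a)))) :=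
      ((((h.tendsto a).sub_const p).norm.add ((h.tendsto b).sub_const p).norm).const_mul 4).add
        ((NNReal.tendsto_coe.2 h.tendsto_speed).mul_const _)
    rw [hua, hub, sub_self, norm_zero, add_zero, mul_zero, zero_add] at hlim
    have hev : ∀ᶠ n in atTop, (L : ℝ) * (T / M) ≤
        4 * (‖s n a - p‖ + ‖s n b - p‖) + c n * (T / M - (b - a)) := by
      filter_upwards [hc, hta] with n hn hna
      refine (isConeLoop_of_mem_cone hT (h.mem n)).minSpeed_le_near_axis hT hM hR₀ (h.norm n)
        (h.lip n) hab (by linarith) hp1 (min_le_right _ _) hR hR1 hpR hball fun x hx => ?_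
      have h1 := (h.lip n).dist_le_mul x a
      have h3 : (c n : ℝ) ≤ L + 1 := by exact_mod_cast hn
      rw [Real.dist_eq, abs_of_nonneg (by linarith [hx.1])] at h1
      have h5 : (c n : ℝ) * (x - a) ≤ (L + 1) * δ :=
        mul_le_mul h3 (by linarith [hx.2]) (by linarith [hx.1]) (by positivity)
      rw [hua] at hna
      have := dist_triangle (s n x) (s n a) p
      rw [Metric.mem_ball]
      linarith
    have h6 := ge_of_tendsto hlim hev
    have h7 : 0 < (L : ℝ) * (b - a) := mul_pos hpos (by linarith)
    linarith
  rcases lt_or_gt_of_ne hne with hlt | hgt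
  · rw [abs_of_neg (by linarith)] at ht
    exact key t t₀ hlt (by linarith) hut rfl
  · rw [abs_of_pos (by linarith)] at ht
    exact key t₀ t hgt (by linarith) rfl hut

end IsMinimizingLimit

/-! ### The limit is composed of great-circle arcs -/

/-- A curve on the sphere whose points subtend angles proportional to the time is a great-circle
arc. -/
lemma exists_greatCircle_of_inner_eq {f : ℝ → E3} {k : ℝ} (hk : 0 < k) {t₀ δ : ℝ} (hδ : 0 < δ)
    (h : ∀ x y, |x - t₀| < δ → |y - t₀| < δ → inner ℝ (f x) (f y) = Real.cos (k * (y - x))) :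
    ∃ η > 0, ∃ X Y : E3, ‖X‖ = 1 ∧ ‖Y‖ = 1 ∧ inner ℝ X Y = (0 : ℝ) ∧ ∀ t, |t - t₀| < η →
      f t = Real.cos (k * (t - t₀)) • X + Real.sin (k * (t - t₀)) • Y := by
  set ε := min (δ / 2) (1 / k) with hε
  have hε0 : 0 < ε := lt_min (by linarith) (by positivity)
  have hεδ : ε < δ := (min_le_left _ _).trans_lt (by linarith)
  have hkε : k * ε ≤ 1 := by
    have := mul_le_mul_of_nonneg_left (min_le_right (δ / 2) (1 / k)) hk.le
    rwa [mul_one_div, div_self hk.ne'] at this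
  have hB : 0 < Real.sin (k * ε) := Real.sin_pos_of_pos_of_lt_pi (by positivity)
    (by linarith [Real.pi_gt_three])
  set w := t₀ + ε with hw
  have h0 : |t₀ - t₀| < δ := by simpa using hδ
  have hwδ : |w - t₀| < δ := by rw [hw, add_sub_cancel_left, abs_of_pos hε0]; exact hεδ
  have e00 := h t₀ t₀ h0 h0
  have e0w := h t₀ w h0 hwδ
  have eww := h w w hwδ hwδ
  rw [sub_self, mul_zero, Real.cos_zero] at e00 eww
  rw [hw, add_sub_cancel_left, ← hw] at e0w
  have ew0 : inner ℝ (f w) (f t₀) = Real.cos (k * ε) := by rw [real_inner_comm]; exact e0w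
  set C := Real.cos (k * ε) with hC
  set S := Real.sin (k * ε) with hS
  have hSC : S ^ 2 + C ^ 2 = 1 := Real.sin_sq_add_cos_sq _
  set Y : E3 := S⁻¹ • (f w - C • f t₀) with hY
  have hXY : inner ℝ (f t₀) Y = (0 : ℝ) := by
    rw [hY, inner_smul_right, inner_sub_right, inner_smul_right, e00, e0w]; ring
  have hYY : inner ℝ Y Y = (1 : ℝ) := by
    simp only [hY, inner_smul_right, inner_smul_left, inner_sub_right, inner_sub_left, e00, e0w,
      ew0, eww, RCLike.conj_to_real]
    field_simp
    linear_combination -hSC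
  have hnorm : ∀ x : E3, inner ℝ x x = (1 : ℝ) → ‖x‖ = 1 := fun x hx => by
    rw [real_inner_self_eq_norm_sq] at hx
    exact (pow_eq_one_iff_of_nonneg (norm_nonneg _) two_ne_zero).1 hx
  refine ⟨δ, hδ, f t₀, Y, hnorm _ e00, hnorm _ hYY, hXY, fun t ht => ?_⟩
  have ett := h t t ht ht
  have et0 := h t t₀ ht h0
  have etw := h t w ht hwδ
  rw [sub_self, mul_zero, Real.cos_zero] at ett
  set c := Real.cos (k * (t - t₀)) with hc
  set s := Real.sin (k * (t - t₀)) with hs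
  have hsc : s ^ 2 + c ^ 2 = 1 := Real.sin_sq_add_cos_sq _
  have et0' : inner ℝ (f t) (f t₀) = c := by
    rw [et0, hc, ← Real.cos_neg]; congr 1; ring
  have etw' : inner ℝ (f t) (f w) = C * c + S * s := by
    rw [etw, hc, hs, hC, hS, ← Real.cos_sub]; congr 1; rw [hw]; ring
  have e0t : inner ℝ (f t₀) (f t) = c := by rw [real_inner_comm]; exact et0'
  have ewt : inner ℝ (f w) (f t) = C * c + S * s := by rw [real_inner_comm]; exact etw'
  have htY : inner ℝ (f t) Y = s := by
    rw [hY, inner_smul_right, inner_sub_right, inner_smul_right, et0', etw']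
    field_simp; ring
  have hYt : inner ℝ Y (f t) = s := by rw [real_inner_comm]; exact htY
  have hYX : inner ℝ Y (f t₀) = (0 : ℝ) := by rw [real_inner_comm]; exact hXY
  have hzero : inner ℝ (f t - (c • f t₀ + s • Y)) (f t - (c • f t₀ + s • Y)) = (0 : ℝ) := by
    simp only [inner_sub_left, inner_sub_right, inner_add_left, inner_add_right, inner_smul_left,
      inner_smul_right, ett, et0', e0t, htY, hYt, hXY, hYX, hYY, e00, RCLike.conj_to_real]
    linear_combination -hsc
  exact sub_eq_zero.1 (inner_self_eq_zero.1 hzero)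

/-- A curve that is locally a great-circle arc of speed `k` is a great-circle arc. -/
lemma exists_greatCircle_of_local {f : ℝ → E3} (hf : Continuous f) {k : ℝ} (hk : 0 < k) {a b : ℝ}
    (hab : a < b) (h : ∀ t₀ ∈ Ioo a b, ∃ η > 0, ∃ X Y : E3, ‖X‖ = 1 ∧ ‖Y‖ = 1 ∧
      inner ℝ X Y = (0 : ℝ) ∧ ∀ t, |t - t₀| < η →
        f t = Real.cos (k * (t - t₀)) • X + Real.sin (k * (t - t₀)) • Y) :
    ∃ X Y : E3, ‖X‖ = 1 ∧ ‖Y‖ = 1 ∧ inner ℝ X Y = (0 : ℝ) ∧ ∀ t ∈ Icc a b,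
      f t = Real.cos (k * (t - a)) • X + Real.sin (k * (t - a)) • Y := by
  have hlin : ∀ (X Y : E3) (t₀ t : ℝ),
      HasDerivAt (fun x => Real.cos (k * (x - t₀)) • X + Real.sin (k * (x - t₀)) • Y)
        (k • (-Real.sin (k * (t - t₀)) • X + Real.cos (k * (t - t₀)) • Y)) t := by
    intro X Y t₀ t
    have h1 : HasDerivAt (fun x => k * (x - t₀)) k t := by
      simpa using ((hasDerivAt_id t).sub_const t₀).const_mul k
    have h2 := (h1.cos.smul_const X).add (h1.sin.smul_const Y)
    refine h2.congr_deriv ?_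
    module
  have hnhds : ∀ t₀ η : ℝ, 0 < η → ∀ᶠ t in 𝓝 t₀, |t - t₀| < η := fun t₀ η hη => by
    filter_upwards [Metric.ball_mem_nhds t₀ hη] with t ht
    rwa [Metric.mem_ball, Real.dist_eq] at ht
  -- The derivative, and the equation `f'' = -k² f`.
  have hloc : ∀ t₀ ∈ Ioo a b, HasDerivAt f (deriv f t₀) t₀ ∧
      HasDerivAt (deriv f) (-(k ^ 2) • f t₀) t₀ ∧ ‖f t₀‖ = 1 ∧ ‖deriv f t₀‖ = k ∧
      inner ℝ (f t₀) (deriv f t₀) = (0 : ℝ) := by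
    intro t₀ ht₀
    obtain ⟨η, hη, X, Y, hX, hY, hXY, hf⟩ := h t₀ ht₀
    have hder : ∀ t, |t - t₀| < η → HasDerivAt f
        (k • (-Real.sin (k * (t - t₀)) • X + Real.cos (k * (t - t₀)) • Y)) t := by
      intro t ht
      refine (hlin X Y t₀ t).congr_of_eventuallyEq ?_
      have : Metric.ball t₀ η ∈ 𝓝 t := Metric.isOpen_ball.mem_nhds (by
        rwa [Metric.mem_ball, Real.dist_eq])
      filter_upwards [this] with x hx
      exact hf x (by rwa [Metric.mem_ball, Real.dist_eq] at hx)
    have hself : |t₀ - t₀| < η := by simpa using hη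
    have hd0 := hder t₀ hself
    have hf0 := hf t₀ hself
    simp only [sub_self, mul_zero, Real.sin_zero, Real.cos_zero, neg_zero, zero_smul, one_smul,
      zero_add, add_zero] at hd0 hf0
    refine ⟨hd0.differentiableAt.hasDerivAt, ?_, by rw [hf0, hX], ?_, ?_⟩
    · have h1 := (hlin Y (-X) t₀ t₀).const_smul k
      have h2 : HasDerivAt (deriv f)
          (k • (k • (-Real.sin (k * (t₀ - t₀)) • Y + Real.cos (k * (t₀ - t₀)) • -X))) t₀ := by
        refine h1.congr_of_eventuallyEq ?_
        filter_upwards [hnhds t₀ η hη] with t ht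
        rw [(hder t ht).deriv, Pi.smul_apply]
        congr 1
        module
      refine h2.congr_deriv ?_
      simp only [sub_self, mul_zero, Real.sin_zero, Real.cos_zero, hf0]
      module
    · rw [hd0.deriv, norm_smul, hY, mul_one, Real.norm_of_nonneg hk.le]
    · rw [hd0.deriv, hf0, inner_smul_right, hXY, mul_zero]
  -- The two amplitudes are constant.
  set P : ℝ → E3 := fun t => Real.cos (k * (t - a)) • f t -
    (k⁻¹ * Real.sin (k * (t - a))) • deriv f t with hP
  set Q : ℝ → E3 := fun t => Real.sin (k * (t - a)) • f t +
    (k⁻¹ * Real.cos (k * (t - a))) • deriv f t with hQ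
  have hlinear : ∀ t, HasDerivAt (fun x => k * (x - a)) k t := fun t => by
    simpa using ((hasDerivAt_id t).sub_const a).const_mul k
  have hPd : ∀ t ∈ Ioo a b, HasDerivAt P 0 t := by
    intro t ht
    obtain ⟨h1, h2, -⟩ := hloc t ht
    have h3 := ((hlinear t).cos.smul h1).sub (((hlinear t).sin.const_mul k⁻¹).smul h2)
    refine h3.congr_deriv ?_
    have : k⁻¹ * (Real.cos (k * (t - a)) * k) = Real.cos (k * (t - a)) := by field_simp
    rw [this]
    have h4 : (k⁻¹ * Real.sin (k * (t - a))) • -k ^ 2 • f t =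
        (-Real.sin (k * (t - a)) * k) • f t := by
      rw [smul_smul]; congr 1; field_simp
    rw [h4]; module
  have hQd : ∀ t ∈ Ioo a b, HasDerivAt Q 0 t := by
    intro t ht
    obtain ⟨h1, h2, -⟩ := hloc t ht
    have h3 := ((hlinear t).sin.smul h1).add (((hlinear t).cos.const_mul k⁻¹).smul h2)
    refine h3.congr_deriv ?_
    have : k⁻¹ * (-Real.sin (k * (t - a)) * k) = -Real.sin (k * (t - a)) := by field_simp
    rw [this]
    have h4 : (k⁻¹ * Real.cos (k * (t - a))) • -k ^ 2 • f t =
        (-Real.cos (k * (t - a)) * k) • f t := by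
      rw [smul_smul]; congr 1; field_simp
    rw [h4]; module
  have hconst : ∀ {G : ℝ → E3}, (∀ t ∈ Ioo a b, HasDerivAt G 0 t) → ∀ x ∈ Ioo a b,
      ∀ y ∈ Ioo a b, G x = G y := fun hG x hx y hy =>
    isOpen_Ioo.is_const_of_deriv_eq_zero isPreconnected_Ioo
      (fun t ht => (hG t ht).differentiableAt.differentiableWithinAt)
      (fun t ht => (hG t ht).deriv) hx hy
  set t₁ := (a + b) / 2 with ht₁
  have hm : t₁ ∈ Ioo a b := ⟨by linarith, by linarith⟩
  obtain ⟨-, -, n1, n2, n3⟩ := hloc t₁ hm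
  have i1 : inner ℝ (f t₁) (f t₁) = (1 : ℝ) := by rw [real_inner_self_eq_norm_sq, n1]; norm_num
  have i2 : inner ℝ (deriv f t₁) (deriv f t₁) = k ^ 2 := by rw [real_inner_self_eq_norm_sq, n2]
  have i3 : inner ℝ (deriv f t₁) (f t₁) = (0 : ℝ) := by rw [real_inner_comm]; exact n3
  have hsc := Real.sin_sq_add_cos_sq (k * (t₁ - a))
  have hnorm : ∀ x : E3, inner ℝ x x = (1 : ℝ) → ‖x‖ = 1 := fun x hx => by
    rw [real_inner_self_eq_norm_sq] at hx
    exact (pow_eq_one_iff_of_nonneg (norm_nonneg _) two_ne_zero).1 hx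
  have hclosed : IsClosed {t | f t = Real.cos (k * (t - a)) • P t₁ +
      Real.sin (k * (t - a)) • Q t₁} := isClosed_eq hf (by fun_prop)
  refine ⟨P t₁, Q t₁, hnorm _ ?_, hnorm _ ?_, ?_, fun t ht => ?_⟩
  · simp only [hP, inner_sub_left, inner_sub_right, inner_smul_left, inner_smul_right, i1, i2, i3,
      n3, RCLike.conj_to_real]
    field_simp
    linear_combination k * hsc
  · simp only [hQ, inner_add_left, inner_add_right, inner_smul_left, inner_smul_right, i1, i2, i3,
      n3, RCLike.conj_to_real]
    field_simp
    linear_combination k * hsc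
  · simp only [hP, hQ, inner_sub_left, inner_add_right, inner_smul_left, inner_smul_right, i1, i2,
      i3, n3, RCLike.conj_to_real]
    field_simp
    ring
  · have hsub : Ioo a b ⊆ {t | f t = Real.cos (k * (t - a)) • P t₁ +
        Real.sin (k * (t - a)) • Q t₁} := by
      intro x hx
      have e1 := hconst hPd t₁ hm x hx
      have e2 := hconst hQd t₁ hm x hx
      have hx2 := Real.sin_sq_add_cos_sq (k * (x - a))
      change f x = _
      rw [e1, e2]
      simp only [hP, hQ]
      have : f x = (Real.sin (k * (x - a)) ^ 2 + Real.cos (k * (x - a)) ^ 2) • f x := by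
        rw [hx2, one_smul]
      conv_lhs => rw [this]
      module
    have := closure_minimal hsub hclosed
    rw [closure_Ioo hab.ne] at this
    exact this ht

/-- Every two vectors of `ℝ³` are orthogonal to a common non-zero vector. -/
lemma exists_ne_zero_orthogonal (x y : E3) :
    ∃ n : E3, n ≠ 0 ∧ inner ℝ n x = (0 : ℝ) ∧ inner ℝ n y = (0 : ℝ) := by
  classical
  set W : Submodule ℝ E3 := Submodule.span ℝ (({x, y} : Finset E3) : Set E3) with hW
  have hx : x ∈ W := Submodule.subset_span (by simp)
  have hy : y ∈ W := Submodule.subset_span (by simp)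
  have h1 : Module.finrank ℝ W ≤ 2 := (finrank_span_finset_le_card _).trans Finset.card_le_two
  have h2 : Module.finrank ℝ E3 = 3 := by simp
  have h3 := W.finrank_add_finrank_orthogonal
  have h4 : Wᗮ ≠ ⊥ := by
    intro h
    rw [h, finrank_bot] at h3
    omega
  obtain ⟨n, hn, hn0⟩ := Submodule.exists_mem_ne_zero_of_ne_bot h4
  rw [Submodule.mem_orthogonal'] at hn
  exact ⟨n, hn0, hn x hx, hn y hy⟩

namespace IsMinimizingLimit

variable {s : ℕ → ℝ → E3} {c : ℕ → ℝ≥0} {u : ℝ → E3}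

lemma per_limit (h : IsMinimizingLimit T ℛ γ R₀ M s c u) : Function.Periodic u T := fun t =>
  tendsto_nhds_unique (h.tendsto (t + T)) ((h.tendsto t).congr fun n => ((h.mem n).1.1 t).symm)

lemma exists_greatCircle (h : IsMinimizingLimit T ℛ γ R₀ M s c u) (hT : 0 < T) (hM : 0 < M)
    (hR₀ : R₀ ∈ ℛ) (hℛ : IsFiniteRotationGroup ℛ) (hpos : 0 < minSpeed T ℛ γ R₀ M) {a b : ℝ}
    (hab : a < b) (hav : ∀ t ∈ Ioo a b, u t ∉ collisionSet ℛ) :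
    ∃ X Y : E3, ‖X‖ = 1 ∧ ‖Y‖ = 1 ∧ inner ℝ X Y = (0 : ℝ) ∧ ∀ t ∈ Icc a b,
      u t = Real.cos (minSpeed T ℛ γ R₀ M * (t - a)) • X +
        Real.sin (minSpeed T ℛ γ R₀ M * (t - a)) • Y := by
  have hk : (0 : ℝ) < minSpeed T ℛ γ R₀ M := NNReal.coe_pos.2 hpos
  refine exists_greatCircle_of_local h.lip_limit.continuous hk hab fun t₀ ht₀ => ?_
  obtain ⟨δ, hδ, hang⟩ := h.exists_angle_eq hT hM hR₀ hℛ (hav t₀ ht₀)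
  refine exists_greatCircle_of_inner_eq hk hδ fun x y hx hy => ?_
  rw [abs_lt] at hx hy
  have hin : ∀ a b, InnerProductGeometry.angle (u a) (u b) = minSpeed T ℛ γ R₀ M * (b - a) →
      inner ℝ (u a) (u b) = Real.cos (minSpeed T ℛ γ R₀ M * (b - a)) := by
    intro a b hab
    rw [← hab, InnerProductGeometry.cos_angle, h.norm_limit, h.norm_limit]; simp
  rcases le_total x y with hxy | hyx
  · exact hin x y (hang x y (by linarith) hxy (by linarith))
  · rw [real_inner_comm, hin y x (hang y x (by linarith) hyx (by linarith)), ← Real.cos_neg]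
    congr 1; ring

/-- The limit is in the cone if it avoids the collisions. -/
lemma mem_cone_of_avoid (h : IsMinimizingLimit T ℛ γ R₀ M s c u) (hT : 0 < T) (hM : 0 < M)
    (hR₀ : R₀ ∈ ℛ) (hℛ : IsFiniteRotationGroup ℛ) (hav : ∀ t, u t ∉ collisionSet ℛ) :
    u ∈ cone T ℛ γ R₀ M := by
  have hΓ := isClosed_collisionSet hℛ
  have hne : (collisionSet ℛ).Nonempty := ⟨0, zero_mem_collisionSet hℛ⟩
  have hcont : Continuous fun t => Metric.infDist (u t) (collisionSet ℛ) :=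
    (Metric.continuous_infDist_pt _).comp h.lip_limit.continuous
  obtain ⟨t₀, -, hmin⟩ := (isCompact_Icc (a := (0 : ℝ)) (b := T / M)).exists_isMinOn
    (nonempty_Icc.2 (by positivity)) hcont.continuousOn
  have hε : 0 < Metric.infDist (u t₀) (collisionSet ℛ) :=
    (hΓ.notMem_iff_infDist_pos hne).1 (hav t₀)
  obtain ⟨n, hn⟩ := (h.tendstoUniformlyOn_Icc 0 (T / M) hε).exists
  refine IsConeLoop.mem_cone ?_ (isH1Loop_of_lipschitz hT h.per_limit h.lip_limit)
  refine (isConeLoop_of_mem_cone hT (h.mem n)).of_segment hT hM hR₀ h.lip_limit.continuous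
    h.equiv_limit 0 fun t ht σ hσ hmem => ?_
  rw [zero_add] at ht
  have ht' : t ∈ Icc 0 (T / M) := ⟨ht.1, ht.2.le⟩
  have h1 := Metric.infDist_le_dist_of_mem (x := u t) hmem
  have h2 := hmin ht'
  have h3 : dist (u t) ((1 - σ) • s n t + σ • u t) ≤ ‖s n t - u t‖ := by
    have : u t - ((1 - σ) • s n t + σ • u t) = (1 - σ) • (u t - s n t) := by module
    rw [dist_eq_norm, this, norm_smul, Real.norm_of_nonneg (by linarith [hσ.2]),
      norm_sub_rev (u t)]
    exact mul_le_of_le_one_left (norm_nonneg _) (by linarith [hσ.1])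
  have h4 := hn t ht'
  change Metric.infDist (u t₀) _ ≤ Metric.infDist (u t) _ at h2
  linarith

/-- If the cone is not central, then the limit has collisions: otherwise it would be a great circle
or a point that belongs to the cone. -/
lemma exists_collision (h : IsMinimizingLimit T ℛ γ R₀ M s c u) (hT : 0 < T) (hM : 0 < M)
    (hR₀ : R₀ ∈ ℛ) (hℛ : IsFiniteRotationGroup ℛ) (hc : ¬ IsCentral (cone T ℛ γ R₀ M)) :
    ∃ t, u t ∈ collisionSet ℛ := by
  by_contra! hav
  have hu := h.mem_cone_of_avoid hT hM hR₀ hℛ hav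
  rcases eq_or_lt_of_le (zero_le (a := minSpeed T ℛ γ R₀ M)) with h0 | hpos
  · obtain ⟨n, hn0, hn, -⟩ := exists_ne_zero_orthogonal (u 0) (u 0)
    refine hc ⟨u, hu, n, hn0, fun t => ?_⟩
    have hL := h.lip_limit.dist_le_mul t 0
    rw [← h0, NNReal.coe_zero, zero_mul] at hL
    rw [dist_le_zero.1 hL, hn]
  · obtain ⟨X, Y, -, -, -, hXY⟩ := h.exists_greatCircle hT hM hR₀ hℛ hpos hT fun t _ => hav t
    obtain ⟨n, hn0, hnX, hnY⟩ := exists_ne_zero_orthogonal X Y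
    refine hc ⟨u, hu, n, hn0, fun t => ?_⟩
    obtain ⟨x, hx, hxt⟩ := h.per_limit.exists_mem_Ico₀ hT t
    rw [hxt, hXY x ⟨hx.1, hx.2.le⟩, inner_add_right, inner_smul_right, inner_smul_right, hnX, hnY]
    ring

/-- The minimal speed is positive: otherwise the limit is constant, at a point of a rotation axis,
and the class is represented in a small ball around that point. -/
lemma minSpeed_pos (h : IsMinimizingLimit T ℛ γ R₀ M s c u) (hT : 0 < T) (hM : 0 < M)
    (hR₀ : R₀ ∈ ℛ) (hℛ : IsFiniteRotationGroup ℛ) (hc : ¬ IsCentral (cone T ℛ γ R₀ M))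
    (hγ : ¬ WindsAroundAtMostOneAxis T ℛ γ) : 0 < minSpeed T ℛ γ R₀ M := by
  rcases eq_or_lt_of_le (zero_le (a := minSpeed T ℛ γ R₀ M)) with h0 | hpos
  swap
  · exact hpos
  exfalso
  obtain ⟨t₀, ht₀⟩ := h.exists_collision hT hM hR₀ hℛ hc
  have hp0 : u t₀ ≠ 0 := norm_ne_zero_iff.1 (by rw [h.norm_limit]; exact one_ne_zero)
  obtain ⟨d, hd, R, hR, hR1, hball, -⟩ := exists_ball_inter_subset_axis hℛ ht₀ hp0
  obtain ⟨n, hn⟩ := (h.tendstoUniformlyOn_Icc 0 T hd).exists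
  refine hγ ⟨s n, (h.mem n).2.2.1, u t₀, d, fun t => ?_, R, hR, hR1, hball⟩
  obtain ⟨x, hx, hxt⟩ := (h.mem n).1.1.exists_mem_Ico₀ hT t
  have hL := h.lip_limit.dist_le_mul x t₀
  rw [← h0, NNReal.coe_zero, zero_mul] at hL
  have := hn x ⟨hx.1, hx.2.le⟩
  rw [dist_le_zero.1 hL] at this
  rw [hxt, Metric.mem_ball, dist_eq_norm]
  exact this

/-- The limit is composed of finitely many great-circle arcs that start on rotation axes. -/
lemma isCircularArcLoop (h : IsMinimizingLimit T ℛ γ R₀ M s c u) (hT : 0 < T) (hM : 0 < M)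
    (hR₀ : R₀ ∈ ℛ) (hℛ : IsFiniteRotationGroup ℛ) (hc : ¬ IsCentral (cone T ℛ γ R₀ M))
    (hpos : 0 < minSpeed T ℛ γ R₀ M) {ρ : ℝ} (hρ : 0 < ρ) :
    IsCircularArcLoop T ℛ (fun t => ρ • u t) := by
  obtain ⟨t₀, ht₀⟩ := h.exists_collision hT hM hR₀ hℛ hc
  set C : Set ℝ := {t | u t ∈ collisionSet ℛ} ∩ Icc t₀ (t₀ + T) with hC
  have hclosed : IsClosed {t | u t ∈ collisionSet ℛ} :=
    (isClosed_collisionSet hℛ).preimage h.lip_limit.continuous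
  have hfin : C.Finite := by
    by_contra hinf
    obtain ⟨x, -, hx⟩ := Set.Infinite.exists_accPt_of_subset_isCompact hinf isCompact_Icc
      inter_subset_right
    have hxC : u x ∈ collisionSet ℛ :=
      hclosed.closure_subset_iff.2 (inter_subset_left (t := Icc t₀ (t₀ + T)))
        (mem_closure_iff_clusterPt.2 hx.clusterPt)
    obtain ⟨δ, hδ, hiso⟩ := h.isolated_collision hT hM hR₀ hℛ hpos hxC
    rw [accPt_iff_nhds] at hx
    obtain ⟨y, ⟨hy1, hy2⟩, hyx⟩ := hx _ (Metric.ball_mem_nhds x hδ)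
    exact hiso y (by rwa [Metric.mem_ball, Real.dist_eq] at hy1) hyx hy2.1
  have ht₀C : t₀ ∈ hfin.toFinset := hfin.mem_toFinset.2 ⟨ht₀, le_rfl, by linarith⟩
  have ht₁C : t₀ + T ∈ hfin.toFinset := hfin.mem_toFinset.2
    ⟨by change u (t₀ + T) ∈ collisionSet ℛ; rwa [h.per_limit t₀], by linarith, le_rfl⟩
  obtain ⟨m, hm⟩ : ∃ m, hfin.toFinset.card = m + 1 :=
    ⟨_, (Nat.succ_pred_eq_of_pos (Finset.card_pos.2 ⟨_, ht₀C⟩)).symm⟩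
  set τ := hfin.toFinset.orderEmbOfFin hm with hτ
  have hτmem : ∀ i, τ i ∈ C := fun i =>
    hfin.mem_toFinset.1 (Finset.orderEmbOfFin_mem _ hm i)
  have hτsurj : ∀ x ∈ C, ∃ i, τ i = x := fun x hx => by
    have : x ∈ Set.range τ := by
      rw [hτ, Finset.range_orderEmbOfFin]; exact_mod_cast hfin.mem_toFinset.2 hx
    exact this
  have hτ0 : τ 0 = t₀ := by
    obtain ⟨i, hi⟩ := hτsurj t₀ (hfin.mem_toFinset.1 ht₀C)
    refine le_antisymm ?_ (hτmem 0).2.1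
    rw [← hi]
    exact τ.monotone (Fin.zero_le i)
  have hτl : τ (Fin.last m) = t₀ + T := by
    obtain ⟨i, hi⟩ := hτsurj (t₀ + T) (hfin.mem_toFinset.1 ht₁C)
    refine le_antisymm (hτmem _).2.2 ?_
    rw [← hi]
    exact τ.monotone (Fin.le_last i)
  have harc : ∀ i : Fin m, ∃ X Y : E3, ‖X‖ = 1 ∧ ‖Y‖ = 1 ∧ inner ℝ X Y = (0 : ℝ) ∧
      ∀ t ∈ Icc (τ i.castSucc) (τ i.succ),
        u t = Real.cos (minSpeed T ℛ γ R₀ M * (t - τ i.castSucc)) • X +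
          Real.sin (minSpeed T ℛ γ R₀ M * (t - τ i.castSucc)) • Y := by
    intro i
    refine h.exists_greatCircle hT hM hR₀ hℛ hpos (τ.strictMono Fin.castSucc_lt_succ) ?_
    intro t ht hmem
    obtain ⟨j, hj⟩ := hτsurj t ⟨hmem, (hτmem _).2.1.trans ht.1.le, ht.2.le.trans (hτmem _).2.2⟩
    rw [← hj] at ht
    have h1 := τ.lt_iff_lt.1 ht.1
    have h2 := τ.lt_iff_lt.1 ht.2
    rw [Fin.lt_def] at h1 h2
    simp at h1 h2
    omega
  choose e f he hf hef hu using harc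
  refine ⟨ρ, minSpeed T ℛ γ R₀ M, m, τ, e, f, hρ, NNReal.coe_pos.2 hpos, τ.strictMono,
    by rw [hτl, hτ0], fun i => ⟨he i, hf i, hef i⟩, fun i => ?_, fun i t ht => ?_⟩
  · have h1 := hu i (τ i.castSucc) ⟨le_rfl, τ.monotone Fin.castSucc_lt_succ.le⟩
    simp only [sub_self, mul_zero, Real.cos_zero, Real.sin_zero, one_smul, zero_smul,
      add_zero] at h1
    rw [← h1]
    exact (hτmem _).1
  · change ρ • u t = _
    rw [hu i t ht]

end IsMinimizingLimit

/-! ### Lower bounds for the one-dimensional Kepler problem -/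

lemma ac_contDiffOn_comp {F g : ℝ → ℝ} {a b c d : ℝ} (hg : AbsolutelyContinuousOnInterval g a b)
    (hF : ContDiffOn ℝ 1 F (Icc c d)) (hm : ∀ t ∈ uIcc a b, g t ∈ Icc c d) :
    AbsolutelyContinuousOnInterval (fun t => F (g t)) a b := by
  obtain ⟨K, hK⟩ := hF.exists_lipschitzOnWith (by norm_num) (convex_Icc c d) isCompact_Icc
  exact ac_of_dist_le K hg fun x hx y hy => hK.dist_le_mul _ (hm x hx) _ (hm y hy)

/-- The solution `-κ tan (κ (x - S / 2))` of the Riccati equation is smooth on `[0, S]` if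
`κ S < π`. -/
lemma exists_riccati {κ S : ℝ} (hκ : 0 < κ) (hS : κ * S < Real.pi) :
    ∃ g : ℝ → ℝ, ContDiffOn ℝ 1 g (Icc 0 S) ∧
      ∀ x ∈ Icc 0 S, HasDerivAt g (-κ ^ 2 - g x ^ 2) x := by
  have hcos : ∀ x ∈ Icc 0 S, Real.cos (κ * (x - S / 2)) ≠ 0 := by
    intro x hx
    refine (Real.cos_pos_of_mem_Ioo ⟨?_, ?_⟩).ne'
    · have := mul_nonneg hκ.le hx.1
      linarith
    · have := mul_le_mul_of_nonneg_left hx.2 hκ.le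
      linarith
  refine ⟨fun x => -κ * Real.tan (κ * (x - S / 2)), fun x hx => ?_, fun x hx => ?_⟩
  · have h1 : ContDiffAt ℝ 1 (fun x : ℝ => κ * (x - S / 2)) x := by fun_prop
    have h2 : ContDiffAt ℝ 1 Real.tan (κ * (x - S / 2)) := Real.contDiffAt_tan.2 (hcos x hx)
    exact (contDiffAt_const.mul (h2.comp x h1)).contDiffWithinAt
  · have h1 : HasDerivAt (fun x : ℝ => κ * (x - S / 2)) κ x := by
      simpa using ((hasDerivAt_id x).sub_const (S / 2)).const_mul κ
    have h2 := ((Real.hasDerivAt_tan (hcos x hx)).comp x h1).const_mul (-κ)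
    refine h2.congr_deriv ?_
    have h3 := Real.sin_sq_add_cos_sq (κ * (x - S / 2))
    have h4 := hcos x hx
    simp only [Real.tan_eq_sin_div_cos]
    generalize κ * (x - S / 2) = y at h3 h4
    field_simp
    linear_combination h3

/-- The kinetic action of a collision arc of the one-dimensional Kepler problem, in terms of the
regularized time `∫ 1 / r`. With `σ` the regularized time and `g` a solution of the Riccati
equation, the function `g(σ) r`, which vanishes at the endpoints, has derivative at most
`r'² / 4 - κ²`. -/
lemma collision_bound {r : ℝ → ℝ} {a b κ : ℝ} (hab : a < b)
    (hr : AbsolutelyContinuousOnInterval r a b) (ha : r a = 0) (hb : r b = 0)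
    (hpos : ∀ᵐ t, t ∈ Ioc a b → 0 < r t) (hnn : ∀ t, 0 ≤ r t)
    (hinv : IntervalIntegrable (fun t => (r t)⁻¹) volume a b)
    (hsq : IntervalIntegrable (fun t => deriv r t ^ 2) volume a b) (hκ : 0 < κ)
    (hκS : κ * (∫ t in a..b, (r t)⁻¹) < Real.pi) :
    2 * κ ^ 2 * (b - a) ≤ ∫ t in a..b, deriv r t ^ 2 / 2 := by
  set S := ∫ t in a..b, (r t)⁻¹ with hS
  set σ : ℝ → ℝ := fun t => ∫ x in a..t, (r x)⁻¹ with hσ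
  obtain ⟨g, hg, hg'⟩ := exists_riccati hκ hκS
  have hσac : AbsolutelyContinuousOnInterval σ a b := ac_integral hinv
  have hσm : ∀ t ∈ uIcc a b, σ t ∈ Icc 0 S := by
    intro t ht
    rw [uIcc_of_le hab.le] at ht
    refine ⟨intervalIntegral.integral_nonneg ht.1 fun x _ => inv_nonneg.2 (hnn x), ?_⟩
    refine intervalIntegral.integral_mono_interval le_rfl ht.1 ht.2 ?_ hinv
    exact Eventually.of_forall fun x => inv_nonneg.2 (hnn x)
  have hgac := ac_contDiffOn_comp hσac hg hσm
  have hΦ : AbsolutelyContinuousOnInterval (fun t => g (σ t) * r t) a b := hgac.fun_mul hr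
  have key := ac_sub_le_integral (h := fun t => deriv r t ^ 2 / 4 - κ ^ 2) hab.le hΦ
    ((hsq.div_const 4).sub intervalIntegrable_const) ?_
  · simp only [ha, hb, mul_zero, sub_self] at key
    rw [intervalIntegral.integral_sub (hsq.div_const 4) intervalIntegrable_const,
      intervalIntegral.integral_const, intervalIntegral.integral_div, smul_eq_mul] at key
    rw [intervalIntegral.integral_div]
    linarith
  · filter_upwards [hpos, hr.ae_differentiableAt, hinv.ae_hasDerivAt_integral] with t h1 h2 h3 ht
    have ht' : t ∈ uIcc a b := by rw [uIcc_of_le hab.le]; exact Ioc_subset_Icc_self ht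
    have hr0 := h1 ht
    have h4 : HasDerivAt σ (r t)⁻¹ t := h3 ht' a left_mem_uIcc
    have h5 := ((hg' (σ t) (hσm t ht')).comp t h4).mul (h2 ht').hasDerivAt
    have h6 : deriv (fun t => g (σ t) * r t) t =
        (-κ ^ 2 - g (σ t) ^ 2) * (r t)⁻¹ * r t + g (σ t) * deriv r t := h5.deriv
    rw [h6, mul_assoc, inv_mul_cancel₀ hr0.ne']
    nlinarith [sq_nonneg (deriv r t / 2 - g (σ t))]

/-- The kinetic action of an arc of the planar Kepler problem that sweeps an angle at least `2 β`,
between two points at the same distance from the centre. In the coordinates of Levi-Civita the arc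
becomes an arc of a harmonic oscillator that sweeps the angle `β < π`. -/
lemma sweep_bound {r f : ℝ → ℝ} {a b β : ℝ} (hab : a < b)
    (hr : AbsolutelyContinuousOnInterval r a b) (hpos : ∀ t ∈ Icc a b, 0 < r t) (hrab : r a = r b)
    (hf : IntervalIntegrable f volume a b) (hβ : 0 < β) (hβπ : β < Real.pi)
    (hfβ : 2 * β ≤ ∫ t in a..b, f t)
    (hsq : IntervalIntegrable (fun t => deriv r t ^ 2 + r t ^ 2 * f t ^ 2) volume a b) :
    2 * (β / ∫ t in a..b, (r t)⁻¹) ^ 2 * (b - a) ≤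
      ∫ t in a..b, (deriv r t ^ 2 + r t ^ 2 * f t ^ 2) / 2 := by
  have hIcc : uIcc a b = Icc a b := uIcc_of_le hab.le
  have hrc : ContinuousOn r (Icc a b) := by rw [← hIcc]; exact hr.continuousOn
  have hinvc : ContinuousOn (fun t => (r t)⁻¹) (uIcc a b) := by
    rw [hIcc]; exact hrc.inv₀ fun t ht => (hpos t ht).ne'
  have hinv : IntervalIntegrable (fun t => (r t)⁻¹) volume a b := hinvc.intervalIntegrable
  set S := ∫ t in a..b, (r t)⁻¹ with hS
  have hS0 : 0 < S := intervalIntegral.intervalIntegral_pos_of_pos_on hinv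
    (fun t ht => inv_pos.2 (hpos t (Ioo_subset_Icc_self ht))) hab
  set κ := β / S with hκ
  have hκ0 : 0 < κ := div_pos hβ hS0
  have hκS : κ * S = β := div_mul_cancel₀ _ hS0.ne'
  set σ : ℝ → ℝ := fun t => ∫ x in a..t, (r x)⁻¹ with hσ
  set L := ∫ t in a..b, f t with hL
  have hL0 : 0 < L := by linarith
  set φ : ℝ → ℝ := fun t => β / L * ∫ x in a..t, f x with hφ
  set q : ℝ → ℝ := fun t => √(r t) with hq
  have hσac : AbsolutelyContinuousOnInterval σ a b := ac_integral hinv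
  have hφac : AbsolutelyContinuousOnInterval φ a b := (ac_integral hf).const_mul _
  have hσm : ∀ t ∈ uIcc a b, σ t ∈ Icc 0 S := by
    intro t ht
    rw [hIcc] at ht
    refine ⟨intervalIntegral.integral_nonneg ht.1 fun x hx =>
      inv_nonneg.2 (hpos x ⟨hx.1, hx.2.trans ht.2⟩).le, ?_⟩
    refine intervalIntegral.integral_mono_interval le_rfl ht.1 ht.2 ?_ hinv
    refine (ae_restrict_iff' measurableSet_Ioc).2 (Eventually.of_forall fun x hx => ?_)
    exact inv_nonneg.2 (hpos x (Ioc_subset_Icc_self hx)).le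
  obtain ⟨g, hg, hg'⟩ := exists_riccati hκ0 (hκS.trans_lt hβπ)
  have hgac := ac_contDiffOn_comp hσac hg hσm
  have hqac : AbsolutelyContinuousOnInterval q a b := by
    obtain ⟨x₀, hx₀, hmin⟩ := isCompact_Icc.exists_isMinOn (nonempty_Icc.2 hab.le) hrc
    obtain ⟨x₁, hx₁, hmax⟩ := isCompact_Icc.exists_isMaxOn (nonempty_Icc.2 hab.le) hrc
    refine ac_contDiffOn_comp (c := r x₀) (d := r x₁) hr (fun x hx => ?_) fun t ht => ?_
    · exact (Real.contDiffAt_sqrt ((hpos x₀ hx₀).trans_le hx.1).ne').contDiffWithinAt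
    · rw [hIcc] at ht; exact ⟨hmin ht, hmax ht⟩
  have hcos : ∀ {h : ℝ → ℝ}, AbsolutelyContinuousOnInterval h a b →
      AbsolutelyContinuousOnInterval (fun t => Real.cos (h t)) a b := fun hh =>
    ac_of_dist_le 1 hh fun x _ y _ => by simpa using Real.lipschitzWith_cos.dist_le_mul _ _
  have hsin : ∀ {h : ℝ → ℝ}, AbsolutelyContinuousOnInterval h a b →
      AbsolutelyContinuousOnInterval (fun t => Real.sin (h t)) a b := fun hh =>
    ac_of_dist_le 1 hh fun x _ y _ => by simpa using Real.lipschitzWith_sin.dist_le_mul _ _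
  -- `(A, B) = z - ζ`, where `z` is the arc in the coordinates of Levi-Civita, with the angle scaled
  -- so that it sweeps exactly `β`, and `ζ` is the uniform circular motion with the same endpoints.
  set A : ℝ → ℝ := fun t => q t * Real.cos (φ t) - q a * Real.cos (κ * σ t) with hA
  set B : ℝ → ℝ := fun t => q t * Real.sin (φ t) - q a * Real.sin (κ * σ t) with hB
  have hAac : AbsolutelyContinuousOnInterval A a b :=
    (hqac.fun_mul (hcos hφac)).fun_sub ((hcos (hσac.const_mul κ)).const_mul _)
  have hBac : AbsolutelyContinuousOnInterval B a b :=
    (hqac.fun_mul (hsin hφac)).fun_sub ((hsin (hσac.const_mul κ)).const_mul _)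
  -- The calibration `2 g |z - ζ|² + 4 ⟨ζ', z - ζ⟩`, with `ζ'` the derivative in the regularized
  -- time. It vanishes at the endpoints; the first term controls the second variation around `ζ`
  -- and the second one accounts for the first variation.
  set Φ : ℝ → ℝ := fun t => 2 * (g (σ t) * (A t * A t + B t * B t)) +
    4 * κ * q a * (B t * Real.cos (κ * σ t) - A t * Real.sin (κ * σ t)) with hΦ
  have hΦac : AbsolutelyContinuousOnInterval Φ a b :=
    ((hgac.fun_mul ((hAac.fun_mul hAac).fun_add (hBac.fun_mul hBac))).const_mul 2).fun_add
      (((hBac.fun_mul (hcos (hσac.const_mul κ))).fun_sub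
        (hAac.fun_mul (hsin (hσac.const_mul κ)))).const_mul _)
  have hAa : A a = 0 := by simp [hA, hφ, hσ]
  have hBa : B a = 0 := by simp [hB, hφ, hσ]
  have hqb : q b = q a := by simp only [hq, hrab]
  have hφb : φ b = κ * σ b := by
    change β / L * L = κ * S
    rw [hκS, div_mul_cancel₀ _ hL0.ne']
  have hAb : A b = 0 := by simp only [hA, hφb, hqb, sub_self]
  have hBb : B b = 0 := by simp only [hB, hφb, hqb, sub_self]
  have key := ac_sub_le_integral
    (h := fun t => (deriv r t ^ 2 + r t ^ 2 * f t ^ 2) / 2 - 2 * κ ^ 2) hab.le hΦac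
    ((hsq.div_const 2).sub intervalIntegrable_const) ?_
  · have h1 : Φ b - Φ a = 0 := by simp only [hΦ, hAa, hBa, hAb, hBb]; ring
    rw [h1, intervalIntegral.integral_sub (hsq.div_const 2) intervalIntegrable_const,
      intervalIntegral.integral_const, smul_eq_mul] at key
    linarith
  · filter_upwards [hr.ae_differentiableAt, hinv.ae_hasDerivAt_integral,
      hf.ae_hasDerivAt_integral] with t h2 h3 h4 ht
    have ht' : t ∈ uIcc a b := by rw [hIcc]; exact Ioc_subset_Icc_self ht
    have hr0 : 0 < r t := hpos t (Ioc_subset_Icc_self ht)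
    have hq0 : 0 < q t := Real.sqrt_pos.2 hr0
    have hqq : q t ^ 2 = r t := Real.sq_sqrt hr0.le
    have dσ : HasDerivAt σ (r t)⁻¹ t := h3 ht' a left_mem_uIcc
    have dφ : HasDerivAt φ (β / L * f t) t := (h4 ht' a left_mem_uIcc).const_mul _
    have dq : HasDerivAt q (deriv r t / (2 * q t)) t := (h2 ht').hasDerivAt.sqrt hr0.ne'
    have dg : HasDerivAt (fun t => g (σ t)) ((-κ ^ 2 - g (σ t) ^ 2) * (r t)⁻¹) t :=
      (hg' (σ t) (hσm t ht')).comp t dσ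
    have dκ := dσ.const_mul κ
    have dA : HasDerivAt A _ t := (dq.mul dφ.cos).sub (dκ.cos.const_mul (q a))
    have dB : HasDerivAt B _ t := (dq.mul dφ.sin).sub (dκ.sin.const_mul (q a))
    have dΦ : HasDerivAt Φ _ t := ((dg.mul ((dA.mul dA).add (dB.mul dB))).const_mul 2).add
      (((dB.mul dκ.cos).sub (dA.mul dκ.sin)).const_mul (4 * κ * q a))
    rw [dΦ.deriv, ← hqq]
    have hhalf : (β / L * f t) ^ 2 ≤ (f t / 2) ^ 2 := by
      have h5 : β / L ≤ 1 / 2 := by rw [div_le_div_iff₀ hL0 two_pos]; linarith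
      have h6 : 0 ≤ β / L := by positivity
      have h7 : (β / L) ^ 2 ≤ 1 / 4 := by nlinarith
      have h8 := mul_le_mul_of_nonneg_right h7 (sq_nonneg (f t))
      rw [mul_pow, div_pow (f t)]
      linarith
    have hcs := Real.sin_sq_add_cos_sq (φ t)
    have hcs' := Real.sin_sq_add_cos_sq (κ * σ t)
    set ψ := β / L * f t with hψ
    set p := deriv r t / (2 * q t) with hp
    have hrp : deriv r t = 2 * q t * p := by rw [hp]; field_simp
    rw [hrp]
    set E := Real.cos (φ t)
    set F := Real.sin (φ t)
    set C := Real.cos (κ * σ t)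
    set D := Real.sin (κ * σ t)
    set G := g (σ t)
    set Q := q t
    set q₀ := q a
    have hAt : A t = Q * E - q₀ * C := rfl
    have hBt : B t = Q * F - q₀ * D := rfl
    have h5 : (Q ^ 2) ^ 2 * ψ ^ 2 * 2 ≤ (Q ^ 2) ^ 2 * f t ^ 2 / 2 := by
      nlinarith [mul_le_mul_of_nonneg_left hhalf (sq_nonneg (Q ^ 2))]
    have h6 : 0 ≤ 2 / Q ^ 2 * ((Q ^ 2 * (p * E - Q * F * ψ) + q₀ * κ * D - G * A t) ^ 2 +
        (Q ^ 2 * (p * F + Q * E * ψ) - q₀ * κ * C - G * B t) ^ 2) := by positivity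
    refine le_trans (le_of_eq (b := 2 * Q ^ 2 * p ^ 2 + (Q ^ 2) ^ 2 * ψ ^ 2 * 2 - 2 * κ ^ 2 -
        2 / Q ^ 2 * ((Q ^ 2 * (p * E - Q * F * ψ) + q₀ * κ * D - G * A t) ^ 2 +
          (Q ^ 2 * (p * F + Q * E * ψ) - q₀ * κ * C - G * B t) ^ 2)) ?_) (by linarith)
    clear_value ψ p κ
    simp only [Pi.mul_apply, Pi.add_apply, hAt, hBt]
    field_simp
    linear_combination (2 * Q ^ 6 * ψ ^ 2 + 2 * Q ^ 4 * p ^ 2 - 2 * κ ^ 2 * Q ^ 2) * hcs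

/-! ### Lower bounds for the action over one period of the symmetry -/

/-- The action of the circular motion around a Newtonian centre that sweeps the angle `θ` in the
time `τ`. -/
noncomputable def keplerBound (τ θ : ℝ) : ℝ := 3 / 2 * (θ ^ 2 * τ) ^ (1 / 3 : ℝ)

/-- Minimization over the length `S` of the regularized time interval: `A + S` is at least
`2 (θ / 2 / S)² τ + S`, whose minimum over `S > 0` is `keplerBound τ θ`. -/
lemma keplerBound_le_of_le {τ θ S A : ℝ} (hτ : 0 < τ) (hS : 0 < S)
    (h : 2 * (θ / 2 / S) ^ 2 * τ ≤ A) : keplerBound τ θ ≤ A + S := by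
  set y := (θ ^ 2 * τ) ^ (1 / 3 : ℝ) with hy
  have hy0 : 0 ≤ y := by positivity
  have hy3 : y ^ 3 = θ ^ 2 * τ := by
    rw [hy, ← Real.rpow_natCast, ← Real.rpow_mul (by positivity)]
    norm_num
  have h1 : 2 * (θ / 2 / S) ^ 2 * τ = y ^ 3 / (2 * S ^ 2) := by rw [hy3]; field_simp
  have h2 : 3 / 2 * y - S ≤ y ^ 3 / (2 * S ^ 2) := by
    rw [le_div_iff₀ (by positivity)]
    nlinarith [mul_nonneg (sq_nonneg (y - S)) (by linarith : 0 ≤ y + 2 * S)]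
  change 3 / 2 * y ≤ A + S
  linarith

/-- It suffices to consider smaller angles, for which the solution of the Riccati equation exists
up to the endpoints. -/
lemma keplerBound_le_of_forall_lt {τ b A : ℝ} (hb : 0 < b)
    (h : ∀ θ, 0 < θ → θ < b → keplerBound τ θ ≤ A) : keplerBound τ b ≤ A := by
  have hc : Continuous fun θ => keplerBound τ θ :=
    continuous_const.mul (Real.continuous_rpow_const (by norm_num) |>.comp (by fun_prop))
  have ht : Tendsto (fun θ => keplerBound τ θ) (𝓝[<] b) (𝓝 (keplerBound τ b)) :=
    hc.continuousAt.tendsto.mono_left nhdsWithin_le_nhds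
  refine le_of_tendsto ht ?_
  filter_upwards [Ioo_mem_nhdsLT hb] with θ hθ using h θ hθ.1 hθ.2

/-- The decomposition of the speed in polar coordinates: radial and tangential parts. -/
lemma norm_deriv_sq_eq {v : ℝ → E3} {t : ℝ} (hv : DifferentiableAt ℝ v t) (h0 : v t ≠ 0) :
    ‖deriv v t‖ ^ 2 = deriv (fun x => ‖v x‖) t ^ 2 +
      ‖v t‖ ^ 2 * ‖deriv (fun x => ‖v x‖⁻¹ • v x) t‖ ^ 2 := by
  have hr : DifferentiableAt ℝ (fun x => ‖v x‖) t := hv.norm ℝ h0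
  have hr0 : ‖v t‖ ≠ 0 := norm_ne_zero_iff.2 h0
  have hs : DifferentiableAt ℝ (fun x => ‖v x‖⁻¹ • v x) t := (hr.inv hr0).smul hv
  set s : ℝ → E3 := fun x => ‖v x‖⁻¹ • v x with hsdef
  have hev : ∀ᶠ x in 𝓝 t, v x ≠ 0 := hv.continuousAt.eventually_ne h0
  have h1 : v =ᶠ[𝓝 t] fun x => ‖v x‖ • s x := by
    filter_upwards [hev] with x hx
    rw [hsdef, smul_inv_smul₀ (norm_ne_zero_iff.2 hx)]
  have hss : inner ℝ (s t) (deriv s t) = (0 : ℝ) := by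
    have h2 : HasDerivAt (fun x => inner ℝ (s x) (s x)) (0 : ℝ) t := by
      refine (hasDerivAt_const t (1 : ℝ)).congr_of_eventuallyEq ?_
      filter_upwards [hev] with x hx
      rw [real_inner_self_eq_norm_sq, norm_normalize_eq_one hx, one_pow]
    have h3 := (hs.hasDerivAt.inner ℝ hs.hasDerivAt).unique h2
    rw [real_inner_comm (s t) (deriv s t)] at h3
    linarith
  have hsn : ‖s t‖ = 1 := norm_normalize_eq_one h0
  have h4 : deriv v t = ‖v t‖ • deriv s t + deriv (fun x => ‖v x‖) t • s t := by
    rw [h1.deriv_eq]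
    exact (hr.hasDerivAt.smul hs.hasDerivAt).deriv
  rw [h4, norm_add_sq_real, norm_smul, norm_smul, hsn, inner_smul_left, inner_smul_right,
    real_inner_comm, hss, Real.norm_eq_abs, Real.norm_eq_abs, mul_one, mul_pow, sq_abs, sq_abs]
  ring

lemma ac_norm {v : ℝ → E3} {a b : ℝ} (hv : AbsolutelyContinuousOnInterval v a b) :
    AbsolutelyContinuousOnInterval (fun t => ‖v t‖) a b :=
  ac_of_dist_le 1 hv fun x _ y _ => by
    rw [one_mul, Real.dist_eq, dist_eq_norm]
    exact abs_norm_sub_norm_le _ _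

/-- The action of an arc without zeros, with endpoints at the same distance from the origin, whose
radial projection has length at least `θ`. -/
lemma keplerBound_le_of_sweep {v : ℝ → E3} {a b θ : ℝ} (hab : a < b)
    (hv : AbsolutelyContinuousOnInterval v a b) (h0 : ∀ t ∈ Icc a b, v t ≠ 0)
    (hvab : ‖v a‖ = ‖v b‖) (hsq : IntervalIntegrable (fun t => ‖deriv v t‖ ^ 2) volume a b)
    (hθ : 0 < θ) (hθπ : θ ≤ 2 * Real.pi)
    (hθs : θ ≤ ∫ t in a..b, ‖deriv (fun x => ‖v x‖⁻¹ • v x) t‖) :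
    keplerBound (b - a) θ ≤ ∫ t in a..b, (‖deriv v t‖ ^ 2 / 2 + ‖v t‖⁻¹) := by
  have hIcc : uIcc a b = Icc a b := uIcc_of_le hab.le
  have hsac := ac_normalize hv (by rwa [hIcc])
  have hinv : IntervalIntegrable (fun t => ‖v t‖⁻¹) volume a b := by
    refine ContinuousOn.intervalIntegrable ?_
    exact hv.continuousOn.norm.inv₀ fun t ht => norm_ne_zero_iff.2 (h0 t (by rwa [hIcc] at ht))
  have hS : 0 < ∫ t in a..b, ‖v t‖⁻¹ := intervalIntegral.intervalIntegral_pos_of_pos_on hinv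
    (fun t ht => inv_pos.2 (norm_pos_iff.2 (h0 t (Ioo_subset_Icc_self ht)))) hab
  have hae : ∀ᵐ t, t ∈ Ioc a b → ‖deriv v t‖ ^ 2 = deriv (fun x => ‖v x‖) t ^ 2 +
      ‖v t‖ ^ 2 * ‖deriv (fun x => ‖v x‖⁻¹ • v x) t‖ ^ 2 := by
    filter_upwards [ac_ae_differentiableAt hv] with t ht hmem
    have := Ioc_subset_Icc_self hmem
    exact norm_deriv_sq_eq (ht (by rwa [hIcc])) (h0 t this)
  rw [intervalIntegral.integral_add (hsq.div_const 2) hinv]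
  refine keplerBound_le_of_forall_lt hθ fun θ' hθ' hlt => ?_
  refine keplerBound_le_of_le (by linarith) hS ?_
  have key := sweep_bound (β := θ' / 2) hab (ac_norm hv) (fun t ht => norm_pos_iff.2 (h0 t ht)) hvab
    (ac_intervalIntegrable_deriv hsac).norm (by linarith) (by linarith) (by linarith) ?_
  · refine key.trans (le_of_eq ?_)
    refine intervalIntegral.integral_congr_ae ?_
    rw [uIoc_of_le hab.le]
    filter_upwards [hae] with t ht hmem
    rw [ht hmem]
  · refine hsq.congr_ae ?_
    rw [uIoc_of_le hab.le]
    exact (ae_restrict_iff' measurableSet_Ioc).2 hae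

/-- The action of an arc between two collisions with the centre, estimated from its radial part. -/
lemma keplerBound_le_of_collision {v : ℝ → E3} {a b : ℝ} (hab : a < b)
    (hv : AbsolutelyContinuousOnInterval v a b) (ha : v a = 0) (hb : v b = 0)
    (h0 : ∀ᵐ t, t ∈ Ioc a b → v t ≠ 0)
    (hsq : IntervalIntegrable (fun t => ‖deriv v t‖ ^ 2) volume a b)
    (hinv : IntervalIntegrable (fun t => ‖v t‖⁻¹) volume a b) :
    keplerBound (b - a) (2 * Real.pi) ≤ ∫ t in a..b, (‖deriv v t‖ ^ 2 / 2 + ‖v t‖⁻¹) := by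
  have hpos : ∀ᵐ t, t ∈ Ioc a b → 0 < ‖v t‖ := by
    filter_upwards [h0] with t ht hmem using norm_pos_iff.2 (ht hmem)
  have hS : 0 < ∫ t in a..b, ‖v t‖⁻¹ := by
    rw [intervalIntegral.integral_pos_iff_support_of_nonneg_ae
      (Eventually.of_forall fun t => by positivity) hinv]
    refine ⟨hab, ?_⟩
    have h1 : (Ioc a b : Set ℝ) ≤ᵐ[volume]
        (Function.support (fun t => ‖v t‖⁻¹) ∩ Ioc a b : Set ℝ) := by
      filter_upwards [hpos] with t ht hmem
      exact ⟨(inv_pos.2 (ht hmem)).ne', hmem⟩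
    have h2 := measure_mono_ae h1
    refine lt_of_lt_of_le ?_ h2
    simpa using hab
  have hle : ∀ᵐ t, t ∈ Ioc a b → deriv (fun x => ‖v x‖) t ^ 2 ≤ ‖deriv v t‖ ^ 2 := by
    filter_upwards [ac_ae_differentiableAt hv, h0] with t ht h0t hmem
    rw [norm_deriv_sq_eq (ht (by rw [uIcc_of_le hab.le]; exact Ioc_subset_Icc_self hmem))
      (h0t hmem)]
    exact le_add_of_nonneg_right (by positivity)
  have hle' : ∀ᵐ t ∂volume.restrict (Ioc a b), deriv (fun x => ‖v x‖) t ^ 2 ≤ ‖deriv v t‖ ^ 2 :=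
    (ae_restrict_iff' measurableSet_Ioc).2 hle
  have hsqr : IntervalIntegrable (fun t => deriv (fun x => ‖v x‖) t ^ 2) volume a b := by
    refine hsq.mono_fun ((measurable_deriv _).pow_const 2).aestronglyMeasurable ?_
    rw [uIoc_of_le hab.le]
    filter_upwards [hle'] with t ht
    rwa [Real.norm_of_nonneg (sq_nonneg _), Real.norm_of_nonneg (sq_nonneg _)]
  rw [intervalIntegral.integral_add (hsq.div_const 2) hinv]
  refine keplerBound_le_of_forall_lt (by positivity) fun θ hθ hlt => ?_
  refine keplerBound_le_of_le (by linarith) hS ?_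
  have key := collision_bound (κ := θ / 2 / ∫ t in a..b, ‖v t‖⁻¹) hab (ac_norm hv) (by simp [ha])
    (by simp [hb]) hpos (fun t => norm_nonneg _) hinv hsqr (by positivity)
    (by rw [div_mul_cancel₀ _ hS.ne']; linarith)
  refine key.trans (intervalIntegral.integral_mono_ae_restrict hab.le (hsqr.div_const 2)
    (hsq.div_const 2) ?_)
  have : ∀ᵐ t ∂volume.restrict (Icc a b), deriv (fun x => ‖v x‖) t ^ 2 ≤ ‖deriv v t‖ ^ 2 := by
    rwa [← restrict_Ioc_eq_restrict_Icc]
  filter_upwards [this] with t ht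
  linarith

/-! ### The Kepler action of the loops in the cone -/

/-- The action of the loop `v` in the Newtonian potential of the centre, with `1 / 0 = ∞`. -/
noncomputable def keplerAction (T : ℝ) (v : ℝ → E3) : ℝ≥0∞ :=
  ∫⁻ t in Ioc 0 T, (‖deriv v t‖ₑ ^ 2 / 2 + ‖v t‖ₑ⁻¹)

lemma keplerAction_le_actionIntegral (T : ℝ) (ℛ : Subgroup (E3 ≃ₗᵢ[ℝ] E3)) (ε : ℝ≥0) (v : ℝ → E3) :
    keplerAction T v ≤ actionIntegral T ℛ 1 ε v := by
  refine lintegral_mono fun t => ?_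
  simp only [ENNReal.rpow_one]
  exact le_self_add

lemma ofReal_lagrangian (x : E3) {y : E3} (hy : y ≠ 0) :
    ENNReal.ofReal (‖x‖ ^ 2 / 2 + ‖y‖⁻¹) = ‖x‖ₑ ^ 2 / 2 + ‖y‖ₑ⁻¹ := by
  rw [ENNReal.ofReal_add (by positivity) (by positivity), ENNReal.ofReal_div_of_pos two_pos,
    ENNReal.ofReal_inv_of_pos (norm_pos_iff.2 hy), ENNReal.ofReal_pow (norm_nonneg _),
    ofReal_norm, ofReal_norm, ENNReal.ofReal_ofNat]

lemma ae_of_periodic {p : ℝ → Prop} (hT : 0 < T) (hp : Function.Periodic p T)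
    (h : ∀ᵐ t ∂volume.restrict (Ioc 0 T), p t) : ∀ᵐ t, p t := by
  rw [ae_restrict_iff' measurableSet_Ioc] at h
  have h1 : ∀ᵐ t : ℝ, ∀ k : ℤ, t - k * T ∈ Ioc 0 T → p (t - k * T) := ae_all_iff.2 fun k =>
    (measurePreserving_sub_right volume ((k : ℝ) * T)).quasiMeasurePreserving.ae h
  filter_upwards [h1] with t ht
  have h2 := toIocMod_add_toIocDiv_zsmul hT 0 t
  have h3 := toIocMod_mem_Ioc hT 0 t
  rw [zsmul_eq_mul] at h2
  have h4 : t - toIocDiv hT 0 t * T = toIocMod hT 0 t := by linarith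
  have h5 := ht (toIocDiv hT 0 t) (by rw [h4]; simpa using h3)
  have h6 := hp.int_mul (toIocDiv hT 0 t) (t - toIocDiv hT 0 t * T)
  rw [sub_add_cancel] at h6
  rwa [h6]

/-- A loop of finite action is at the centre for a null set of times only. -/
lemma ne_zero_of_keplerAction_ne_top (hT : 0 < T) {v : ℝ → E3} (hv : IsH1Loop T v)
    (h : keplerAction T v ≠ ⊤) :
    (∀ᵐ t, v t ≠ 0) ∧ ∀ a b, IntervalIntegrable (fun t => ‖v t‖⁻¹) volume a b := by
  have hm : Measurable v := (hv.continuous hT).measurable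
  have h1 : ∫⁻ t in Ioc 0 T, ‖v t‖ₑ⁻¹ ≠ ⊤ :=
    ne_top_of_le_ne_top h (lintegral_mono fun t => le_add_self)
  have h2 : ∀ᵐ t ∂volume.restrict (Ioc 0 T), v t ≠ 0 := by
    filter_upwards [ae_lt_top hm.enorm.inv h1] with t ht h0
    simp [h0] at ht
  refine ⟨ae_of_periodic hT (fun t => by simp only [hv.1 t]) h2, ?_⟩
  refine Function.Periodic.intervalIntegrable₀ (T := T) (fun t => by simp only [hv.1 t]) hT.ne' ?_
  rw [intervalIntegrable_iff_integrableOn_Ioc_of_le hT.le]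
  refine ⟨hm.norm.inv.aestronglyMeasurable, ?_⟩
  refine lt_of_eq_of_lt (lintegral_congr_ae ?_) (lt_top_iff_ne_top.2 h1)
  filter_upwards [h2] with t ht
  rw [enorm_inv (norm_ne_zero_iff.2 ht), enorm_norm]

lemma keplerAction_eq_ofReal (hT : 0 < T) {v : ℝ → E3} (hv : IsH1Loop T v) (h0 : ∀ᵐ t, v t ≠ 0)
    (hi : IntervalIntegrable (fun t => ‖v t‖⁻¹) volume 0 T) :
    keplerAction T v = ENNReal.ofReal (∫ t in (0 : ℝ)..T, (‖deriv v t‖ ^ 2 / 2 + ‖v t‖⁻¹)) := by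
  have h1 := ((hv.intervalIntegrable_sq hT 0 T).div_const 2).add hi
  rw [intervalIntegrable_iff_integrableOn_Ioc_of_le hT.le] at h1
  rw [intervalIntegral.integral_of_le hT.le, ofReal_integral_eq_lintegral_ofReal h1
    (Eventually.of_forall fun t => by positivity)]
  refine lintegral_congr_ae ?_
  filter_upwards [ae_restrict_of_ae h0] with t ht
  exact (ofReal_lagrangian _ ht).symm

lemma keplerBound_mono {τ θ θ' : ℝ} (hτ : 0 ≤ τ) (hθ : 0 ≤ θ) (h : θ ≤ θ') :
    keplerBound τ θ ≤ keplerBound τ θ' := by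
  unfold keplerBound
  gcongr

/-- An equivariant loop that collides with the centre, or whose radial projection is long, has a
large action. -/
lemma le_keplerAction (hT : 0 < T) (hM : 0 < M) {v : ℝ → E3} (hv : IsH1Loop T v)
    (hve : ∀ t, v (t + T / M) = R₀ (v t)) {θ : ℝ} (hθ : 0 < θ) (hθπ : θ ≤ 2 * Real.pi)
    (h : (∃ t, v t = 0) ∨ (∀ t, v t ≠ 0) ∧
      θ ≤ ∫ t in (0 : ℝ)..T / M, ‖deriv (fun x => ‖v x‖⁻¹ • v x) t‖) :
    ENNReal.ofReal (M * keplerBound (T / M) θ) ≤ keplerAction T v := by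
  have hτ : 0 < T / M := div_pos hT (by exact_mod_cast hM)
  have hM0 : (0 : ℝ) < M := by exact_mod_cast hM
  by_cases htop : keplerAction T v = ⊤
  · rw [htop]; exact le_top
  obtain ⟨h0, hinv⟩ := ne_zero_of_keplerAction_ne_top hT hv htop
  rw [keplerAction_eq_ofReal hT hv h0 (hinv 0 T)]
  refine ENNReal.ofReal_le_ofReal ?_
  have hper : Function.Periodic (fun t => ‖deriv v t‖ ^ 2 / 2 + ‖v t‖⁻¹) (T / M) := fun t => by
    have h1 : ‖deriv v (t + T / M)‖ = ‖deriv v t‖ := norm_deriv_periodic_of_equivariant hve t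
    have h2 : ‖v (t + T / M)‖ = ‖v t‖ := norm_periodic_of_equivariant hve t
    simp only [h1, h2]
  have hsq := hv.intervalIntegrable_sq hT
  have hM' : ∫ t in (0 : ℝ)..T, (‖deriv v t‖ ^ 2 / 2 + ‖v t‖⁻¹) =
      (M : ℝ) * ∫ t in (0 : ℝ)..T / M, (‖deriv v t‖ ^ 2 / 2 + ‖v t‖⁻¹) := by
    have := hper.intervalIntegral_add_zsmul_eq M 0 fun x y => ((hsq x y).div_const 2).add (hinv x y)
    rw [zero_add, zero_add, zsmul_eq_mul, zsmul_eq_mul] at this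
    push_cast at this
    rwa [mul_div_cancel₀ T hM0.ne'] at this
  rw [hM']
  refine mul_le_mul_of_nonneg_left ?_ hM0.le
  rcases h with ⟨t₀, ht₀⟩ | ⟨hne, hθs⟩
  · have h1 := keplerBound_le_of_collision (a := t₀) (b := t₀ + T / M) (by linarith)
      (hv.ac hT _ _) ht₀ (by rw [hve, ht₀, map_zero])
      (by filter_upwards [h0] with t ht _ using ht) (hsq _ _) (hinv _ _)
    rw [hper.intervalIntegral_add_eq t₀ 0, zero_add, add_sub_cancel_left] at h1
    exact (keplerBound_mono hτ.le hθ.le hθπ).trans h1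
  · have h1 := keplerBound_le_of_sweep (a := 0) (b := T / M) hτ (hv.ac hT _ _) (fun t _ => hne t)
      (by have := hve 0; rw [zero_add] at this; rw [this, R₀.norm_map]) (hsq _ _) hθ hθπ hθs
    rwa [sub_zero] at h1

/-- The angle that determines the minimal action: the length of the shortest spherical loops over
one symmetry period, or `2π` if this is smaller. -/
noncomputable def criticalAngle (T : ℝ) (ℛ : Subgroup (E3 ≃ₗᵢ[ℝ] E3)) (γ : ℝ → E3)
    (R₀ : E3 ≃ₗᵢ[ℝ] E3) (M : ℕ) : ℝ := min (minSpeed T ℛ γ R₀ M * (T / M)) (2 * Real.pi)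

lemma criticalAngle_pos (hT : 0 < T) (hM : 0 < M) (hpos : 0 < minSpeed T ℛ γ R₀ M) :
    0 < criticalAngle T ℛ γ R₀ M := by
  have hM0 : (0 : ℝ) < M := by exact_mod_cast hM
  have : (0 : ℝ) < minSpeed T ℛ γ R₀ M := NNReal.coe_pos.2 hpos
  exact lt_min (by positivity) (by positivity)

lemma le_keplerAction_of_mem_cone (hT : 0 < T) (hM : 0 < M) (hR₀ : R₀ ∈ ℛ)
    (hℛ : IsFiniteRotationGroup ℛ) (hpos : 0 < minSpeed T ℛ γ R₀ M) {v : ℝ → E3}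
    (hv : v ∈ cone T ℛ γ R₀ M) :
    ENNReal.ofReal (M * keplerBound (T / M) (criticalAngle T ℛ γ R₀ M)) ≤ keplerAction T v := by
  have hvc := isConeLoop_of_mem_cone hT hv
  refine le_keplerAction hT hM hv.1 hvc.equiv (criticalAngle_pos hT hM hpos) (min_le_right _ _)
    (Or.inr ⟨hvc.ne_zero hℛ, (min_le_left _ _).trans ?_⟩)
  have := (hvc.normalize hT hM hR₀ hℛ).minSpeed_mul_le hT hM
    (fun t => norm_normalize_eq_one (hvc.ne_zero hℛ t))
    (fun a b => ac_normalize (hv.1.ac hT a b) fun t _ => hvc.ne_zero hℛ t) 0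
  rwa [zero_add] at this

/-- The embedding of `H¹` into the continuous functions. -/
lemma exists_uniform_of_h1DistSq_lt (hT : 0 < T) {η : ℝ} (hη : 0 < η) :
    ∃ δ : ℝ≥0∞, 0 < δ ∧ ∀ v w : ℝ → E3, IsH1Loop T v → IsH1Loop T w → h1DistSq T v w < δ →
      ∀ t, ‖v t - w t‖ ≤ η := by
  set e := η / (2 * (1 + T)) with he
  have he0 : 0 < e := by positivity
  set d := e * (η / 2) / (1 / T + 1) with hd
  have hd0 : 0 < d := by positivity
  refine ⟨ENNReal.ofReal d, ENNReal.ofReal_pos.2 hd0, fun v w hv hw hvw => ?_⟩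
  have hc := (hv.continuous hT).sub (hw.continuous hT)
  have hz : IntervalIntegrable (fun t => ‖v t - w t‖ ^ 2) volume 0 T :=
    (hc.norm.pow 2).intervalIntegrable _ _
  have hdd : MemLp (fun t => deriv v t - deriv w t) 2 (volume.restrict (Ioc 0 T)) :=
    hv.2.1.sub hw.2.1
  have hdsq : IntervalIntegrable (fun t => ‖deriv v t - deriv w t‖ ^ 2) volume 0 T := by
    rw [intervalIntegrable_iff_integrableOn_Ioc_of_le hT.le]
    exact hdd.integrable_norm_pow two_ne_zero
  set D₀ := ∫ t in (0 : ℝ)..T, ‖v t - w t‖ ^ 2 with hD₀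
  set D₁ := ∫ t in (0 : ℝ)..T, ‖deriv v t - deriv w t‖ ^ 2 with hD₁
  have hD₀0 : 0 ≤ D₀ := intervalIntegral.integral_nonneg hT.le fun t _ => by positivity
  have hD₁0 : 0 ≤ D₁ := intervalIntegral.integral_nonneg hT.le fun t _ => by positivity
  have hD : D₀ + D₁ < d := by
    rw [hD₀, hD₁, ← intervalIntegral.integral_add hz hdsq]
    have h1 := hz.add hdsq
    rw [intervalIntegrable_iff_integrableOn_Ioc_of_le hT.le] at h1
    rw [← ENNReal.ofReal_lt_ofReal_iff hd0, intervalIntegral.integral_of_le hT.le,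
      ofReal_integral_eq_lintegral_ofReal h1 (Eventually.of_forall fun t => by positivity)]
    refine lt_of_eq_of_lt (lintegral_congr fun t => ?_) hvw
    rw [ENNReal.ofReal_add (by positivity) (by positivity), ENNReal.ofReal_pow (norm_nonneg _),
      ENNReal.ofReal_pow (norm_nonneg _), ofReal_norm, ofReal_norm]
  have hyoung : ∀ x : ℝ, x ≤ e + x ^ 2 / e := fun x => by
    rw [← sub_nonneg]
    have : e + x ^ 2 / e - x = ((x - e / 2) ^ 2 + 3 / 4 * e ^ 2) / e := by field_simp; ring
    rw [this]; positivity
  have hdn : IntervalIntegrable (fun t => ‖deriv v t - deriv w t‖) volume 0 T :=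
    ((hv.intervalIntegrable hT 0 T).sub (hw.intervalIntegrable hT 0 T)).norm
  have hI : ∫ t in (0 : ℝ)..T, ‖deriv v t - deriv w t‖ ≤ e * T + D₁ / e := by
    have h1 := intervalIntegral.integral_mono_on hT.le hdn
      ((intervalIntegrable_const (c := e)).add (hdsq.div_const e)) fun t _ => hyoung _
    rw [intervalIntegral.integral_add intervalIntegrable_const (hdsq.div_const e),
      intervalIntegral.integral_const, intervalIntegral.integral_div, smul_eq_mul, sub_zero] at h1
    linarith
  have hbound : ∀ t ∈ Icc 0 T, ‖v t - w t‖ ≤ η := by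
    intro t ht
    have h1 : ∀ x ∈ Icc 0 T, ‖v t - w t‖ ≤ e + ‖v x - w x‖ ^ 2 / e + (e * T + D₁ / e) := by
      intro x hx
      have h2 : v t - w t = (v x - w x) + ∫ y in x..t, (deriv v y - deriv w y) := by
        rw [intervalIntegral.integral_sub (hv.intervalIntegrable hT x t)
          (hw.intervalIntegrable hT x t), ← hv.sub_eq hT, ← hw.sub_eq hT]
        abel
      have h3 : ‖∫ y in x..t, (deriv v y - deriv w y)‖ ≤
          ∫ y in (0 : ℝ)..T, ‖deriv v y - deriv w y‖ := by
        refine intervalIntegral.norm_integral_le_integral_norm_uIoc.trans ?_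
        rw [intervalIntegral.integral_of_le hT.le]
        refine setIntegral_mono_set ?_ (Eventually.of_forall fun y => norm_nonneg _)
          (Eventually.of_forall ?_)
        · rwa [intervalIntegrable_iff_integrableOn_Ioc_of_le hT.le] at hdn
        · intro y hy
          exact ⟨(le_min hx.1 ht.1).trans_lt hy.1, hy.2.trans (max_le hx.2 ht.2)⟩
      rw [h2]
      exact (norm_add_le _ _).trans (add_le_add (hyoung _) (h3.trans hI))
    have h4 := intervalIntegral.integral_mono_on hT.le intervalIntegrable_const
      (((intervalIntegrable_const (c := e)).add (hz.div_const e)).add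
        (intervalIntegrable_const (c := e * T + D₁ / e))) h1
    rw [intervalIntegral.integral_add
        ((intervalIntegrable_const (c := e)).add (hz.div_const e)) intervalIntegrable_const,
      intervalIntegral.integral_add intervalIntegrable_const (hz.div_const e),
      intervalIntegral.integral_const, intervalIntegral.integral_const,
      intervalIntegral.integral_const, intervalIntegral.integral_div, smul_eq_mul, smul_eq_mul,
      smul_eq_mul, sub_zero] at h4
    have h5 : T * ‖v t - w t‖ ≤ T * (e * (1 + T) + (D₀ * (1 / T) + D₁) / e) := by
      refine h4.trans (le_of_eq ?_)
      rw [← hD₀]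
      field_simp
      ring
    have h6 := le_of_mul_le_mul_left h5 hT
    have h7 : e * (1 + T) = η / 2 := by rw [he]; field_simp
    have h8 : (D₀ * (1 / T) + D₁) / e ≤ η / 2 := by
      rw [div_le_iff₀ he0]
      have hT' : 0 < 1 / T := by positivity
      have h9 : D₀ * (1 / T) + D₁ ≤ (D₀ + D₁) * (1 / T + 1) := by nlinarith
      have h10 : d * (1 / T + 1) = e * (η / 2) := by rw [hd]; field_simp
      have h11 := mul_le_mul_of_nonneg_right hD.le (by positivity : 0 ≤ 1 / T + 1)
      linarith
    linarith
  intro t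
  obtain ⟨x, hx, hxt⟩ := (hv.1.sub hw.1).exists_mem_Ico₀ hT t
  simp only [Pi.sub_apply] at hxt
  rw [hxt]
  exact hbound x ⟨hx.1, hx.2.le⟩

/-- The action is upper semicontinuous in `H¹` at a loop without zeros. -/
lemma keplerAction_le_add {v w : ℝ → E3} {δ : ℝ} (hδ : 0 < δ)
    (hm : Measurable v)
    (h : ∀ t, ‖v t‖ ≤ (1 + δ) * ‖w t‖) (h0 : ∀ t, v t ≠ 0) :
    keplerAction T w ≤ ENNReal.ofReal (1 + δ) * keplerAction T v +
      ENNReal.ofReal (1 + 1 / δ) * h1DistSq T v w := by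
  unfold keplerAction h1DistSq
  rw [← lintegral_const_mul _ (by
      exact (((measurable_deriv v).enorm.pow_const 2).div_const 2).add hm.enorm.inv),
    ← lintegral_const_mul' _ _ ENNReal.ofReal_ne_top, ← lintegral_add_left (by
      exact ((((measurable_deriv v).enorm.pow_const 2).div_const 2).add hm.enorm.inv).const_mul _)]
  refine lintegral_mono fun t => ?_
  have hw0 : w t ≠ 0 := by
    intro hw
    have := h t
    rw [hw, norm_zero, mul_zero] at this
    exact h0 t (norm_le_zero_iff.1 this)
  have hvp := norm_pos_iff.2 (h0 t)
  have hwp := norm_pos_iff.2 hw0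
  have h1 : ‖v t - w t‖ₑ ^ 2 + ‖deriv v t - deriv w t‖ₑ ^ 2 =
      ENNReal.ofReal (‖v t - w t‖ ^ 2 + ‖deriv v t - deriv w t‖ ^ 2) := by
    rw [ENNReal.ofReal_add (by positivity) (by positivity), ENNReal.ofReal_pow (norm_nonneg _),
      ENNReal.ofReal_pow (norm_nonneg _), ofReal_norm, ofReal_norm]
  simp only
  rw [h1, ← ofReal_lagrangian _ hw0, ← ofReal_lagrangian _ (h0 t),
    ← ENNReal.ofReal_mul (by positivity), ← ENNReal.ofReal_mul (by positivity),
    ← ENNReal.ofReal_add (by positivity) (by positivity)]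
  refine ENNReal.ofReal_le_ofReal ?_
  have h2 : ‖w t‖⁻¹ ≤ (1 + δ) * ‖v t‖⁻¹ := by
    rw [← div_eq_mul_inv, le_div_iff₀ hvp, inv_mul_le_iff₀ hwp]
    linarith [h t]
  have h3 : ‖deriv w t‖ ^ 2 ≤ (1 + δ) * ‖deriv v t‖ ^ 2 +
      (1 + 1 / δ) * ‖deriv v t - deriv w t‖ ^ 2 := by
    have h4 : ‖deriv w t‖ ≤ ‖deriv v t‖ + ‖deriv v t - deriv w t‖ := by
      have := norm_sub_norm_le (deriv w t) (deriv v t)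
      rw [norm_sub_rev] at this
      linarith
    generalize ‖deriv v t‖ = x at h4
    generalize ‖deriv v t - deriv w t‖ = y at h4
    have h5 : (1 + δ) * x ^ 2 + (1 + 1 / δ) * y ^ 2 - (x + y) ^ 2 = (δ * x - y) ^ 2 / δ := by
      field_simp; ring
    have h6 : 0 ≤ (δ * x - y) ^ 2 / δ := by positivity
    nlinarith [norm_nonneg (deriv w t)]
  have h7 : 0 ≤ (1 + 1 / δ) * ‖v t - w t‖ ^ 2 := by positivity
  have h8 : 0 ≤ (1 + 1 / δ) * ‖deriv v t - deriv w t‖ ^ 2 := by positivity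
  linarith

/-- The lower bound of the action passes to the closure of the cone in `H¹`. -/
lemma le_keplerAction_of_mem_h1Closure (hT : 0 < T) (hM : 0 < M) (hR₀ : R₀ ∈ ℛ)
    (hℛ : IsFiniteRotationGroup ℛ) (hpos : 0 < minSpeed T ℛ γ R₀ M) {v : ℝ → E3}
    (hv : v ∈ h1Closure T (cone T ℛ γ R₀ M)) :
    ENNReal.ofReal (M * keplerBound (T / M) (criticalAngle T ℛ γ R₀ M)) ≤ keplerAction T v := by
  set B := ENNReal.ofReal (M * keplerBound (T / M) (criticalAngle T ℛ γ R₀ M)) with hB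
  obtain ⟨hv1, hv2⟩ := hv
  have hvc := hv1.continuous hT
  have hve : ∀ t, v (t + T / M) = R₀ (v t) := by
    intro t
    rw [← sub_eq_zero, ← norm_le_zero_iff]
    refine le_of_forall_pos_le_add fun ε hε => ?_
    obtain ⟨δ, hδ, hclose⟩ := exists_uniform_of_h1DistSq_lt hT (half_pos hε)
    obtain ⟨w, hw, hwv⟩ := hv2 δ hδ
    have h1 := hclose v w hv1 hw.1 hwv
    have h2 : v (t + T / M) - R₀ (v t) = (v (t + T / M) - w (t + T / M)) - R₀ (v t - w t) := by
      rw [hw.2.2.2, map_sub]; abel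
    rw [h2]
    refine (norm_sub_le _ _).trans ?_
    rw [R₀.norm_map]
    linarith [h1 t, h1 (t + T / M)]
  by_cases h0 : ∃ t, v t = 0
  · exact le_keplerAction hT hM hv1 hve (criticalAngle_pos hT hM hpos) (min_le_right _ _)
      (Or.inl h0)
  push Not at h0
  by_cases htop : keplerAction T v = ⊤
  · rw [htop]; exact le_top
  obtain ⟨t₀, -, hmin⟩ := (isCompact_Icc (a := (0 : ℝ)) (b := T)).exists_isMinOn
    (nonempty_Icc.2 hT.le) hvc.norm.continuousOn
  have hm0 : 0 < ‖v t₀‖ := norm_pos_iff.2 (h0 t₀)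
  have hmin' : ∀ t, ‖v t₀‖ ≤ ‖v t‖ := fun t => by
    obtain ⟨x, hx, hxt⟩ := hv1.1.exists_mem_Ico₀ hT t
    rw [hxt]
    exact hmin ⟨hx.1, hx.2.le⟩
  have hstep : ∀ δ : ℝ, 0 < δ → B ≤ ENNReal.ofReal (1 + δ) * keplerAction T v := by
    intro δ hδ
    have hη : 0 < δ / (1 + δ) * ‖v t₀‖ := by positivity
    obtain ⟨d, hd, hclose⟩ := exists_uniform_of_h1DistSq_lt hT hη
    refine ENNReal.le_of_forall_pos_le_add fun ε hε _ => ?_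
    obtain ⟨w, hw, hwv⟩ := hv2 (min d (ε / ENNReal.ofReal (1 + 1 / δ)))
      (lt_min hd (ENNReal.div_pos (ENNReal.coe_pos.2 hε).ne' ENNReal.ofReal_ne_top))
    have h1 := hclose v w hv1 hw.1 (hwv.trans_le (min_le_left _ _))
    refine (le_keplerAction_of_mem_cone hT hM hR₀ hℛ hpos hw).trans
      ((keplerAction_le_add hδ hvc.measurable (fun t => ?_) h0).trans ?_)
    · have h2 := norm_sub_norm_le (v t) (w t)
      have h3 : δ / (1 + δ) * ‖v t₀‖ ≤ δ / (1 + δ) * ‖v t‖ :=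
        mul_le_mul_of_nonneg_left (hmin' t) (by positivity)
      have h4 : ‖v t‖ - δ / (1 + δ) * ‖v t‖ ≤ ‖w t‖ := by linarith [h1 t]
      have h5 : ‖v t‖ = (1 + δ) * (‖v t‖ - δ / (1 + δ) * ‖v t‖) := by field_simp; ring
      rw [h5]
      exact mul_le_mul_of_nonneg_left h4 (by positivity)
    · gcongr
      rw [mul_comm]
      exact ENNReal.mul_le_of_le_div (hwv.le.trans (min_le_right _ _))
  have hlim : Tendsto (fun δ : ℝ => ENNReal.ofReal (1 + δ) * keplerAction T v) (𝓝[>] 0)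
      (𝓝 (ENNReal.ofReal (1 + 0) * keplerAction T v)) := by
    refine ENNReal.Tendsto.mul_const ?_ (Or.inr htop)
    refine (ENNReal.tendsto_ofReal ?_)
    exact (continuous_const.add continuous_id).continuousAt.tendsto.mono_left nhdsWithin_le_nhds
  rw [add_zero, ENNReal.ofReal_one, one_mul] at hlim
  refine ge_of_tendsto hlim ?_
  filter_upwards [self_mem_nhdsWithin] with δ hδ using hstep δ hδ

/-! ### Minimizers of the `Γ`-limit -/

/-- The potential of a non-vanishing function is bounded on compact sets. -/
lemma exists_enorm_inv_le {X : Type*} [TopologicalSpace X] {s : Set X} (hs : IsCompact s)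
    {f : X → E3} (hf : ContinuousOn f s) (h0 : ∀ x ∈ s, f x ≠ 0) :
    ∃ C : ℝ≥0, ∀ x ∈ s, (‖f x‖ₑ ^ (1 : ℝ))⁻¹ ≤ C := by
  rcases s.eq_empty_or_nonempty with rfl | hne
  · exact ⟨0, by simp⟩
  obtain ⟨x₀, hx₀, hmin⟩ := hs.exists_isMinOn hne hf.norm
  refine ⟨‖f x₀‖₊⁻¹, fun x hx => ?_⟩
  have h1 : ‖f x₀‖₊ ≤ ‖f x‖₊ := hmin hx
  have h2 : ‖f x₀‖₊ ≠ 0 := nnnorm_ne_zero_iff.2 (h0 x₀ hx₀)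
  rw [ENNReal.rpow_one, ENNReal.coe_inv h2]
  exact ENNReal.inv_le_inv.2 (ENNReal.coe_le_coe.2 h1)

/-- On the loops without collisions, the `Γ`-limit is at most the Kepler action. -/
lemma infAction_le_keplerAction (hT : 0 < T) (hℛ : IsFiniteRotationGroup ℛ) {v : ℝ → E3}
    (hv : v ∈ cone T ℛ γ R₀ M) {u : l2Closure T (cone T ℛ γ R₀ M)} (hu : Represents T v u.1) :
    infAction T ℛ (cone T ℛ γ R₀ M) 1 u ≤ keplerAction T v := by
  set I := {R : E3 ≃ₗᵢ[ℝ] E3 // R ∈ ℛ ∧ R ≠ 1} with hI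
  have hfin : Finite I := by
    exact (hℛ.finite.subset (fun R hR => hR.1 : {R | R ∈ ℛ ∧ R ≠ 1} ⊆ _)).to_subtype
  have : Fintype I := Fintype.ofFinite I
  have hvc := hv.1.continuous hT
  have hC : ∀ R : I, ∃ C : ℝ≥0, ∀ t ∈ Icc 0 T, (‖R.1 (v t) - v t‖ₑ ^ (1 : ℝ))⁻¹ ≤ C := fun R =>
    exists_enorm_inv_le isCompact_Icc ((R.1.continuous.comp hvc).sub hvc).continuousOn
      fun t _ h => hv.2.1 t ⟨R.1, R.2.1, R.2.2, sub_eq_zero.1 h⟩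
  choose C hC using hC
  set K := ∑ R, C R with hK
  have hle : ∀ ε : ℝ≥0, actionIntegral T ℛ 1 ε v ≤
      keplerAction T v + ε * (K * ENNReal.ofReal T) := by
    intro ε
    have h1 : ∀ t ∈ Ioc 0 T, ‖deriv v t‖ₑ ^ 2 / 2 + (‖v t‖ₑ ^ (1 : ℝ))⁻¹ +
        (ε : ℝ≥0∞) / 2 * ∑' R : I, (‖R.1 (v t) - v t‖ₑ ^ (1 : ℝ))⁻¹ ≤
        (‖deriv v t‖ₑ ^ 2 / 2 + ‖v t‖ₑ⁻¹) + ε * K := by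
      intro t ht
      rw [ENNReal.rpow_one, tsum_fintype]
      refine add_le_add le_rfl (mul_le_mul' ENNReal.half_le_self ?_)
      rw [hK, ENNReal.ofNNReal_finsetSum]
      exact Finset.sum_le_sum fun R _ => hC R t (Ioc_subset_Icc_self ht)
    refine (setLIntegral_mono' measurableSet_Ioc h1).trans (le_of_eq ?_)
    rw [lintegral_add_right _ measurable_const, setLIntegral_const, Real.volume_Ioc, sub_zero,
      mul_assoc]
    rfl
  refine ENNReal.le_of_forall_pos_le_add fun ε hε _ => ?_
  set D := (K * ENNReal.ofReal T).toNNReal with hD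
  have hD' : (K : ℝ≥0∞) * ENNReal.ofReal T = D :=
    (ENNReal.coe_toNNReal (ENNReal.mul_ne_top ENNReal.coe_ne_top ENNReal.ofReal_ne_top)).symm
  have hε' : 0 < ε / (D + 1) := by positivity
  refine (iInf₂_le (ε / (D + 1)) hε').trans ?_
  have hmem : v ∈ h1Closure T (cone T ℛ γ R₀ M) :=
    ⟨hv.1, fun δ hδ => ⟨v, hv, by simpa [h1DistSq] using hδ⟩⟩
  refine (iInf₂_le v ⟨hmem, hu⟩).trans ((hle _).trans (add_le_add le_rfl ?_))
  rw [hD', ← ENNReal.coe_mul]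
  refine ENNReal.coe_le_coe.2 ?_
  rw [div_mul_eq_mul_div]
  refine div_le_of_le_mul₀ (by positivity) (by positivity) ?_
  gcongr
  exact le_self_add

/-- The limit of a minimizing sequence of loops without collisions minimizes the `Γ`-limit: the
constant lower bound of the action is a lower semicontinuous minorant. -/
lemma exists_minimizer_of_tendsto (hT : 0 < T) (hℛ : IsFiniteRotationGroup ℛ) {B : ℝ≥0∞}
    (hB : ∀ v ∈ h1Closure T (cone T ℛ γ R₀ M), B ≤ keplerAction T v) {f : ℕ → ℝ → E3}
    (hf : ∀ n, f n ∈ cone T ℛ γ R₀ M)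
    (hfB : Tendsto (fun n => keplerAction T (f n)) atTop (𝓝 B)) {v : ℝ → E3} (hv : IsH1Loop T v)
    (hfv : ∀ t, Tendsto (fun n => f n t) atTop (𝓝 (v t))) {C : ℝ} (hC : ∀ n t, ‖f n t‖ ≤ C) :
    ∃ u : l2Closure T (cone T ℛ γ R₀ M),
      (∀ w, gammaLimit T ℛ (cone T ℛ γ R₀ M) 1 u ≤ gammaLimit T ℛ (cone T ℛ γ R₀ M) 1 w) ∧
      Represents T v u.1 := by
  have hvC : ∀ t, ‖v t‖ ≤ C := fun t => le_of_tendsto' (hfv t).norm fun n => hC n t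
  have hfm : ∀ n, MemLp (f n) 2 (volume.restrict (Ioc 0 T)) := fun n =>
    MemLp.of_bound ((hf n).1.continuous hT).aestronglyMeasurable C
      (Eventually.of_forall (hC n))
  have hvm : MemLp v 2 (volume.restrict (Ioc 0 T)) :=
    MemLp.of_bound (hv.continuous hT).aestronglyMeasurable C (Eventually.of_forall hvC)
  have hlim : Tendsto (fun n => (hfm n).toLp (f n)) atTop (𝓝 (hvm.toLp v)) := by
    rw [tendsto_iff_edist_tendsto_0]
    simp only [Lp.edist_toLp_toLp]
    have h1 : Tendsto (fun n => ∫⁻ t in Ioc 0 T, ‖(f n - v) t‖ₑ ^ (2 : ℝ)) atTop (𝓝 0) := by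
      have h2 : ∫⁻ t in Ioc 0 T, (0 : ℝ≥0∞) = 0 := lintegral_zero
      rw [← h2]
      refine tendsto_lintegral_of_dominated_convergence
        (fun _ => ENNReal.ofReal (2 * C) ^ (2 : ℝ)) (fun n => ?_) (fun n => ?_) ?_ ?_
      · exact (((hf n).1.continuous hT).sub (hv.continuous hT)).measurable.enorm.pow_const _
      · refine Eventually.of_forall fun t => ENNReal.rpow_le_rpow ?_ (by norm_num)
        rw [← ofReal_norm]
        refine ENNReal.ofReal_le_ofReal ((norm_sub_le _ _).trans ?_)
        linarith [hC n t, hvC t]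
      · rw [lintegral_const, Measure.restrict_apply_univ, Real.volume_Ioc]
        exact ENNReal.mul_ne_top (ENNReal.rpow_ne_top_of_nonneg (by norm_num)
          ENNReal.ofReal_ne_top) ENNReal.ofReal_ne_top
      · refine Eventually.of_forall fun t => ?_
        have h3 : Tendsto (fun n => ‖(f n - v) t‖ₑ) atTop (𝓝 0) := by
          have := (((hfv t).sub_const (v t)).enorm)
          rwa [sub_self, enorm_zero] at this
        have h4 := (ENNReal.continuous_rpow_const (y := 2)).continuousAt.tendsto.comp h3
        rwa [ENNReal.zero_rpow_of_pos (by norm_num)] at h4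
    have h5 := (ENNReal.continuous_rpow_const (y := 1 / 2)).continuousAt.tendsto.comp h1
    rw [ENNReal.zero_rpow_of_pos (by norm_num)] at h5
    refine h5.congr fun n => ?_
    rw [eLpNorm_eq_lintegral_rpow_enorm_toReal two_ne_zero ENNReal.ofNat_ne_top]
    rfl
  have hmem : ∀ n, (hfm n).toLp (f n) ∈ l2Closure T (cone T ℛ γ R₀ M) := fun n =>
    subset_closure ⟨f n, hf n, (hfm n).coeFn_toLp⟩
  have hvmem : hvm.toLp v ∈ l2Closure T (cone T ℛ γ R₀ M) :=
    isClosed_closure.mem_of_tendsto hlim (Eventually.of_forall hmem)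
  refine ⟨⟨hvm.toLp v, hvmem⟩, fun w => ?_, hvm.coeFn_toLp⟩
  have hBw : ∀ w, B ≤ infAction T ℛ (cone T ℛ γ R₀ M) 1 w := fun w =>
    le_iInf₂ fun ε _ => le_iInf₂ fun x hx =>
      (hB x hx.1).trans (keplerAction_le_actionIntegral T ℛ ε x)
  refine le_trans ?_ (le_iSup₂_of_le (fun _ => B) ⟨lowerSemicontinuous_const, hBw⟩ le_rfl :
    B ≤ gammaLimit T ℛ (cone T ℛ γ R₀ M) 1 w)
  refine iSup₂_le fun F hF => ?_
  by_contra! hlt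
  obtain ⟨c, hBc, hcF⟩ := exists_between hlt
  have h1 := hF.1 _ c hcF
  have h2 : Tendsto (fun n => (⟨(hfm n).toLp (f n), hmem n⟩ : l2Closure T (cone T ℛ γ R₀ M))) atTop
      (𝓝 ⟨hvm.toLp v, hvmem⟩) := tendsto_subtype_rng.2 hlim
  obtain ⟨n, h3, h4⟩ := ((h2.eventually h1).and (hfB.eventually_lt_const hBc)).exists
  have h5 := (hF.2 ⟨(hfm n).toLp (f n), hmem n⟩).trans
    (infAction_le_keplerAction hT hℛ (hf n) (hfm n).coeFn_toLp)
  exact absurd (h3.trans_le h5) (not_lt.2 h4.le)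

/-! ### Weak limits in `H¹` -/

/-- A pointwise limit of loops with bounded energy is of class `H¹`: the derivatives have a weak
limit in `L²`. -/
lemma isH1Loop_of_tendsto (hT : 0 < T) {f : ℕ → ℝ → E3} (hf : ∀ n, IsH1Loop T (f n)) {C : ℝ}
    (hC : ∀ n, ∫ t in (0 : ℝ)..T, ‖deriv (f n) t‖ ^ 2 ≤ C) {v : ℝ → E3}
    (hfv : ∀ t, Tendsto (fun n => f n t) atTop (𝓝 (v t))) : IsH1Loop T v := by
  set g : ℕ → L2 T := fun n => (hf n).2.1.toLp (deriv (f n)) with hg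
  have hgn : ∀ n, ‖g n‖ ≤ √C := by
    intro n
    refine Real.le_sqrt_of_sq_le ((le_of_eq ?_).trans (hC n))
    rw [← real_inner_self_eq_norm_sq, L2.inner_def, intervalIntegral.integral_of_le hT.le]
    refine integral_congr_ae ?_
    filter_upwards [(hf n).2.1.coeFn_toLp] with t ht
    rw [real_inner_self_eq_norm_sq]
    exact congrArg (fun x => ‖x‖ ^ 2) ht
  obtain ⟨Λ, -, hΛ⟩ :=
    (WeakDual.isCompact_closedBall (0 : StrongDual ℝ (L2 T)) √C).ultrafilter_le_nhds'
    ((hyperfilter ℕ).map fun n =>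
      StrongDual.toWeakDual (InnerProductSpace.toDual ℝ (L2 T) (g n)))
    (by
      rw [Ultrafilter.mem_map]
      refine Filter.univ_mem' fun n => ?_
      change InnerProductSpace.toDual ℝ (L2 T) (g n) ∈ Metric.closedBall _ _
      rw [mem_closedBall_zero_iff, LinearIsometryEquiv.norm_map]
      exact hgn n)
  have heval : ∀ φ : L2 T, Tendsto (fun n => (inner ℝ (g n) φ : ℝ)) (hyperfilter ℕ) (𝓝 (Λ φ)) :=
    fun φ => ((WeakDual.eval_continuous φ).tendsto Λ).comp (show Tendsto (fun n =>
      StrongDual.toWeakDual (InnerProductSpace.toDual ℝ (L2 T) (g n))) (hyperfilter ℕ)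
        (𝓝 Λ) from hΛ)
  set G : L2 T := (InnerProductSpace.toDual ℝ (L2 T)).symm (WeakDual.toStrongDual Λ) with hG
  have hGΛ : ∀ φ : L2 T, inner ℝ G φ = Λ φ := fun φ => by
    rw [hG, InnerProductSpace.toDual_symm_apply]; rfl
  have hper : Function.Periodic v T := fun t =>
    tendsto_nhds_unique (hfv (t + T)) ((hfv t).congr fun n => ((hf n).1 t).symm)
  have hle : ((hyperfilter ℕ : Ultrafilter ℕ) : Filter ℕ) ≤ atTop := by
    rw [← Nat.cofinite_eq_atTop]; exact hyperfilter_le_cofinite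
  refine isH1Loop_of_integral hT hper (g := G) (Lp.memLp G) fun t ht => ?_
  have hset : ∀ h : ℝ → E3, ∫ x in Ioc 0 t, h x ∂(volume.restrict (Ioc 0 T)) =
      ∫ x in (0 : ℝ)..t, h x := fun h => by
    rw [intervalIntegral.integral_of_le ht.1, Measure.restrict_restrict measurableSet_Ioc,
      inter_eq_self_of_subset_left (Ioc_subset_Ioc_right ht.2)]
  have hμ : volume.restrict (Ioc 0 T) (Ioc 0 t) ≠ ∞ := measure_ne_top _ _
  rw [← sub_eq_iff_eq_add']
  refine ext_inner_left ℝ fun y => ?_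
  have h1 : ∀ n, inner ℝ (g n) (indicatorConstLp 2 measurableSet_Ioc hμ y) =
      inner ℝ y (f n t - f n 0) := by
    intro n
    rw [real_inner_comm, L2.inner_indicatorConstLp_eq_inner_setIntegral, hset, (hf n).sub_eq hT]
    congr 1
    refine intervalIntegral.integral_congr_ae_restrict ?_
    rw [uIoc_of_le ht.1]
    exact ae_restrict_of_ae_restrict_of_subset (Ioc_subset_Ioc_right ht.2) (hf n).2.1.coeFn_toLp
  have h2 : Tendsto (fun n => (inner ℝ y (f n t - f n 0) : ℝ)) (hyperfilter ℕ)
      (𝓝 (inner ℝ y (v t - v 0))) :=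
    (tendsto_const_nhds.inner ((hfv t).sub (hfv 0))).mono_left hle
  have h3 := heval (indicatorConstLp 2 measurableSet_Ioc hμ y)
  simp only [h1] at h3
  rw [tendsto_nhds_unique h2 h3, ← hGΛ, real_inner_comm,
    L2.inner_indicatorConstLp_eq_inner_setIntegral, hset]

/-! ### Circular minimizers -/

lemma keplerAction_le_of_le {v : ℝ → E3} {K : ℝ} (h0 : ∀ t, v t ≠ 0)
    (h : ∀ t, ‖deriv v t‖ ^ 2 / 2 + ‖v t‖⁻¹ ≤ K) :
    keplerAction T v ≤ ENNReal.ofReal K * ENNReal.ofReal T := by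
  have h1 : ∫⁻ _ in Ioc 0 T, ENNReal.ofReal K = ENNReal.ofReal K * ENNReal.ofReal T := by
    rw [setLIntegral_const, Real.volume_Ioc, sub_zero]
  rw [← h1]
  refine lintegral_mono fun t => ?_
  rw [← ofReal_lagrangian _ (h0 t)]
  exact ENNReal.ofReal_le_ofReal (h t)

/-- If the shortest spherical loops sweep at most the angle `2π` over one symmetry period, then the
uniform motion on their limit is a minimizer. -/
lemma IsMinimizingLimit.exists_minimizer {s : ℕ → ℝ → E3} {c : ℕ → ℝ≥0} {u : ℝ → E3}
    (h : IsMinimizingLimit T ℛ γ R₀ M s c u) (hT : 0 < T) (hM : 0 < M)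
    (hR₀ : R₀ ∈ ℛ) (hℛ : IsFiniteRotationGroup ℛ) (hpos : 0 < minSpeed T ℛ γ R₀ M)
    (hπ : minSpeed T ℛ γ R₀ M * (T / M) ≤ 2 * Real.pi) :
    ∃ ρ : ℝ, 0 < ρ ∧ IsH1Loop T (fun t => ρ • u t) ∧ ∃ w : l2Closure T (cone T ℛ γ R₀ M),
      (∀ w', gammaLimit T ℛ (cone T ℛ γ R₀ M) 1 w ≤ gammaLimit T ℛ (cone T ℛ γ R₀ M) 1 w') ∧
      Represents T (fun t => ρ • u t) w.1 := by
  have hk0 : (0 : ℝ) < minSpeed T ℛ γ R₀ M := NNReal.coe_pos.2 hpos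
  set k : ℝ := (minSpeed T ℛ γ R₀ M : ℝ) with hk
  have hM0 : (0 : ℝ) < M := by exact_mod_cast hM
  -- The radius of the circular motion of angular speed `k`, by Kepler's third law.
  set y := k ^ (1 / 3 : ℝ) with hy
  have hy0 : 0 < y := by positivity
  have hy3 : y ^ 3 = k := by
    rw [hy, ← Real.rpow_natCast, ← Real.rpow_mul hk0.le]; norm_num
  set ρ := (y ^ 2)⁻¹ with hρ
  have hρ0 : 0 < ρ := by positivity
  have hbound : M * keplerBound (T / M) (criticalAngle T ℛ γ R₀ M) =
      (ρ ^ 2 * k ^ 2 / 2 + ρ⁻¹) * T := by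
    rw [criticalAngle, min_eq_left hπ, keplerBound]
    have h1 : (k * (T / M)) ^ 2 * (T / M) = (y ^ 2 * (T / M)) ^ 3 := by rw [← hy3]; ring
    rw [h1, ← Real.rpow_natCast (y ^ 2 * (T / M)) 3, ← Real.rpow_mul (by positivity), hρ, ← hy3]
    norm_num
    field_simp
    ring
  have hcone : ∀ n, IsConeLoop T ℛ γ R₀ M (fun t => ρ • s n t) := fun n =>
    (isConeLoop_of_mem_cone hT (h.mem n)).smul hT hM hR₀ continuous_const (fun t => rfl)
      fun _ => hρ0
  have hlip : ∀ {c : ℝ≥0} {w : ℝ → E3}, LipschitzWith c w →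
      LipschitzWith (‖ρ‖₊ * c) (fun t => ρ • w t) := fun hw => (lipschitzWith_smul ρ).comp hw
  have hmem : ∀ n, (fun t => ρ • s n t) ∈ cone T ℛ γ R₀ M := fun n =>
    (hcone n).mem_cone (isH1Loop_of_lipschitz hT (hcone n).per (hlip (h.lip n)))
  have hH1 : IsH1Loop T (fun t => ρ • u t) :=
    isH1Loop_of_lipschitz hT (fun t => by simp only [h.per_limit t]) (hlip h.lip_limit)
  refine ⟨ρ, hρ0, hH1, exists_minimizer_of_tendsto hT hℛ
    (fun v hv => le_keplerAction_of_mem_h1Closure hT hM hR₀ hℛ hpos hv) hmem ?_ hH1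
    (fun t => (h.tendsto t).const_smul ρ) (C := ρ) fun n t => ?_⟩
  · refine tendsto_of_tendsto_of_tendsto_of_le_of_le
      (h := fun n => ENNReal.ofReal (ρ ^ 2 * (c n : ℝ) ^ 2 / 2 + ρ⁻¹) * ENNReal.ofReal T)
      tendsto_const_nhds ?_
      (fun n => le_keplerAction_of_mem_cone hT hM hR₀ hℛ hpos (hmem n)) fun n => ?_
    · rw [hbound, ENNReal.ofReal_mul (by positivity)]
      refine ENNReal.Tendsto.mul_const ?_ (Or.inr ENNReal.ofReal_ne_top)
      refine ENNReal.tendsto_ofReal ?_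
      have h1 : Tendsto (fun n => (c n : ℝ)) atTop (𝓝 k) := NNReal.tendsto_coe.2 h.tendsto_speed
      exact (((h1.pow 2).const_mul (ρ ^ 2)).div_const 2).add_const _
    · refine keplerAction_le_of_le (fun t => (hcone n).ne_zero hℛ t) fun t => ?_
      have h1 := norm_deriv_le_of_lipschitzWith (hlip (h.lip n)) t
      rw [NNReal.coe_mul, coe_nnnorm, Real.norm_of_nonneg hρ0.le] at h1
      have h2 : ‖ρ • s n t‖ = ρ := by rw [norm_smul, h.norm, mul_one, Real.norm_of_nonneg hρ0.le]
      have h3 := pow_le_pow_left₀ (norm_nonneg _) h1 2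
      rw [mul_pow] at h3
      rw [h2]
      linarith
  · rw [norm_smul, h.norm, mul_one, Real.norm_of_nonneg hρ0.le]

/-! ### Kepler ellipses of large eccentricity -/

/-- The eccentric anomaly: the inverse of Kepler's equation `n t = E - e sin E`. -/
lemma exists_eccentricAnomaly {e n : ℝ} (he0 : 0 ≤ e) (he1 : e < 1) (hn : 0 < n) :
    ∃ E : ℝ → ℝ, E 0 = 0 ∧ (∀ t, E (t + 2 * Real.pi / n) = E t + 2 * Real.pi) ∧
      ∀ t, HasDerivAt E (n / (1 - e * Real.cos (E t))) t := by
  set K : ℝ → ℝ := fun x => (x - e * Real.sin x) / n with hK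
  have hKd : ∀ x, HasDerivAt K ((1 - e * Real.cos x) / n) x := fun x =>
    ((hasDerivAt_id x).sub ((Real.hasDerivAt_sin x).const_mul e)).div_const n
  have hpos : ∀ x, 0 < 1 - e * Real.cos x := fun x => by nlinarith [Real.cos_le_one x]
  have hKc : Continuous K := by fun_prop
  have hmono : StrictMono K := strictMono_of_deriv_pos fun x => by
    rw [(hKd x).deriv]; exact div_pos (hpos x) hn
  have htop : Tendsto K atTop atTop := by
    refine Tendsto.atTop_div_const hn (tendsto_atTop_mono (f := fun x => x - e) (fun x => ?_)
      (tendsto_atTop_add_const_right _ _ tendsto_id))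
    nlinarith [Real.sin_le_one x]
  have hbot : Tendsto K atBot atBot := by
    refine Tendsto.atBot_div_const hn (tendsto_atBot_mono (fun x => ?_)
      (tendsto_atBot_add_const_right atBot e tendsto_id))
    rw [id]
    nlinarith [Real.neg_one_le_sin x]
  have hsurj : Function.Surjective K := hKc.surjective htop hbot
  set φ := StrictMono.orderIsoOfSurjective K hmono hsurj with hφ
  have hKE : ∀ t, K (φ.symm t) = t := fun t => φ.apply_symm_apply t
  have hEK : ∀ x, φ.symm (K x) = x := fun x => φ.symm_apply_apply x
  refine ⟨φ.symm, ?_, fun t => ?_, fun t => ?_⟩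
  · have : K 0 = 0 := by simp [hK]
    rw [← this, hEK, this]
  · have : K (φ.symm t + 2 * Real.pi) = t + 2 * Real.pi / n := by
      have h1 := hKE t
      simp only [hK, Real.sin_add_two_pi] at h1 ⊢
      rw [add_sub_right_comm, add_div, h1]
    rw [← this, hEK]
  · have h1 := (hKd (φ.symm t)).of_local_left_inverse φ.symm.continuous.continuousAt
      (div_pos (hpos _) hn).ne' (Eventually.of_forall hKE)
    rwa [inv_div] at h1

/-- The angular parameter of the Kepler ellipse: the true anomaly of an ellipse as a function of the
eccentric anomaly, in closed form. -/
lemma hasDerivAt_trueAnomaly {β : ℝ} (h0 : 0 ≤ β) (h1 : β < 1) (x : ℝ) :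
    HasDerivAt (fun x => x + 2 * Real.arctan (β * Real.sin x / (1 - β * Real.cos x)))
      ((1 - β ^ 2) / (1 + β ^ 2) / (1 - 2 * β / (1 + β ^ 2) * Real.cos x)) x := by
  have hden : 0 < 1 - β * Real.cos x := by nlinarith [Real.cos_le_one x]
  have hden2 : 0 < 1 + β ^ 2 - 2 * β * Real.cos x := by nlinarith [Real.cos_le_one x]
  have h2 := (((Real.hasDerivAt_sin x).const_mul β).div
    (((Real.hasDerivAt_cos x).const_mul β).const_sub 1) hden.ne').arctan
  refine ((hasDerivAt_id x).add (h2.const_mul 2)).congr_deriv ?_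
  have hsc := Real.sin_sq_add_cos_sq x
  simp only [Pi.div_apply]
  set S := Real.sin x
  set C := Real.cos x
  have h3 : 1 + (β * S / (1 - β * C)) ^ 2 = (1 + β ^ 2 - 2 * β * C) / (1 - β * C) ^ 2 := by
    field_simp
    linear_combination β ^ 2 * hsc
  have h4 : 1 - 2 * β / (1 + β ^ 2) * C = (1 + β ^ 2 - 2 * β * C) / (1 + β ^ 2) := by
    field_simp
  rw [h3, h4]
  field_simp
  linear_combination -2 * β ^ 2 * hsc

/-- Chain rule for the speed of a Lipschitz curve, which need not be differentiable at `ψ t`. -/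
lemma norm_deriv_comp_le {s : ℝ → E3} {c : ℝ≥0} (hs : LipschitzWith c s) {ψ : ℝ → ℝ} {ψ' t : ℝ}
    (hψ : HasDerivAt ψ ψ' t) : ‖deriv (fun x => s (ψ x)) t‖ ≤ c * |ψ'| := by
  by_cases hd : DifferentiableAt ℝ (fun x => s (ψ x)) t
  · refine le_of_tendsto_of_tendsto (hasDerivAt_iff_tendsto_slope.1 hd.hasDerivAt).norm
      ((hasDerivAt_iff_tendsto_slope.1 hψ).norm.const_mul (c : ℝ)) ?_
    refine Eventually.of_forall fun x => ?_
    simp only [slope_def_module, norm_smul]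
    have := hs.dist_le_mul (ψ x) (ψ t)
    rw [dist_eq_norm, dist_eq_norm] at this
    calc _ ≤ ‖(x - t)⁻¹‖ * (c * ‖ψ x - ψ t‖) := by gcongr
      _ = _ := by ring
  · rw [deriv_zero_of_not_differentiableAt hd, norm_zero]
    positivity

/-- Loops that follow a Kepler ellipse of semi-axis `a` and eccentricity `2 β / (1 + β²)`, with the
angular motion slaved to a given spherical loop. -/
lemma exists_kepler_loop (hT : 0 < T) (hM : 0 < M) (hR₀ : R₀ ∈ ℛ) {s : ℝ → E3} {c : ℝ≥0}
    (hs : s ∈ cone T ℛ γ R₀ M) (hs1 : ∀ t, ‖s t‖ = 1) (hsc : LipschitzWith c s) {a : ℝ} (ha : 0 < a)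
    (ha3 : a ^ 3 * (2 * Real.pi / (T / M)) ^ 2 = 1) {β : ℝ} (hβ0 : 0 ≤ β) (hβ1 : β < 1) :
    ∃ v ∈ cone T ℛ γ R₀ M, (∀ t, ‖v t‖ ≤ 2 * a) ∧ ‖v 0‖ = a * (1 - 2 * β / (1 + β ^ 2)) ∧
      keplerAction T v ≤ ENNReal.ofReal (3 / 2 * T / a +
        a ^ 2 * c ^ 2 * ((1 - β ^ 2) / (1 + β ^ 2)) * T / 2) ∧ (∀ t, v t ≠ 0) ∧
      ∃ D, LipschitzWith D v := by
  have hM0 : (0 : ℝ) < M := by exact_mod_cast hM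
  have hτ : 0 < T / M := div_pos hT hM0
  have hsl := isConeLoop_of_mem_cone hT hs
  set n := 2 * Real.pi / (T / M) with hn
  have hn0 : 0 < n := by positivity
  have hnτ : 2 * Real.pi / n = T / M := by rw [hn]; field_simp
  set e := 2 * β / (1 + β ^ 2) with he
  set q := (1 - β ^ 2) / (1 + β ^ 2) with hq
  have he0 : 0 ≤ e := by positivity
  have he1 : e < 1 := by
    rw [he, div_lt_one (by positivity)]
    nlinarith [mul_pos (sub_pos.2 hβ1) (sub_pos.2 hβ1)]
  have hq0 : 0 < q := div_pos (by nlinarith) (by positivity)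
  obtain ⟨E, hE0, hEτ, hE⟩ := exists_eccentricAnomaly he0 he1 hn0
  rw [hnτ] at hEτ
  set w : ℝ → ℝ := fun t => 1 - e * Real.cos (E t) with hw
  have hw1 : ∀ t, 1 - e ≤ w t := fun t => by
    have := mul_le_mul_of_nonneg_left (Real.cos_le_one (E t)) he0
    simp only [hw]; linarith
  have hw0 : ∀ t, 0 < w t := fun t => by linarith [hw1 t]
  have hw2 : ∀ t, w t ≤ 2 := fun t => by
    have := mul_le_mul_of_nonneg_left (Real.neg_one_le_cos (E t)) he0
    simp only [hw]; linarith
  set ψ : ℝ → ℝ := fun t =>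
    (E t + 2 * Real.arctan (β * Real.sin (E t) / (1 - β * Real.cos (E t)))) / n with hψ
  have hψd : ∀ t, HasDerivAt ψ (q / w t ^ 2) t := by
    intro t
    have h1 := ((hasDerivAt_trueAnomaly hβ0 hβ1 (E t)).comp t (hE t)).div_const n
    refine h1.congr_deriv ?_
    change q / w t * (n / w t) / n = q / w t ^ 2
    field_simp
  have hwd : ∀ t, HasDerivAt w (e * Real.sin (E t) * (n / w t)) t := by
    intro t
    refine (((hE t).cos.const_mul e).const_sub 1).congr_deriv ?_
    change -(e * (-Real.sin (E t) * (n / w t))) = _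
    ring
  have hψτ : ∀ t, ψ (t + T / M) = ψ t + T / M := by
    intro t
    simp only [hψ, hEτ, Real.sin_add_two_pi, Real.cos_add_two_pi]
    rw [add_right_comm, add_div, hnτ]
  have hwτ : Function.Periodic w (T / M) := fun t => by
    simp only [hw, hEτ, Real.cos_add_two_pi]
  have hψc : Continuous ψ := continuous_iff_continuousAt.2 fun t => (hψd t).continuousAt
  have hwc : Continuous w := continuous_iff_continuousAt.2 fun t => (hwd t).continuousAt
  have hEc : Continuous E := continuous_iff_continuousAt.2 fun t => (hE t).continuousAt
  set v : ℝ → E3 := fun t => (a * w t) • s (ψ t) with hv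
  have hrpos : ∀ t, 0 < a * w t := fun t => mul_pos ha (hw0 t)
  have hvn : ∀ t, ‖v t‖ = a * w t := fun t => by
    rw [hv, norm_smul, hs1, mul_one, Real.norm_of_nonneg (hrpos t).le]
  have hv0 : ∀ t, v t ≠ 0 := fun t => norm_ne_zero_iff.1 (by rw [hvn]; exact (hrpos t).ne')
  have hvs : ∀ t, ‖v t‖⁻¹ • v t = s (ψ t) := fun t => by
    rw [hvn, hv, inv_smul_smul₀ (hrpos t).ne']
  have hcone : IsConeLoop T ℛ γ R₀ M v := (hsl.comp hM hψc hψτ).smul hT hM hR₀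
    (continuous_const.mul hwc) (fun t => by simp only [hwτ t]) hrpos
  have hder : ∀ t, ‖deriv v t‖ ^ 2 ≤ (a * (e * Real.sin (E t) * (n / w t))) ^ 2 +
      (a * w t) ^ 2 * (c * (q / w t ^ 2)) ^ 2 := by
    intro t
    by_cases hd : DifferentiableAt ℝ v t
    · have h1 : deriv (fun x => ‖v x‖) t = a * (e * Real.sin (E t) * (n / w t)) := by
        simp only [hvn]
        exact ((hwd t).const_mul a).deriv
      have h2 := norm_deriv_comp_le hsc (hψd t)
      rw [abs_of_nonneg (div_nonneg hq0.le (sq_nonneg _))] at h2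
      rw [norm_deriv_sq_eq hd (hv0 t), h1]
      simp only [hvs]
      rw [hvn]
      gcongr
    · rw [deriv_zero_of_not_differentiableAt hd, norm_zero, zero_pow two_ne_zero]
      positivity
  have ha2 : a ^ 2 * n ^ 2 = 1 / a := by rw [eq_div_iff ha.ne', ← ha3]; ring
  have hpt : ∀ t, ‖deriv v t‖ ^ 2 / 2 + ‖v t‖⁻¹ ≤
      1 / a * (2 * (n / w t) / n - 1 / 2) + a ^ 2 * c ^ 2 * q / 2 * (q / w t ^ 2) := by
    intro t
    have h1 := hder t
    have hs2 := Real.sin_sq_add_cos_sq (E t)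
    have h2 : e ^ 2 * Real.sin (E t) ^ 2 = e ^ 2 - 1 + 2 * w t - w t ^ 2 := by
      simp only [hw]
      linear_combination e ^ 2 * hs2
    have h3 : (a * (e * Real.sin (E t) * (n / w t))) ^ 2 =
        1 / a * ((e ^ 2 - 1 + 2 * w t - w t ^ 2) / w t ^ 2) := by
      have := (hw0 t).ne'
      rw [← h2, ← ha2]
      field_simp
    have h4 : (e ^ 2 - 1 + 2 * w t - w t ^ 2) / w t ^ 2 ≤ 2 * (w t)⁻¹ - 1 := by
      have h5 : (w t)⁻¹ = w t / w t ^ 2 := by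
        have := (hw0 t).ne'
        field_simp
      rw [h5, div_le_iff₀ (by have := hw0 t; positivity), sub_mul, ← mul_div_assoc,
        div_mul_cancel₀ _ (pow_ne_zero 2 (hw0 t).ne')]
      nlinarith
    have h6 : (a * w t) ^ 2 * (c * (q / w t ^ 2)) ^ 2 = a ^ 2 * c ^ 2 * q * (q / w t ^ 2) := by
      have := (hw0 t).ne'
      field_simp
    have h7 : 2 * (n / w t) / n = 2 * (w t)⁻¹ := by
      have := (hw0 t).ne'
      field_simp
    have h8 : (a * w t)⁻¹ = 1 / a * (w t)⁻¹ := by rw [mul_inv, one_div]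
    have h9 := mul_le_mul_of_nonneg_left h4 (by positivity : 0 ≤ 1 / a)
    rw [hvn, h8, h7]
    rw [h3, h6] at h1
    linarith
  have hLip : ∃ D, LipschitzWith D v := by
    have hwL : ∀ x y, |w x - w y| ≤ n / (1 - e) * |x - y| := fun x y => by
      have := Convex.norm_image_sub_le_of_norm_hasDerivWithin_le (f := w) (s := univ)
        (C := n / (1 - e)) (fun t _ => (hwd t).hasDerivWithinAt) (fun t _ => ?_) convex_univ
        (mem_univ y) (mem_univ x)
      · exact this
      · rw [Real.norm_eq_abs, abs_mul, abs_mul, abs_of_nonneg he0,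
          abs_of_pos (div_pos hn0 (hw0 t))]
        have h1 : e * |Real.sin (E t)| ≤ 1 * 1 :=
          mul_le_mul he1.le (Real.abs_sin_le_one _) (abs_nonneg _) zero_le_one
        have h2 : n / w t ≤ n / (1 - e) :=
          div_le_div_of_nonneg_left hn0.le (by linarith) (hw1 t)
        calc _ ≤ 1 * 1 * (n / (1 - e)) := mul_le_mul h1 h2 (div_pos hn0 (hw0 t)).le (by norm_num)
          _ = _ := by ring
    have hψL : ∀ x y, |ψ x - ψ y| ≤ q / (1 - e) ^ 2 * |x - y| := fun x y => by
      have := Convex.norm_image_sub_le_of_norm_hasDerivWithin_le (f := ψ) (s := univ)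
        (C := q / (1 - e) ^ 2) (fun t _ => (hψd t).hasDerivWithinAt) (fun t _ => ?_) convex_univ
        (mem_univ y) (mem_univ x)
      · exact this
      · rw [Real.norm_of_nonneg (div_nonneg hq0.le (sq_nonneg _))]
        exact div_le_div_of_nonneg_left hq0.le (pow_pos (by linarith) 2)
          (pow_le_pow_left₀ (by linarith) (hw1 t) 2)
    refine ⟨_, LipschitzWith.of_dist_le' (K := a * (n / (1 - e)) +
      a * 2 * (c * (q / (1 - e) ^ 2))) fun x y => ?_⟩
    rw [dist_eq_norm, Real.dist_eq]
    have h1 : v x - v y = (a * (w x - w y)) • s (ψ x) + (a * w y) • (s (ψ x) - s (ψ y)) := by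
      simp only [hv]; module
    have h2 := hsc.dist_le_mul (ψ x) (ψ y)
    rw [dist_eq_norm, Real.dist_eq] at h2
    rw [h1, add_mul]
    refine (norm_add_le _ _).trans (add_le_add ?_ ?_)
    · rw [norm_smul, hs1, mul_one, norm_mul, Real.norm_of_nonneg ha.le, Real.norm_eq_abs, mul_assoc]
      exact mul_le_mul_of_nonneg_left (hwL x y) ha.le
    · rw [norm_smul, Real.norm_of_nonneg (hrpos y).le, mul_assoc (a * 2), mul_assoc (c : ℝ)]
      refine mul_le_mul (mul_le_mul_of_nonneg_left (hw2 y) ha.le)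
        (h2.trans (mul_le_mul_of_nonneg_left (hψL x y) c.2)) (norm_nonneg _) (by positivity)
  obtain ⟨D, hD⟩ := hLip
  refine ⟨v, hcone.mem_cone (isH1Loop_of_lipschitz hT hcone.per hD), fun t => ?_, ?_, ?_, hv0,
    D, hD⟩
  · rw [hvn]; nlinarith [hw2 t]
  · rw [hvn]; simp only [hw, hE0, Real.cos_zero, mul_one]
  -- The integrand is estimated by the derivative of `G`, whose increment over `[0, T]` is explicit.
  · set G : ℝ → ℝ := fun t => 1 / a * (2 * E t / n - t / 2) + a ^ 2 * c ^ 2 * q / 2 * ψ t with hG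
    have hGd : ∀ t, HasDerivAt G
        (1 / a * (2 * (n / w t) / n - 1 / 2) + a ^ 2 * c ^ 2 * q / 2 * (q / w t ^ 2)) t := fun t =>
      (((((hE t).const_mul 2).div_const n).sub ((hasDerivAt_id t).div_const 2)).const_mul _).add
        ((hψd t).const_mul _)
    have hcont : Continuous fun t => 1 / a * (2 * (n / w t) / n - 1 / 2) +
        a ^ 2 * c ^ 2 * q / 2 * (q / w t ^ 2) := by
      have h1 : ∀ t, w t ≠ 0 := fun t => (hw0 t).ne'
      have h2 : ∀ t, w t ^ 2 ≠ 0 := fun t => pow_ne_zero 2 (h1 t)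
      fun_prop (disch := assumption)
    have hint := intervalIntegral.integral_eq_sub_of_hasDerivAt (a := 0) (b := T)
      (fun t _ => hGd t) (hcont.intervalIntegrable 0 T)
    have hET : E T = E 0 + M * (2 * Real.pi) := by
      have := translation_period hM hEτ 0; rwa [zero_add] at this
    have hψT : ψ T = ψ 0 + M * (T / M) := by
      have := translation_period hM hψτ 0; rwa [zero_add] at this
    have hGT : G T - G 0 = 3 / 2 * T / a + a ^ 2 * c ^ 2 * q * T / 2 := by
      simp only [hG, hET, hψT, hE0]
      rw [hn]
      field_simp
      ring
    rw [← hGT, ← hint, intervalIntegral.integral_of_le hT.le, ofReal_integral_eq_lintegral_ofReal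
      (hcont.integrableOn_Ioc) (Eventually.of_forall fun t => le_trans (by positivity) (hpt t))]
    refine lintegral_mono fun t => ?_
    rw [← ofReal_lagrangian _ (hv0 t)]
    exact ENNReal.ofReal_le_ofReal (hpt t)

/-! ### Minimizers with total collisions -/

/-- The embedding of `H¹` into the Hölder continuous functions of exponent `1 / 2`. -/
lemma norm_sub_le_sqrt (hT : 0 < T) {v : ℝ → E3} (hv : IsH1Loop T v) {A C : ℝ}
    (hA : ∀ t, ‖v t‖ ≤ A) (hC : ∫ t in (0 : ℝ)..T, ‖deriv v t‖ ^ 2 ≤ C) (x y : ℝ) :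
    ‖v x - v y‖ ≤ ((1 + C) / 2 + 2 * A / √T) * √|x - y| := by
  have hA0 : 0 ≤ A := (norm_nonneg _).trans (hA 0)
  have hC0 : 0 ≤ C :=
    (intervalIntegral.integral_nonneg hT.le fun t _ => by positivity).trans hC
  wlog hxy : x ≤ y generalizing x y
  · rw [norm_sub_rev, abs_sub_comm]
    exact this y x (le_of_not_ge hxy)
  rw [norm_sub_rev, abs_sub_comm, abs_of_nonneg (sub_nonneg.2 hxy)]
  rcases hxy.eq_or_lt with rfl | hlt
  · simp
  have hh : 0 < y - x := sub_pos.2 hlt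
  set k := √(y - x) with hk
  have hk0 : 0 < k := Real.sqrt_pos.2 hh
  have hkk : k ^ 2 = y - x := Real.sq_sqrt hh.le
  rcases le_total (y - x) T with hle | hle
  · have hsq := hv.intervalIntegrable_sq hT
    have h1 : ‖v y - v x‖ ≤ ∫ t in x..y, ‖deriv v t‖ := ac_norm_sub_le hxy (hv.ac hT x y)
    have h2 : ∫ t in x..y, ‖deriv v t‖ ≤ ∫ t in x..y, (k⁻¹ / 2 + ‖deriv v t‖ ^ 2 * (k / 2)) := by
      refine intervalIntegral.integral_mono_on hxy (hv.intervalIntegrable hT x y).norm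
        (intervalIntegrable_const.add ((hsq x y).mul_const _)) fun t _ => ?_
      have : k⁻¹ / 2 + ‖deriv v t‖ ^ 2 * (k / 2) - ‖deriv v t‖ =
          (k * ‖deriv v t‖ - 1) ^ 2 / (2 * k) := by field_simp; ring
      have h3 : 0 ≤ (k * ‖deriv v t‖ - 1) ^ 2 / (2 * k) := by positivity
      linarith
    have h4 : ∫ t in x..y, ‖deriv v t‖ ^ 2 ≤ C := by
      have hper : Function.Periodic (fun t => ‖deriv v t‖ ^ 2) T := fun t => by
        simp only [periodic_deriv hv.1 t]
      refine le_trans ?_ hC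
      have h5 := hper.intervalIntegral_add_eq 0 x
      rw [zero_add] at h5
      rw [h5]
      exact intervalIntegral.integral_mono_interval le_rfl hxy (by linarith)
        (Eventually.of_forall fun t => by positivity) (hsq _ _)
    rw [intervalIntegral.integral_add intervalIntegrable_const ((hsq x y).mul_const _),
      intervalIntegral.integral_const, intervalIntegral.integral_mul_const, smul_eq_mul,
      ← hkk] at h2
    have h6 : k ^ 2 * (k⁻¹ / 2) = k / 2 := by field_simp
    rw [h6] at h2
    have h7 := mul_le_mul_of_nonneg_right h4 (by positivity : 0 ≤ k / 2)
    have h8 : 0 ≤ 2 * A / √T * k := by positivity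
    linarith
  · have h1 : √T ≤ k := Real.sqrt_le_sqrt hle
    have hT0 : 0 < √T := Real.sqrt_pos.2 hT
    have h2 : 2 * A ≤ 2 * A / √T * k := by
      rw [div_mul_eq_mul_div, le_div_iff₀ hT0]
      exact mul_le_mul_of_nonneg_left h1 (by positivity)
    have h3 : 0 ≤ (1 + C) / 2 * k := by positivity
    have h4 := norm_sub_le (v y) (v x)
    linarith [hA x, hA y]

/-- If the spherical loops sweep at least the angle `2π` over one symmetry period, then the Kepler
ellipses degenerate to a minimizer that collides with the centre. -/
lemma exists_minimizer_collision (hT : 0 < T) (hM : 0 < M) (hR₀ : R₀ ∈ ℛ)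
    (hℛ : IsFiniteRotationGroup ℛ) (hne : (cone T ℛ γ R₀ M).Nonempty)
    (hpos : 0 < minSpeed T ℛ γ R₀ M) (hπ : 2 * Real.pi ≤ minSpeed T ℛ γ R₀ M * (T / M)) :
    ∃ v, IsH1Loop T v ∧ v 0 = 0 ∧ ∃ w : l2Closure T (cone T ℛ γ R₀ M),
      (∀ w', gammaLimit T ℛ (cone T ℛ γ R₀ M) 1 w ≤ gammaLimit T ℛ (cone T ℛ γ R₀ M) 1 w') ∧
      Represents T v w.1 := by
  have hM0 : (0 : ℝ) < M := by exact_mod_cast hM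
  have hτ : 0 < T / M := div_pos hT hM0
  obtain ⟨c, s, hs, hs1, hsc⟩ := exists_lipschitz_mem_cone hT hM hR₀ hℛ hne
  set n := 2 * Real.pi / (T / M) with hn
  have hn0 : 0 < n := by positivity
  set y := (n ^ 2) ^ (1 / 3 : ℝ) with hy
  have hy0 : 0 < y := by positivity
  have hy3 : y ^ 3 = n ^ 2 := by
    rw [hy, ← Real.rpow_natCast, ← Real.rpow_mul (by positivity)]; norm_num
  -- The semi-axis, by Kepler's third law for the period `T / M`.
  set a := y⁻¹ with ha
  have ha0 : 0 < a := by positivity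
  have ha3 : a ^ 3 * n ^ 2 = 1 := by rw [ha, ← hy3]; field_simp
  have hbound : M * keplerBound (T / M) (criticalAngle T ℛ γ R₀ M) = 3 / 2 * T / a := by
    rw [criticalAngle, min_eq_right hπ, keplerBound]
    have h1 : (2 * Real.pi) ^ 2 * (T / M) = (y * (T / M)) ^ 3 := by
      rw [mul_pow y, hy3, hn]; field_simp
    rw [h1, ← Real.rpow_natCast (y * (T / M)) 3, ← Real.rpow_mul (by positivity), ha]
    norm_num
    field_simp
  -- The eccentricity `2 β / (1 + β²)` tends to `1` as `β` does.
  set β : ℕ → ℝ := fun k => 1 - 1 / ((k : ℝ) + 1) with hβ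
  have hβ0 : ∀ k, 0 ≤ β k := fun k => by
    have : 1 / ((k : ℝ) + 1) ≤ 1 := by
      rw [div_le_one (by positivity)]; linarith [(Nat.cast_nonneg k : (0 : ℝ) ≤ k)]
    simp only [hβ]; linarith
  have hβ1 : ∀ k, β k < 1 := fun k => by
    have : 0 < 1 / ((k : ℝ) + 1) := by positivity
    simp only [hβ]; linarith
  have hβt : Tendsto β atTop (𝓝 1) := by
    have := (tendsto_one_div_add_atTop_nhds_zero_nat (𝕜 := ℝ)).const_sub 1
    rwa [sub_zero] at this
  choose f hf hfa hf0 hfk hfne D hD using fun k =>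
    exists_kepler_loop hT hM hR₀ hs hs1 hsc ha0 ha3 (hβ0 k) (hβ1 k)
  have hq : Tendsto (fun k => (1 - β k ^ 2) / (1 + β k ^ 2)) atTop (𝓝 0) := by
    have := (hβt.pow 2).const_sub 1 |>.div ((hβt.pow 2).const_add 1) (by norm_num)
    rw [one_pow, sub_self, zero_div] at this
    exact this
  have hfB : Tendsto (fun k => keplerAction T (f k)) atTop
      (𝓝 (ENNReal.ofReal (M * keplerBound (T / M) (criticalAngle T ℛ γ R₀ M)))) := by
    refine tendsto_of_tendsto_of_tendsto_of_le_of_le tendsto_const_nhds ?_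
      (fun k => le_keplerAction_of_mem_cone hT hM hR₀ hℛ hpos (hf k)) hfk
    rw [hbound]
    refine ENNReal.tendsto_ofReal ?_
    have := (((hq.const_mul (a ^ 2 * (c : ℝ) ^ 2)).mul_const T).div_const 2).const_add
      (3 / 2 * T / a)
    simpa using this
  have henergy : ∀ k, ∫ t in (0 : ℝ)..T, ‖deriv (f k) t‖ ^ 2 ≤
      2 * (3 / 2 * T / a + a ^ 2 * c ^ 2 * T / 2) := by
    intro k
    have hc := (hf k).1.continuous hT
    have hi : IntervalIntegrable (fun t => ‖f k t‖⁻¹) volume 0 T :=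
      (hc.norm.inv₀ fun t => norm_ne_zero_iff.2 (hfne k t)).intervalIntegrable _ _
    have h1 := hfk k
    rw [keplerAction_eq_ofReal hT (hf k).1 (Eventually.of_forall (hfne k)) hi] at h1
    have hq0 : 0 ≤ (1 - β k ^ 2) / (1 + β k ^ 2) :=
      div_nonneg (by nlinarith [hβ0 k, hβ1 k]) (by positivity)
    have hq1 : (1 - β k ^ 2) / (1 + β k ^ 2) ≤ 1 := by
      rw [div_le_one (by positivity)]; nlinarith [sq_nonneg (β k)]
    rw [ENNReal.ofReal_le_ofReal_iff (by positivity), intervalIntegral.integral_add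
      (((hf k).1.intervalIntegrable_sq hT 0 T).div_const 2) hi,
      intervalIntegral.integral_div] at h1
    have h2 : 0 ≤ ∫ t in (0 : ℝ)..T, ‖f k t‖⁻¹ :=
      intervalIntegral.integral_nonneg hT.le fun t _ => by positivity
    have h3 : a ^ 2 * (c : ℝ) ^ 2 * ((1 - β k ^ 2) / (1 + β k ^ 2)) * T / 2 ≤
        a ^ 2 * (c : ℝ) ^ 2 * 1 * T / 2 := by gcongr
    linarith
  have hω : Tendsto (fun h : ℝ => ((1 + 2 * (3 / 2 * T / a + a ^ 2 * c ^ 2 * T / 2)) / 2 +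
      2 * (2 * a) / √T) * √|h|) (𝓝 0) (𝓝 0) := by
    have : Continuous fun h : ℝ => ((1 + 2 * (3 / 2 * T / a + a ^ 2 * c ^ 2 * T / 2)) / 2 +
      2 * (2 * a) / √T) * √|h| := by fun_prop
    simpa using this.tendsto 0
  obtain ⟨φ, v, hφ, hv⟩ := exists_subseq_tendsto hfa hω fun k x y =>
    norm_sub_le_sqrt hT (hf k).1 (hfa k) (henergy k) x y
  have hvH : IsH1Loop T v := isH1Loop_of_tendsto hT (fun k => (hf (φ k)).1)
    (fun k => henergy (φ k)) hv
  refine ⟨v, hvH, ?_, exists_minimizer_of_tendsto hT hℛ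
    (fun v hv => le_keplerAction_of_mem_h1Closure hT hM hR₀ hℛ hpos hv) (fun k => hf (φ k))
    (hfB.comp hφ.tendsto_atTop) hvH hv (fun k => hfa (φ k))⟩
  have h1 : Tendsto (fun k => ‖f k 0‖) atTop (𝓝 0) := by
    simp only [hf0]
    have := (((hβt.const_mul 2).div ((hβt.pow 2).const_add 1) (by norm_num)).const_sub
      1).const_mul a
    norm_num at this
    exact this
  exact norm_eq_zero.1 (tendsto_nhds_unique (hv 0).norm (h1.comp hφ.tendsto_atTop))

end PlatonicKepler

theorem mainTheorem5 (T : ℝ) (hT : 0 < T)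
    (ℛ : Subgroup (PlatonicKepler.E3 ≃ₗᵢ[ℝ] PlatonicKepler.E3))
    (hℛ : PlatonicKepler.IsPlatonicRotationGroup ℛ)
    (γ : ℝ → PlatonicKepler.E3)
    (hγ : ¬ PlatonicKepler.WindsAroundAtMostOneAxis T ℛ γ)
    (R₀ : PlatonicKepler.E3 ≃ₗᵢ[ℝ] PlatonicKepler.E3) (hR₀ : R₀ ∈ ℛ)
    (M : ℕ) (hM : 0 < M)
    (hne : (PlatonicKepler.cone T ℛ γ R₀ M).Nonempty)
    (hcentral : ¬ PlatonicKepler.IsCentral (PlatonicKepler.cone T ℛ γ R₀ M)) :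
    ∃ u : PlatonicKepler.l2Closure T (PlatonicKepler.cone T ℛ γ R₀ M),
      (∀ w : PlatonicKepler.l2Closure T (PlatonicKepler.cone T ℛ γ R₀ M),
        PlatonicKepler.gammaLimit T ℛ (PlatonicKepler.cone T ℛ γ R₀ M) 1 u ≤
          PlatonicKepler.gammaLimit T ℛ (PlatonicKepler.cone T ℛ γ R₀ M) 1 w) ∧
      ∃ v : ℝ → PlatonicKepler.E3, PlatonicKepler.IsH1Loop T v ∧
        PlatonicKepler.Represents T v u.1 ∧
        ((∃ t, v t = 0) ∨ PlatonicKepler.IsCircularArcLoop T ℛ v) := by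
  have hfin := hℛ.isFiniteRotationGroup
  obtain ⟨s, c, u, h⟩ := PlatonicKepler.exists_isMinimizingLimit hT hM hR₀ hfin hne
  have hpos := h.minSpeed_pos hT hM hR₀ hfin hcentral hγ
  rcases le_total (PlatonicKepler.minSpeed T ℛ γ R₀ M * (T / M)) (2 * Real.pi) with hπ | hπ
  · obtain ⟨ρ, hρ, hH, w, hw, hrep⟩ := h.exists_minimizer hT hM hR₀ hfin hpos hπ
    exact ⟨w, hw, _, hH, hrep, Or.inr (h.isCircularArcLoop hT hM hR₀ hfin hcentral hpos hρ)⟩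
  · obtain ⟨v, hH, h0, w, hw, hrep⟩ :=
      PlatonicKepler.exists_minimizer_collision hT hM hR₀ hfin hne hpos hπ
    exact ⟨w, hw, v, hH, hrep, Or.inl ⟨0, h0⟩⟩
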